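/- **Setting.** Let $T>0$, $m,d,k\in\mathbb N$. *Hölder spaces.* For a path $f$ on $[0,T]$ write $\delta f_{st}=f_t-f_s$, and for a two-parameter function $h$ write $\delta h_{sut}=h_{st}-h_{su}-h_{ut}$. For $\mu>0$, $h\in\mathcal C_2^{\mu}$ means $|h_{st}|\le C|t-s|^{\mu}$ for all $0\le s\le t\le T$ and some $C$; $f\in\mathcal C_1^{\mu}$ means $\delta f\in\mathcal C_2^{\mu}$. For $\mu>1$, $\Lambda(h)$ denotes the unique $g\in\mathcal C_2^{\mu}$ with $\delta g_{sut}=h_{sut}$ for $0\le s\le u\le t\le T$. *Rough path.* Let $\alpha>\tfrac13$, and let $(\zeta,\zeta^2)$ be a geometric $\alpha$-Hölder rough path: $\zeta\in\mathcal C_1^{\alpha}([0,T];\mathbb R^d)$, $\zeta_0=0$, $\zeta^2\in\mathcal C_2^{2\alpha}([0,T];\mathbb R^{d,d})$, $\delta\zeta^{2;ij}_{sut}=\delta\zeta^i_{su}\,\delta\zeta^j_{ut}$ and $\zeta^{2;ij}_{st}+\zeta^{2;ji}_{st}=\delta\zeta^i_{st}\,\delta\zeta^j_{st}$. *Controlled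 paths.* $\mathcal Q^\kappa_\zeta([0,T];V)$ is the set of couples $(z,z^\zeta)$ with $z\in\mathcal C_1^\kappa(V)$, $z^\zeta\in\mathcal C_1^\kappa(\mathcal L(\mathbb R^d,V))$ and remainder $\rho^z:=\delta z-z^\zeta\,\delta\zeta\in\mathcal C_2^{2\kappa}(V)$. *Controls.* Let $U\subseteq\mathbb R^k$ carry a metric $\mathsf d$ inducing its Euclidean topology, let $\mathcal P_2(U)$ be the set of Borel probability measures on $U$ with finite second moment with respect to $\mathsf d$, with the Wasserstein distance $W_2$ of $\mathsf d$, and let $\mathcal K\subset\mathcal P_2(U)$ be compact. Let $\gamma:[0,T]\to\mathcal K$ satisfy $W_2(\gamma_s,\gamma_t)\le L|t-s|^{\varepsilon}$ for all $s,t\in[0,T]$ and some $\varepsilon,L>0$. *Coefficients.* Let $b:[0,T]\times\mathbb R^m\times U\to\mathbb R^m$ be of class $\mathcal C_b^{0,1,1}$, i.e. $b$, $\partial_xb$ and $\partial_ab$ (the last taken along $U$) exist and are continuous and bounded; and let $b(u,x,a)$ be uniformly continuous in $u\in[0,T]$, with a modulus of continuity which does not depend on $a$ (it may depend on $x$). Let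 $\sigma:[0,T]\times\mathbb R^m\to\mathbb R^{m,d}$ be of class $\mathcal C_b^{1,3}$, i.e. $\partial_t\sigma$ and $\nabla_x^j\sigma$, $0\le j\le3$, exist and are continuous and bounded. Let $y\in\mathbb R^m$. *Solutions.* A solution in $\mathcal Q^\kappa_\zeta$ of $$dx_s=\int_U b(s,x_s,a)\,\gamma_s(da)\,ds+\sigma(s,x_s)\,d\zeta_s,\qquad x_0=y, \qquad (1)$$ is a controlled path $(x,x^\zeta)\in\mathcal Q^\kappa_\zeta([0,T];\mathbb R^m)$ with $x_0=y$ which equals the controlled path obtained by integrating its coefficients. That is, set $\eta_s=\int_Ub(s,x_s,a)\,\gamma_s(da)$, $w_s=\sigma(s,x_s)$, $w^\zeta_s=\nabla_x\sigma(s,x_s)\,x^\zeta_s$ and $\rho^w=\delta w-w^\zeta\delta\zeta$. Then $\eta$ is continuous, $(w,w^\zeta)\in\mathcal Q^\kappa_\zeta$, $x^\zeta_s=\sigma(s,x_s)$ on $[0,T]$ and, for all $0\le s\le t\le T$, $$\delta x_{st}=w_s\,\delta\zeta_{st}+w^\zeta_s\,\zeta^2_{st}+\int_s^t\eta_u\,du+\Lambda_{st}\big(\rho^w\,\delta\zeta+\delta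 w^\zeta\,\zeta^2\big),$$ where $\Lambda$ is taken with exponent $3\kappa>1$ and $w^\zeta\zeta^2$ has components $\sum_{i,j}w^{\zeta;\,\ell j i}\,\zeta^{2;ij}$, with $i$ the index of the derivative in the direction of $\zeta^i$ and $j$ the column index of $w$. **Statement.** For every $\kappa\in(\tfrac13,\alpha)$ with $\kappa\le\tfrac12$, equation (1) has a unique solution $(x,x^\zeta)$ in $\mathcal Q_\zeta^\kappa([0,T];\mathbb R^m)$. Moreover, $x$ is Hölder continuous of exponent $\min(\alpha,1)$. -/

import Mathlib

open MeasureTheory Set Topology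

namespace RoughControl

/-- The Euclidean space `ℝⁿ`. -/
abbrev Euc (n : ℕ) : Type := EuclideanSpace ℝ (Fin n)

section Increments

variable {V : Type*} [NormedAddCommGroup V]

/-- The increment `(δf)_{st} = f_t - f_s` of a path. -/
def delta₁ (f : ℝ → V) (s t : ℝ) : V := f t - f s

/-- The increment `(δh)_{sut} = h_{st} - h_{su} - h_{ut}` of a two-parameter function. -/
def delta₂ (h : ℝ → ℝ → V) (s u t : ℝ) : V := h s t - h s u - h u t

/-- `f ∈ C₂^μ([0,T]; V)`, that is `|f_{st}| ≤ C |t - s|^μ` on the simplex `0 ≤ s ≤ t ≤ T`.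
For `μ > 0` the case `s = t` of the bound says that `f` vanishes on the diagonal. -/
def IsHolder₂ (T μ : ℝ) (f : ℝ → ℝ → V) : Prop :=
  ∃ C : ℝ, ∀ s t : ℝ, 0 ≤ s → s ≤ t → t ≤ T → ‖f s t‖ ≤ C * (t - s) ^ μ

/-- `f ∈ C₁^μ([0,T]; V)`: the path `f` is Hölder continuous of exponent `μ` on `[0,T]`. -/
def IsHolder₁ (T μ : ℝ) (f : ℝ → V) : Prop := IsHolder₂ T μ (delta₁ f)

/-- `g = Λ(h)` in `C₂^μ([0,T]; V)`: the (for `μ > 1` unique) element `g` of `C₂^μ` whose increment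
`δg` is `h` on the simplex `0 ≤ s ≤ u ≤ t ≤ T`. -/
def IsSewing (T μ : ℝ) (h : ℝ → ℝ → ℝ → V) (g : ℝ → ℝ → V) : Prop :=
  IsHolder₂ T μ g ∧
    ∀ s u t : ℝ, 0 ≤ s → s ≤ u → u ≤ t → t ≤ T → delta₂ g s u t = h s u t

end Increments

/-- A geometric `α`-Hölder rough path `(ζ, ζ²)` over `[0,T]` with values in `ℝᵈ`, started at `0`. -/
structure IsRoughPath {d : ℕ} (T α : ℝ) (ζ : ℝ → Euc d) (ζ₂ : ℝ → ℝ → Fin d → Fin d → ℝ) :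
    Prop where
  zero : ζ 0 = 0
  holder : IsHolder₁ T α ζ
  holder_two : IsHolder₂ T (2 * α) ζ₂
  chen : ∀ s u t : ℝ, 0 ≤ s → s ≤ u → u ≤ t → t ≤ T → ∀ i j : Fin d,
    delta₂ ζ₂ s u t i j = delta₁ ζ s u i * delta₁ ζ u t j
  geometric : ∀ s t : ℝ, 0 ≤ s → s ≤ t → t ≤ T → ∀ i j : Fin d,
    ζ₂ s t i j + ζ₂ s t j i = delta₁ ζ s t i * delta₁ ζ s t j

section Controlled

variable {d : ℕ} {V : Type*} [NormedAddCommGroup V] [NormedSpace ℝ V]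

/-- The remainder `ρ_{st} = δz_{st} - z^ζ_s δζ_{st}` of a couple `(z, z^ζ)`. -/
noncomputable def remainder (ζ : ℝ → Euc d) (z : ℝ → V) (z' : ℝ → Euc d →L[ℝ] V) (s t : ℝ) : V :=
  delta₁ z s t - z' s (delta₁ ζ s t)

/-- `(z, z^ζ) ∈ Q_ζ^κ([0,T]; V)`: the path `z` is weakly controlled by `ζ`, with derivative
`z^ζ`. The boundedness of `z^ζ` follows from its Hölder continuity on `[0,T]`. -/
structure IsControlled (T κ : ℝ) (ζ : ℝ → Euc d) (z : ℝ → V) (z' : ℝ → Euc d →L[ℝ] V) :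
    Prop where
  holder : IsHolder₁ T κ z
  holder_deriv : IsHolder₁ T κ z'
  holder_remainder : IsHolder₂ T (2 * κ) (remainder ζ z z')

/-- The contraction `∑_{i,j} A(e_i)(e_j) M_{ij}` of a bilinear map with a matrix. -/
noncomputable def contract (A : Euc d →L[ℝ] Euc d →L[ℝ] V) (M : Fin d → Fin d → ℝ) : V :=
  ∑ i, ∑ j, M i j • A (EuclideanSpace.single i 1) (EuclideanSpace.single j 1)

/-- `z` is a primitive on `[0,T]` of `η_t dt + μ_t dζ_t`, for a continuous `η` and a path `μ` with
values in the linear maps `ℝᵈ → V`, weakly controlled by `ζ` with derivative `μ^ζ`: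
`δz = μ δζ + μ^ζ ζ² + ∫ η du + Λ(ρ^μ δζ + δμ^ζ ζ²)`.
Here `μ^ζ_s v` is the derivative of `μ` in the direction `v`, so that `μ^ζ_s ζ²_{st}` is
`∑_{i,j} μ^ζ_s(e_i)(e_j) ζ²_{st}^{ij}`. -/
def IsPrimitive (T κ : ℝ) (ζ : ℝ → Euc d) (ζ₂ : ℝ → ℝ → Fin d → Fin d → ℝ)
    (η : ℝ → V) (μ : ℝ → Euc d →L[ℝ] V) (μ' : ℝ → Euc d →L[ℝ] Euc d →L[ℝ] V)
    (z : ℝ → V) : Prop :=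
  ContinuousOn η (Icc 0 T) ∧ IsControlled T κ ζ μ μ' ∧
    ∃ g : ℝ → ℝ → V,
      IsSewing T (3 * κ)
        (fun s u t => remainder ζ μ μ' s u (delta₁ ζ u t) + contract (delta₁ μ' s u) (ζ₂ u t)) g ∧
      ∀ s t : ℝ, 0 ≤ s → s ≤ t → t ≤ T →
        delta₁ z s t =
          μ s (delta₁ ζ s t) + contract (μ' s) (ζ₂ s t) + (∫ u in s..t, η u) + g s t

end Controlled

/-- The controlled path `(x, x^ζ) ∈ Q_ζ^κ([0,T]; ℝᵐ)` solves
`dx = B(s, x_s) ds + σ(s, x_s) dζ_s`, `x_0 = y`: it equals the controlled path obtained by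
integrating its own coefficients. The integrand `σ(s, x_s)` has derivative `∇σ(s, x_s) x^ζ_s`, and
the integral has derivative `σ(s, x_s)`. -/
structure IsSolution {m d : ℕ} (T κ : ℝ) (ζ : ℝ → Euc d) (ζ₂ : ℝ → ℝ → Fin d → Fin d → ℝ)
    (B : ℝ → Euc m → Euc m) (σ : ℝ → Euc m → Euc d →L[ℝ] Euc m) (y : Euc m)
    (x : ℝ → Euc m) (x' : ℝ → Euc d →L[ℝ] Euc m) : Prop where
  controlled : IsControlled T κ ζ x x'
  initial : x 0 = y
  primitive : IsPrimitive T κ ζ ζ₂ (fun s => B s (x s)) (fun s => σ s (x s))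
    (fun s => (fderiv ℝ (σ s) (x s)).comp (x' s)) x
  deriv_eq : ∀ s ∈ Icc 0 T, x' s = σ s (x s)

section Coefficients

variable {m : ℕ}

/-- `σ ∈ C_b^{1,n}([0,T] × ℝᵐ; F)`: `σ`, its time derivative and its space derivatives up to order
`n` exist and are continuous and bounded on `[0,T] × ℝᵐ`. -/
structure IsCb1 {F : Type*} [NormedAddCommGroup F] [NormedSpace ℝ F] (n : ℕ) (T : ℝ)
    (σ : ℝ → Euc m → F) : Prop where
  contDiff : ∀ t ∈ Icc 0 T, ContDiff ℝ n (σ t)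
  continuousOn : ∀ j ≤ n, ContinuousOn
    (fun p : ℝ × Euc m => iteratedFDeriv ℝ j (σ p.1) p.2) (Icc 0 T ×ˢ univ)
  bounded : ∀ j ≤ n, ∃ C : ℝ, ∀ t ∈ Icc 0 T, ∀ x, ‖iteratedFDeriv ℝ j (σ t) x‖ ≤ C
  time_deriv : ∃ D : ℝ → Euc m → F,
    (∀ t ∈ Icc 0 T, ∀ x, HasDerivWithinAt (fun s => σ s x) (D t x) (Icc 0 T) t) ∧
    ContinuousOn (fun p : ℝ × Euc m => D p.1 p.2) (Icc 0 T ×ˢ univ) ∧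
    ∃ C : ℝ, ∀ t ∈ Icc 0 T, ∀ x, ‖D t x‖ ≤ C

/-- `b ∈ C_b^{0,1,1}([0,T] × ℝᵐ × U; ℝᵐ)`, where `U` is viewed as a subset of `ℝᵏ` through `ι`:
`b` is continuous and bounded, and so are its derivatives with respect to `x` and to `a`. The
derivative with respect to `a` is taken along `U`. -/
structure IsCb011 {k : ℕ} {U : Type*} [TopologicalSpace U] (ι : U → Euc k) (T : ℝ)
    (b : ℝ → Euc m → U → Euc m) : Prop where
  continuousOn : ContinuousOn (fun p : ℝ × Euc m × U => b p.1 p.2.1 p.2.2) (Icc 0 T ×ˢ univ)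
  bounded : ∃ C : ℝ, ∀ t ∈ Icc 0 T, ∀ x a, ‖b t x a‖ ≤ C
  space_deriv : ∃ D : ℝ → Euc m → U → Euc m →L[ℝ] Euc m,
    (∀ t ∈ Icc 0 T, ∀ x a, HasFDerivAt (fun z => b t z a) (D t x a) x) ∧
    ContinuousOn (fun p : ℝ × Euc m × U => D p.1 p.2.1 p.2.2) (Icc 0 T ×ˢ univ) ∧
    ∃ C : ℝ, ∀ t ∈ Icc 0 T, ∀ x a, ‖D t x a‖ ≤ C
  control_deriv : ∃ D : ℝ → Euc m → U → Euc k →L[ℝ] Euc m,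
    (∀ t ∈ Icc 0 T, ∀ x a,
      (fun a' => b t x a' - b t x a - D t x a (ι a' - ι a)) =o[𝓝 a] (fun a' => ι a' - ι a)) ∧
    ContinuousOn (fun p : ℝ × Euc m × U => D p.1 p.2.1 p.2.2) (Icc 0 T ×ˢ univ) ∧
    ∃ C : ℝ, ∀ t ∈ Icc 0 T, ∀ x a, ‖D t x a‖ ≤ C

/-- `b(u, x, a)` is uniformly continuous in `u ∈ [0,T]`, uniformly in the control `a`. -/
def IsUniformlyContinuousInTime {U : Type*} (T : ℝ) (b : ℝ → Euc m → U → Euc m) : Prop :=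
  ∀ x, ∀ ε > 0, ∃ r > 0, ∀ u ∈ Icc 0 T, ∀ v ∈ Icc 0 T, |u - v| < r →
    ∀ a, ‖b u x a - b v x a‖ < ε

end Coefficients

section Wasserstein

variable (U : Type*) [MetricSpace U] [MeasurableSpace U] [BorelSpace U]

/-- `P₂(U)`: the Borel probability measures on `U` with finite second moment. -/
def P₂ : Type _ :=
  {μ : ProbabilityMeasure U // ∃ a₀ : U, ∫⁻ a, edist a₀ a ^ 2 ∂(μ : Measure U) < ⊤}

variable {U}

/-- The underlying measure of an element of `P₂(U)`. -/
noncomputable def P₂.measure (μ : P₂ U) : Measure U := (μ.1 : Measure U)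

/-- The couplings of two elements of `P₂(U)`. -/
def couplings (μ ν : P₂ U) : Set (Measure (U × U)) :=
  {π | π.map Prod.fst = μ.measure ∧ π.map Prod.snd = ν.measure}

/-- The Wasserstein distance `W₂`. -/
noncomputable def W₂ (μ ν : P₂ U) : ENNReal :=
  ⨅ π ∈ couplings μ ν, (∫⁻ p, edist p.1 p.2 ^ 2 ∂π) ^ (1 / 2 : ℝ)

variable (U) in
/-- The topology of the distance `W₂` on `P₂(U)`: a set is open if and only if it contains a
`W₂`-ball around each of its points. -/
@[reducible] def w₂Topology : TopologicalSpace (P₂ U) where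
  IsOpen s := ∀ μ ∈ s, ∃ ε > 0, ∀ ν, W₂ μ ν < ε → ν ∈ s
  isOpen_univ := fun _ _ => ⟨1, one_pos, fun _ _ => mem_univ _⟩
  isOpen_inter := fun s t hs ht μ hμ => by
    obtain ⟨ε₁, h₁, H₁⟩ := hs μ hμ.1
    obtain ⟨ε₂, h₂, H₂⟩ := ht μ hμ.2
    exact ⟨min ε₁ ε₂, lt_min h₁ h₂, fun ν hν =>
      ⟨H₁ ν (hν.trans_le (min_le_left _ _)), H₂ ν (hν.trans_le (min_le_right _ _))⟩⟩
  isOpen_sUnion := fun S hS μ ⟨s, hs, hμ⟩ => by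
    obtain ⟨ε, h, H⟩ := hS s hs μ hμ
    exact ⟨ε, h, fun ν hν => ⟨s, hs, H ν hν⟩⟩

/-- The class `V^{ε,L}` of paths `γ : [0,T] → K` with `W₂(γ_s, γ_t) ≤ L |t - s|^ε`. -/
def controlPaths (T : ℝ) (K : Set (P₂ U)) (ε L : ℝ) : Set (ℝ → P₂ U) :=
  {γ | (∀ t ∈ Icc 0 T, γ t ∈ K) ∧
    ∀ s ∈ Icc 0 T, ∀ t ∈ Icc 0 T, W₂ (γ s) (γ t) ≤ ENNReal.ofReal (L * |t - s| ^ ε)}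

/-- The relaxed drift `(s, x) ↦ ∫ b(s, x, a) γ_s(da)`. -/
noncomputable def relaxedDrift {m : ℕ} (b : ℝ → Euc m → U → Euc m) (γ : ℝ → P₂ U)
    (s : ℝ) (x : Euc m) : Euc m :=
  ∫ a, b s x a ∂(γ s).measure

end Wasserstein

end RoughControl

set_option maxSynthPendingDepth 3

/-! The control enters only through the relaxed drift B(s, x) = ∫ b(s, x, a) γ_s(da). It is bounded
and Lipschitz in x, and it is continuous in s because W₂-convergence implies weak convergence. What
remains is a rough differential equation dx = B ds + σ dζ with a Lipschitz drift.

The central object is the defect of a path: δx minus the second-order expansion σ(x) δζ + (∇σ σ)(x)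
ζ² and minus the drift integral. With x^ζ = σ(x), being a solution amounts to this defect being of
some order larger than one. Indeed, by Chen's relation (`delta₂_germ`) the increment of the defect
is exactly the argument of Λ, which has order 3κ, and the sewing bound `norm_le_of_delta₂_le` then
raises the order of the defect itself to 3κ.

Existence follows Davie. Euler schemes on finite sets of times have zero defect between neighbours,
and a discrete sewing argument (`norm_le_of_discrete_sewing`, `exists_uniform_euler_bound`) bounds
their defect by M |t - s|^(2/3 + κ), with M independent of the set of times. A pointwise limit along
an ultrafilter of finite sets keeps this bound, so it is a solution. Regularity is then read off the
expansion: its terms have orders α, 2α and 1, and the defect has order above one.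

Uniqueness is a contraction. Two solutions are compared as controlled paths of exponent 1/3, while
the rough path has exponent κ > 1/3. On an interval of length r the surplus r^(κ - 1/3) is small, so
the distance is at most half of itself (`ControlledClose.contract`) and hence vanishes.

The exponent 1/3 is dictated by σ. No mixed space-time derivative is assumed, so the time regularity
of ∇σ and ∇²σ comes from interpolating between ∂_tσ and ∇³σ: the exponents are 2/3 and 1/3. These
are the orders required of a remainder and of an increment at exponent 1/3, and 2/3 + κ > 1 still
allows sewing. -/

namespace RoughControl

/-! ### Hölder classes and sewing bounds -/

section HolderCalculus

variable {V V₁ V₂ V₃ : Type*} [NormedAddCommGroup V] [NormedAddCommGroup V₁]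
  [NormedAddCommGroup V₂] [NormedAddCommGroup V₃]

theorem IsHolder₂.exists_nonneg {T μ : ℝ} {f : ℝ → ℝ → V} (h : IsHolder₂ T μ f) :
    ∃ C : ℝ, 0 ≤ C ∧ ∀ s t : ℝ, 0 ≤ s → s ≤ t → t ≤ T → ‖f s t‖ ≤ C * (t - s) ^ μ := by
  obtain ⟨C, hC⟩ := h
  refine ⟨max C 0, le_max_right _ _, fun s t h0 hst htT => (hC s t h0 hst htT).trans ?_⟩
  have : 0 ≤ t - s := sub_nonneg.2 hst
  gcongr
  exact le_max_left _ _

theorem IsHolder₂.mono_exponent {T μ ν : ℝ} {f : ℝ → ℝ → V} (h : IsHolder₂ T μ f) (hν : 0 < ν)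
    (hνμ : ν ≤ μ) : IsHolder₂ T ν f := by
  obtain ⟨C, hC0, hC⟩ := h.exists_nonneg
  refine ⟨C * T ^ (μ - ν), fun s t h0 hst htT => (hC s t h0 hst htT).trans ?_⟩
  have h1 : 0 ≤ t - s := sub_nonneg.2 hst
  have h2 : (t - s) ^ μ = (t - s) ^ (μ - ν) * (t - s) ^ ν := by
    rw [← Real.rpow_add_of_nonneg h1 (by linarith) hν.le]; ring_nf
  rw [h2, mul_assoc]
  gcongr
  linarith

/-- A linear combination of three terms is the shape of every expansion estimated below; absent
terms are filled with `isHolder₂_zero`. -/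
theorem isHolder₂_of_norm_le {T μ : ℝ} {f : ℝ → ℝ → V} {g₁ : ℝ → ℝ → V₁} {g₂ : ℝ → ℝ → V₂}
    {g₃ : ℝ → ℝ → V₃} (c₁ c₂ c₃ : ℝ) (hc₁ : 0 ≤ c₁) (hc₂ : 0 ≤ c₂) (hc₃ : 0 ≤ c₃)
    (h₁ : IsHolder₂ T μ g₁) (h₂ : IsHolder₂ T μ g₂) (h₃ : IsHolder₂ T μ g₃)
    (h : ∀ s t : ℝ, 0 ≤ s → s ≤ t → t ≤ T →
      ‖f s t‖ ≤ c₁ * ‖g₁ s t‖ + c₂ * ‖g₂ s t‖ + c₃ * ‖g₃ s t‖) : IsHolder₂ T μ f := by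
  obtain ⟨C₁, h₁⟩ := h₁
  obtain ⟨C₂, h₂⟩ := h₂
  obtain ⟨C₃, h₃⟩ := h₃
  refine ⟨c₁ * C₁ + c₂ * C₂ + c₃ * C₃, fun s t h0 hst htT => (h s t h0 hst htT).trans ?_⟩
  have e₁ := mul_le_mul_of_nonneg_left (h₁ s t h0 hst htT) hc₁
  have e₂ := mul_le_mul_of_nonneg_left (h₂ s t h0 hst htT) hc₂
  have e₃ := mul_le_mul_of_nonneg_left (h₃ s t h0 hst htT) hc₃
  linarith

theorem isHolder₂_sub (T : ℝ) : IsHolder₂ T 1 (fun s t : ℝ => t - s) :=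
  ⟨1, fun s t _ hst _ => by
    rw [Real.rpow_one, one_mul, Real.norm_eq_abs, abs_of_nonneg (sub_nonneg.2 hst)]⟩

theorem isHolder₂_zero (T μ : ℝ) : IsHolder₂ T μ (fun _ _ : ℝ => (0 : ℝ)) :=
  ⟨0, fun s t _ _ _ => by simp⟩

theorem IsHolder₂.norm_mul_norm {T μ ν : ℝ} {f : ℝ → ℝ → V₁} {g : ℝ → ℝ → V₂}
    (hf : IsHolder₂ T μ f) (hg : IsHolder₂ T ν g) (hμ : 0 < μ) (hν : 0 < ν) :
    IsHolder₂ T (μ + ν) (fun s t => ‖f s t‖ * ‖g s t‖) := by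
  obtain ⟨C, hC0, hC⟩ := hf.exists_nonneg
  obtain ⟨D, hD0, hD⟩ := hg.exists_nonneg
  refine ⟨C * D, fun s t h0 hst htT => ?_⟩
  have h1 : 0 ≤ t - s := sub_nonneg.2 hst
  rw [Real.rpow_add_of_nonneg h1 hμ.le hν.le, norm_mul, norm_norm, norm_norm]
  calc ‖f s t‖ * ‖g s t‖ ≤ (C * (t - s) ^ μ) * (D * (t - s) ^ ν) :=
        mul_le_mul (hC s t h0 hst htT) (hD s t h0 hst htT) (norm_nonneg _) (by positivity)
    _ = _ := by ring

/-- A bounded two-parameter function with a Hölder bound near the diagonal is Hölder. -/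
theorem isHolder₂_of_local {T μ τ C D : ℝ} (hμ : 0 < μ) (hτ : 0 < τ) {f : ℝ → ℝ → V}
    (hC : ∀ s t : ℝ, 0 ≤ s → s ≤ t → t ≤ T → t - s ≤ τ → ‖f s t‖ ≤ C * (t - s) ^ μ)
    (hD : ∀ s t : ℝ, 0 ≤ s → s ≤ t → t ≤ T → ‖f s t‖ ≤ D) : IsHolder₂ T μ f := by
  refine ⟨max C (D / τ ^ μ), fun s t h0 hst htT => ?_⟩
  have h1 : 0 ≤ t - s := sub_nonneg.2 hst
  rcases le_or_gt (t - s) τ with h | h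
  · refine (hC s t h0 hst htT h).trans ?_
    gcongr
    exact le_max_left _ _
  · have hD0 : 0 ≤ D := (norm_nonneg _).trans (hD s t h0 hst htT)
    have hτμ : 0 < τ ^ μ := Real.rpow_pos_of_pos hτ _
    calc ‖f s t‖ ≤ D := hD s t h0 hst htT
      _ = D / τ ^ μ * τ ^ μ := by field_simp
      _ ≤ D / τ ^ μ * (t - s) ^ μ := by gcongr
      _ ≤ _ := by gcongr; exact le_max_right _ _

theorem IsHolder₁.continuousOn {T μ : ℝ} {f : ℝ → V} (hμ : 0 < μ) (hf : IsHolder₁ T μ f) :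
    ContinuousOn f (Icc 0 T) := by
  obtain ⟨C, hC0, hC⟩ := IsHolder₂.exists_nonneg hf
  have key : ∀ s ∈ Icc 0 T, ∀ t ∈ Icc 0 T, ‖f t - f s‖ ≤ C * |t - s| ^ μ := by
    intro s hs t ht
    rcases le_total s t with h | h
    · rw [abs_of_nonneg (sub_nonneg.2 h)]
      exact hC s t hs.1 h ht.2
    · rw [abs_sub_comm, abs_of_nonneg (sub_nonneg.2 h), norm_sub_rev]
      exact hC t s ht.1 h hs.2
  intro s hs
  rw [ContinuousWithinAt, tendsto_iff_norm_sub_tendsto_zero]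
  refine squeeze_zero' (Filter.Eventually.of_forall fun _ => norm_nonneg _)
    (eventually_nhdsWithin_of_forall fun t ht => key s hs t ht) ?_
  have : Filter.Tendsto (fun t : ℝ => C * |t - s| ^ μ) (𝓝 s) (𝓝 (C * |s - s| ^ μ)) := by
    apply Filter.Tendsto.const_mul
    exact ((continuous_abs.comp (continuous_id.sub continuous_const)).tendsto s).rpow_const
      (Or.inr hμ.le)
  rw [sub_self, abs_zero, Real.zero_rpow hμ.ne', mul_zero] at this
  exact this.mono_left nhdsWithin_le_nhds

theorem two_mul_half_rpow_lt_one {ρ : ℝ} (hρ : 1 < ρ) : (2 : ℝ) * (1 / 2) ^ ρ < 1 := by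
  have : ((1 : ℝ) / 2) ^ ρ < (1 / 2) ^ (1 : ℝ) :=
    Real.rpow_lt_rpow_of_exponent_gt (by norm_num) (by norm_num) hρ
  rw [Real.rpow_one] at this
  linarith

/-- The sewing bound: a two-parameter function of order `μ > 1` is controlled by its increment. -/
theorem norm_le_of_delta₂_le {a b μ ν K N : ℝ} (hμ : 1 < μ) (hν : 1 < ν) (hN : 0 ≤ N)
    {g : ℝ → ℝ → V}
    (hK : ∀ s t : ℝ, a ≤ s → s ≤ t → t ≤ b → ‖g s t‖ ≤ K * (t - s) ^ μ)
    (h : ∀ s u t : ℝ, a ≤ s → s ≤ u → u ≤ t → t ≤ b → ‖delta₂ g s u t‖ ≤ N * (t - s) ^ ν) :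
    ∀ s t : ℝ, a ≤ s → s ≤ t → t ≤ b → ‖g s t‖ ≤ N / (1 - 2 * (1 / 2) ^ ν) * (t - s) ^ ν := by
  have hν' := two_mul_half_rpow_lt_one hν
  have hμ' := two_mul_half_rpow_lt_one hμ
  set A := N / (1 - 2 * (1 / 2) ^ ν) with hA
  have hA0 : 0 ≤ A := div_nonneg hN (by linarith)
  -- `A` is the fixed point of one bisection: two halves at order ν plus the increment at the
  -- midpoint.
  have hAN : 2 * (1 / 2) ^ ν * A + N = A := by
    have : 1 - (2 : ℝ) * (1 / 2) ^ ν ≠ 0 := by linarith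
    rw [hA]; field_simp; ring
  -- Each bisection multiplies the a priori term by 2 (1/2)^μ < 1. The constant `K` and the order μ
  -- therefore disappear in the limit.
  have step : ∀ n : ℕ, ∀ s t : ℝ, a ≤ s → s ≤ t → t ≤ b →
      ‖g s t‖ ≤ A * (t - s) ^ ν + (2 * (1 / 2) ^ μ) ^ n * (K * (t - s) ^ μ) := by
    intro n
    induction n with
    | zero =>
      intro s t h0 hst htT
      have h1 : 0 ≤ t - s := sub_nonneg.2 hst
      have := hK s t h0 hst htT
      rw [pow_zero, one_mul]
      have : 0 ≤ A * (t - s) ^ ν := by positivity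
      linarith
    | succ n ih =>
      intro s t h0 hst htT
      have h1 : 0 ≤ t - s := sub_nonneg.2 hst
      have i₁ := ih s ((s + t) / 2) h0 (by linarith) (by linarith)
      have i₂ := ih ((s + t) / 2) t (by linarith) (by linarith) htT
      have i₃ := h s ((s + t) / 2) t h0 (by linarith) (by linarith) htT
      have e₁ : (s + t) / 2 - s = 1 / 2 * (t - s) := by ring
      have e₂ : t - (s + t) / 2 = 1 / 2 * (t - s) := by ring
      rw [e₁, Real.mul_rpow (by norm_num) h1, Real.mul_rpow (by norm_num) h1] at i₁
      rw [e₂, Real.mul_rpow (by norm_num) h1, Real.mul_rpow (by norm_num) h1] at i₂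
      have i₄ := norm_add₃_le (a := delta₂ g s ((s + t) / 2) t) (b := g s ((s + t) / 2))
        (c := g ((s + t) / 2) t)
      have e : g s t = delta₂ g s ((s + t) / 2) t + g s ((s + t) / 2) + g ((s + t) / 2) t := by
        simp only [delta₂]; abel
      calc ‖g s t‖ ≤ _ := (congrArg _ e).le
        _ ≤ (2 * (1 / 2) ^ ν * A + N) * (t - s) ^ ν +
            (2 * (1 / 2) ^ μ) ^ (n + 1) * (K * (t - s) ^ μ) := by
          rw [pow_succ]
          linarith only [i₁, i₂, i₃, i₄]
        _ = _ := by rw [hAN]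
  intro s t h0 hst htT
  have lim : Filter.Tendsto (fun n : ℕ => A * (t - s) ^ ν +
      (2 * (1 / 2) ^ μ) ^ n * (K * (t - s) ^ μ)) Filter.atTop
      (𝓝 (A * (t - s) ^ ν + 0 * (K * (t - s) ^ μ))) :=
    ((tendsto_pow_atTop_nhds_zero_of_lt_one (by positivity) hμ').mul_const _).const_add _
  rw [zero_mul, add_zero] at lim
  exact ge_of_tendsto' lim fun n => step n s t h0 hst htT

/-- The discrete sewing bound, over a finite partition `P`: a two-parameter function which vanishes
on consecutive points of `P` is controlled by its increment. The increment may be estimated with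
the help of the bound on smaller intervals. -/
theorem norm_le_of_discrete_sewing {P : Finset ℝ} {μ τ M c : ℝ} (hM : 0 ≤ M) (hc : 0 ≤ c)
    (hμ : 0 ≤ μ) (hcM : 2 * (1 / 2) ^ μ * M + 2 * c ≤ M) {e : ℝ → ℝ → V}
    (hdiag : ∀ s ∈ P, e s s = 0)
    (hcons : ∀ s ∈ P, ∀ t ∈ P, s < t → (∀ u ∈ P, ¬ (s < u ∧ u < t)) → e s t = 0)
    (hdelta : ∀ s ∈ P, ∀ u ∈ P, ∀ t ∈ P, s ≤ u → u ≤ t → t - s ≤ τ →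
      ‖e s u‖ ≤ M * (u - s) ^ μ → ‖delta₂ e s u t‖ ≤ c * (t - s) ^ μ) :
    ∀ s ∈ P, ∀ t ∈ P, s ≤ t → t - s ≤ τ → ‖e s t‖ ≤ M * (t - s) ^ μ := by
  -- Strong induction on the number of points of `P` strictly between `s` and `t`.
  suffices H : ∀ n : ℕ, ∀ s ∈ P, ∀ t ∈ P, s ≤ t → t - s ≤ τ →
      (P.filter fun u => s < u ∧ u < t).card = n → ‖e s t‖ ≤ M * (t - s) ^ μ from
    fun s hs t ht hst hτ => H _ s hs t ht hst hτ rfl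
  intro n
  induction n using Nat.strong_induction_on with
  | _ n ih =>
  intro s hs t ht hst hτ hn
  have hr : 0 ≤ (t - s) ^ μ := Real.rpow_nonneg (sub_nonneg.2 hst) _
  rcases hst.eq_or_lt with rfl | hlt
  · rw [hdiag s hs, norm_zero]; positivity
  by_cases hne : ∀ u ∈ P, ¬ (s < u ∧ u < t)
  · rw [hcons s hs t ht hlt hne, norm_zero]; positivity
  push Not at hne
  obtain ⟨v, hv, hsv, hvt⟩ := hne
  have smaller : ∀ a ∈ P, ∀ b ∈ P, s ≤ a → a ≤ b → b ≤ t → (s < a ∨ b < t) →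
      ‖e a b‖ ≤ M * (b - a) ^ μ := by
    intro a ha b hb hsa hab hbt hor
    rcases hab.eq_or_lt with rfl | hab'
    · rw [hdiag a ha, norm_zero]
      exact mul_nonneg hM (Real.rpow_nonneg (by simp) _)
    refine ih _ ?_ a ha b hb hab (by linarith) rfl
    rw [← hn]
    apply Finset.card_lt_card
    rw [Finset.ssubset_iff_of_subset]
    · rcases hor with h | h
      · exact ⟨a, by simp [ha, h, hab'.trans_le hbt], by simp⟩
      · exact ⟨b, by simp [hb, h, hsa.trans_lt hab'], by simp⟩
    · intro u hu
      simp only [Finset.mem_filter] at hu ⊢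
      exact ⟨hu.1, hsa.trans_lt hu.2.1, hu.2.2.trans_le hbt⟩
  -- The midpoint need not lie in `P`. The neighbours k ≤ m < l in `P` replace it: `e k l` vanishes,
  -- and both [s, k] and [l, t] have at most half the length. This costs two increments instead of
  -- one, hence the term 2c in `hcM`.
  set m := (s + t) / 2 with hm
  obtain ⟨k, hk, hkmax⟩ := (P.filter fun u => u ≤ m).exists_max_image id
    ⟨s, by simp only [Finset.mem_filter]; exact ⟨hs, by linarith⟩⟩
  obtain ⟨l, hl, hlmin⟩ := (P.filter fun u => m < u).exists_min_image id
    ⟨t, by simp only [Finset.mem_filter]; exact ⟨ht, by linarith⟩⟩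
  simp only [Finset.mem_filter, id, and_imp] at hk hkmax hl hlmin
  have hsk : s ≤ k := hkmax s hs (by linarith)
  have hlt' : l ≤ t := hlmin t ht (by linarith)
  have hkl : k < l := hk.2.trans_lt hl.2
  have e0 : e k l = 0 := hcons k hk.1 l hl.1 hkl fun u hu ⟨h1, h2⟩ => by
    rcases le_or_gt u m with h | h
    · exact absurd (hkmax u hu h) (not_le.2 h1)
    · exact absurd (hlmin u hu h) (not_le.2 h2)
  have hkt : k < t := by linarith [hk.2]
  have hsl : s < l := by linarith [hl.2]
  have b₁ : ‖e s k‖ ≤ M * (1 / 2 * (t - s)) ^ μ := by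
    refine (smaller s hs k hk.1 le_rfl hsk hkt.le (Or.inr hkt)).trans ?_
    gcongr
    linarith [hk.2]
  have b₂ : ‖e l t‖ ≤ M * (1 / 2 * (t - s)) ^ μ := by
    refine (smaller l hl.1 t ht hsl.le hlt' le_rfl (Or.inl hsl)).trans ?_
    gcongr
    linarith [hl.2]
  have d₁ : ‖delta₂ e s k l‖ ≤ c * (t - s) ^ μ := by
    refine (hdelta s hs k hk.1 l hl.1 hsk hkl.le (by linarith)
      (smaller s hs k hk.1 le_rfl hsk hkt.le (Or.inr hkt))).trans ?_
    gcongr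
  have d₂ : ‖delta₂ e s l t‖ ≤ c * (t - s) ^ μ := by
    -- If l = t, the induction hypothesis is not available on [s, l], but the increment is trivially
    -- zero.
    rcases hlt'.eq_or_lt with rfl | h
    · simp only [delta₂, hdiag l ht, sub_self, norm_zero]
      positivity
    · exact hdelta s hs l hl.1 t ht hsl.le hlt' hτ (smaller s hs l hl.1 le_rfl hsl.le hlt' (Or.inr h))
  rw [Real.mul_rpow (by norm_num) (sub_nonneg.2 hst)] at b₁ b₂
  have hsum : e s t = delta₂ e s l t + delta₂ e s k l + e s k + e l t := by
    simp only [delta₂, e0]; abel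
  calc ‖e s t‖ ≤ ‖delta₂ e s l t‖ + ‖delta₂ e s k l‖ + ‖e s k‖ + ‖e l t‖ := by
        rw [hsum]; exact norm_add₄_le
    _ ≤ (2 * (1 / 2) ^ μ * M + 2 * c) * (t - s) ^ μ := by linarith
    _ ≤ M * (t - s) ^ μ := by gcongr

end HolderCalculus

/-! ### Contraction with the area and Chen's relation -/

section Contract

variable {d : ℕ} {V : Type*} [NormedAddCommGroup V] [NormedSpace ℝ V]

theorem contract_sub_left (A B : Euc d →L[ℝ] Euc d →L[ℝ] V) (M : Fin d → Fin d → ℝ) :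
    contract (A - B) M = contract A M - contract B M := by
  simp [contract, smul_sub, Finset.sum_sub_distrib]

theorem contract_outer (A : Euc d →L[ℝ] Euc d →L[ℝ] V) (v w : Euc d) :
    contract A (fun i j => v i * w j) = A v w := by
  have hv : ∀ v : Euc d, v = ∑ i, v i • EuclideanSpace.single i (1 : ℝ) := fun v => by
    simpa using ((EuclideanSpace.basisFun (Fin d) ℝ).sum_repr v).symm
  conv_rhs => rw [hv v, hv w]
  simp only [contract, map_sum, map_smul, sum_apply,
    smul_apply, Finset.smul_sum, smul_smul]
  rw [Finset.sum_comm]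
  simp only [mul_comm]

theorem norm_contract_le (A : Euc d →L[ℝ] Euc d →L[ℝ] V) (M : Fin d → Fin d → ℝ) :
    ‖contract A M‖ ≤ (d * d : ℝ) * (‖A‖ * ‖M‖) := by
  refine (norm_sum_le _ _).trans ?_
  have : ∀ i ∈ (Finset.univ : Finset (Fin d)),
      ‖∑ j, M i j • A (EuclideanSpace.single i 1) (EuclideanSpace.single j 1)‖ ≤
        d * (‖A‖ * ‖M‖) := by
    intro i _
    refine (norm_sum_le _ _).trans ?_
    have : ∀ j ∈ (Finset.univ : Finset (Fin d)),
        ‖M i j • A (EuclideanSpace.single i 1) (EuclideanSpace.single j 1)‖ ≤ ‖A‖ * ‖M‖ := by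
      intro j _
      rw [norm_smul, mul_comm]
      have h1 := A.le_opNorm₂ (EuclideanSpace.single i 1) (EuclideanSpace.single j 1)
      simp only [PiLp.norm_single, norm_one, mul_one] at h1
      exact mul_le_mul h1 ((norm_le_pi_norm (M i) j).trans (norm_le_pi_norm M i)) (norm_nonneg _)
        A.opNorm_nonneg
    refine (Finset.sum_le_sum this).trans ?_
    simp
  refine (Finset.sum_le_sum this).trans ?_
  simp [mul_assoc]

theorem continuous_contract_left (M : Fin d → Fin d → ℝ) :
    Continuous fun A : Euc d →L[ℝ] Euc d →L[ℝ] V => contract A M := by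
  unfold contract
  fun_prop

/-- The increment of the second-order germ `μ δζ + μ^ζ ζ²`. -/
theorem delta₂_germ {T α : ℝ} {ζ : ℝ → Euc d} {ζ₂ : ℝ → ℝ → Fin d → Fin d → ℝ}
    (hζ : IsRoughPath T α ζ ζ₂) (μ : ℝ → Euc d →L[ℝ] V) (μ' : ℝ → Euc d →L[ℝ] Euc d →L[ℝ] V)
    {s u t : ℝ} (h0 : 0 ≤ s) (hsu : s ≤ u) (hut : u ≤ t) (htT : t ≤ T) :
    delta₂ (fun s t => μ s (delta₁ ζ s t) + contract (μ' s) (ζ₂ s t)) s u t =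
      -(remainder ζ μ μ' s u (delta₁ ζ u t) + contract (delta₁ μ' s u) (ζ₂ u t)) := by
  -- The outer product in Chen's relation contributes μ^ζ_s δζ_su δζ_ut, which turns the increment
  -- of μ into its controlled remainder.
  have chen : ζ₂ s t = ζ₂ s u + ζ₂ u t + fun i j => delta₁ ζ s u i * delta₁ ζ u t j := by
    funext i j
    have := hζ.chen s u t h0 hsu hut htT i j
    simp only [delta₂, Pi.sub_apply] at this
    simp only [Pi.add_apply]
    linarith
  have e : contract (μ' s) (ζ₂ s t) = contract (μ' s) (ζ₂ s u) + contract (μ' s) (ζ₂ u t) +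
      μ' s (delta₁ ζ s u) (delta₁ ζ u t) := by
    rw [← contract_outer, chen]
    simp only [contract, Pi.add_apply, add_smul, Finset.sum_add_distrib]
  have hd : delta₁ ζ s t = delta₁ ζ s u + delta₁ ζ u t := by simp [delta₁]
  simp only [delta₂, remainder, e, hd, map_add, sub_apply]
  simp only [delta₁, contract_sub_left, sub_apply]
  abel

end Contract

/-! ### Mean value, Taylor and interpolation inequalities -/

section MeanValue

variable {E V : Type*} [NormedAddCommGroup E] [NormedSpace ℝ E] [NormedAddCommGroup V]
  [NormedSpace ℝ V]

theorem hasDerivAt_comp_line {g : E → V} {g₁ : E → E →L[ℝ] V} (hg : ∀ x, HasFDerivAt g (g₁ x) x)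
    (x v : E) (r : ℝ) : HasDerivAt (fun r : ℝ => g (x + r • v)) (g₁ (x + r • v) v) r := by
  have h : HasDerivAt (fun r : ℝ => x + r • v) v r := by
    simpa using ((hasDerivAt_id r).smul_const v).const_add x
  exact (hg _).comp_hasDerivAt r h

theorem norm_line_sub_line_le {r : ℝ} (hr : r ∈ Icc (0 : ℝ) 1) (a b a' b' : E) :
    ‖(b + r • (a - b)) - (b' + r • (a' - b'))‖ ≤ ‖a - a'‖ + ‖b - b'‖ := by
  have e : (b + r • (a - b)) - (b' + r • (a' - b')) = r • (a - a') + (1 - r) • (b - b') := by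
    simp only [smul_sub, sub_smul, one_smul]; abel
  rw [e]
  refine (norm_add_le _ _).trans ?_
  rw [norm_smul, norm_smul, Real.norm_of_nonneg hr.1, Real.norm_of_nonneg (sub_nonneg.2 hr.2)]
  have h1 := norm_nonneg (a - a')
  have h2 := norm_nonneg (b - b')
  nlinarith [hr.1, hr.2]

/-- The second-order increment of a function with bounded Lipschitz derivative. -/
theorem norm_four_point_le {g : E → V} {g₁ : E → E →L[ℝ] V} {C : ℝ}
    (hg : ∀ x, HasFDerivAt g (g₁ x) x) (hC : ∀ x, ‖g₁ x‖ ≤ C)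
    (hL : ∀ x y, ‖g₁ x - g₁ y‖ ≤ C * ‖x - y‖) (a b a' b' : E) :
    ‖(g a - g b) - (g a' - g b')‖ ≤
      C * ‖(a - b) - (a' - b')‖ + C * (‖a - a'‖ + ‖b - b'‖) * ‖a - b‖ := by
  have hC0 : 0 ≤ C := (norm_nonneg _).trans (hC a)
  have := norm_image_sub_le_of_norm_deriv_le_segment_01'
    (f := fun r : ℝ => g (b + r • (a - b)) - g (b' + r • (a' - b')))
    (f' := fun r => g₁ (b + r • (a - b)) (a - b) - g₁ (b' + r • (a' - b')) (a' - b'))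
    (C := C * ‖(a - b) - (a' - b')‖ + C * (‖a - a'‖ + ‖b - b'‖) * ‖a - b‖)
    (fun r _ => ((hasDerivAt_comp_line hg _ _ r).sub
      (hasDerivAt_comp_line hg _ _ r)).hasDerivWithinAt) ?_
  · simp only [one_smul, zero_smul, add_sub_cancel, add_zero] at this
    convert this using 2
    abel
  · intro r hr
    have e : g₁ (b + r • (a - b)) (a - b) - g₁ (b' + r • (a' - b')) (a' - b') =
        g₁ (b' + r • (a' - b')) ((a - b) - (a' - b')) +
          (g₁ (b + r • (a - b)) - g₁ (b' + r • (a' - b'))) (a - b) := by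
      simp only [map_sub, sub_apply]; abel
    rw [e]
    refine (norm_add_le _ _).trans (add_le_add ?_ ?_)
    · exact ContinuousLinearMap.le_of_opNorm_le _ (hC _) _
    · refine (ContinuousLinearMap.le_opNorm _ _).trans ?_
      gcongr
      refine (hL _ _).trans ?_
      gcongr
      exact norm_line_sub_line_le ⟨hr.1, hr.2.le⟩ _ _ _ _

/-- The first-order Taylor bound for a function with Lipschitz derivative. -/
theorem norm_taylor_le {g : E → V} {g₁ : E → E →L[ℝ] V} {C : ℝ} (hC0 : 0 ≤ C)
    (hg : ∀ x, HasFDerivAt g (g₁ x) x)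
    (hL : ∀ x y, ‖g₁ x - g₁ y‖ ≤ C * ‖x - y‖) (a b : E) :
    ‖g a - g b - g₁ b (a - b)‖ ≤ C * ‖a - b‖ ^ 2 := by
  have := norm_image_sub_le_of_norm_deriv_le_segment_01'
    (f := fun r : ℝ => g (b + r • (a - b)) - r • g₁ b (a - b))
    (f' := fun r => g₁ (b + r • (a - b)) (a - b) - (1 : ℝ) • g₁ b (a - b))
    (C := C * ‖a - b‖ ^ 2)
    (fun r _ => ((hasDerivAt_comp_line hg _ _ r).sub
      ((hasDerivAt_id r).smul_const _)).hasDerivWithinAt) ?_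
  · simp only [one_smul, zero_smul, add_sub_cancel, add_zero, sub_zero] at this
    convert this using 2
    abel
  · intro r hr
    rw [one_smul, ← sub_apply, pow_two, ← mul_assoc]
    refine (ContinuousLinearMap.le_opNorm _ _).trans ?_
    gcongr
    refine (hL _ _).trans ?_
    gcongr
    rw [add_sub_cancel_left, norm_smul, Real.norm_of_nonneg hr.1]
    exact mul_le_of_le_one_left (norm_nonneg _) hr.2.le

/-- The difference of two first-order Taylor remainders. -/
theorem norm_taylor_sub_taylor_le {g : E → V} {g₁ : E → E →L[ℝ] V} {g₂ : E → E →L[ℝ] E →L[ℝ] V}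
    {C : ℝ} (hg : ∀ x, HasFDerivAt g (g₁ x) x) (hg₁ : ∀ x, HasFDerivAt g₁ (g₂ x) x)
    (hC : ∀ x, ‖g₂ x‖ ≤ C) (hL₁ : ∀ x y, ‖g₁ x - g₁ y‖ ≤ C * ‖x - y‖)
    (hL : ∀ x y, ‖g₂ x - g₂ y‖ ≤ C * ‖x - y‖) (a b a' b' : E) :
    ‖(g a - g b - g₁ b (a - b)) - (g a' - g b' - g₁ b' (a' - b'))‖ ≤
      C * (‖a - b‖ + ‖a' - b'‖) * ‖(a - b) - (a' - b')‖ +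
        C * (‖a - a'‖ + 2 * ‖b - b'‖) * ‖a - b‖ ^ 2 := by
  have hC0 : 0 ≤ C := (g₂ a).opNorm_nonneg.trans (hC a)
  have := norm_image_sub_le_of_norm_deriv_le_segment_01'
    (f := fun r : ℝ => (g (b + r • (a - b)) - r • g₁ b (a - b)) -
      (g (b' + r • (a' - b')) - r • g₁ b' (a' - b')))
    (f' := fun r => (g₁ (b + r • (a - b)) (a - b) - (1 : ℝ) • g₁ b (a - b)) -
      (g₁ (b' + r • (a' - b')) (a' - b') - (1 : ℝ) • g₁ b' (a' - b')))
    (C := C * (‖a - b‖ + ‖a' - b'‖) * ‖(a - b) - (a' - b')‖ +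
        C * (‖a - a'‖ + 2 * ‖b - b'‖) * ‖a - b‖ ^ 2)
    (fun r _ => (((hasDerivAt_comp_line hg _ _ r).sub
      ((hasDerivAt_id r).smul_const _)).sub ((hasDerivAt_comp_line hg _ _ r).sub
      ((hasDerivAt_id r).smul_const _))).hasDerivWithinAt) ?_
  · simp only [one_smul, zero_smul, add_sub_cancel, add_zero, sub_zero] at this
    convert this using 2
    abel
  · intro r hr
    have e : (g₁ (b + r • (a - b)) (a - b) - (1 : ℝ) • g₁ b (a - b)) -
        (g₁ (b' + r • (a' - b')) (a' - b') - (1 : ℝ) • g₁ b' (a' - b')) =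
        ((g₁ (b + r • (a - b)) - g₁ b) - (g₁ (b' + r • (a' - b')) - g₁ b')) (a - b) +
          (g₁ (b' + r • (a' - b')) - g₁ b') ((a - b) - (a' - b')) := by
      simp only [map_sub, sub_apply, one_smul]; abel
    -- The derivative along the segments is a second-order increment of `g₁`, so the four-point
    -- bound applies one order higher.
    have f₁ := norm_four_point_le hg₁ hC hL (b + r • (a - b)) b (b' + r • (a' - b')) b'
    have f₂ := hL₁ (b' + r • (a' - b')) b'
    have f₃ := norm_line_sub_line_le ⟨hr.1, hr.2.le⟩ a b a' b'
    simp only [add_sub_cancel_left, ← smul_sub] at f₁ f₂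
    simp only [norm_smul, Real.norm_of_nonneg hr.1] at f₁ f₂
    have f₄ : ‖(g₁ (b + r • (a - b)) - g₁ b) - (g₁ (b' + r • (a' - b')) - g₁ b')‖ ≤
        C * ‖(a - b) - (a' - b')‖ + C * (‖a - a'‖ + 2 * ‖b - b'‖) * ‖a - b‖ := by
      refine f₁.trans (add_le_add ?_ ?_)
      · gcongr
        exact mul_le_of_le_one_left (norm_nonneg _) hr.2.le
      · have : r * ‖a - b‖ ≤ ‖a - b‖ := mul_le_of_le_one_left (norm_nonneg _) hr.2.le
        have hr0 := hr.1
        have : ‖b + r • (a - b) - (b' + r • (a' - b'))‖ + ‖b - b'‖ ≤ ‖a - a'‖ + 2 * ‖b - b'‖ := by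
          linarith
        gcongr
    have f₅ : ‖g₁ (b' + r • (a' - b')) - g₁ b'‖ ≤ C * ‖a' - b'‖ := by
      refine f₂.trans ?_
      gcongr
      exact mul_le_of_le_one_left (norm_nonneg _) hr.2.le
    rw [e]
    calc _ ≤ _ := norm_add_le _ _
      _ ≤ (C * ‖(a - b) - (a' - b')‖ + C * (‖a - a'‖ + 2 * ‖b - b'‖) * ‖a - b‖) * ‖a - b‖ +
          C * ‖a' - b'‖ * ‖(a - b) - (a' - b')‖ :=
        add_le_add (ContinuousLinearMap.le_of_opNorm_le _ f₄ _)
          (ContinuousLinearMap.le_of_opNorm_le _ f₅ _)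
      _ = _ := by ring

theorem norm_fderiv_sub_fderiv_le {g : E → V} {C : ℝ} (hg : ContDiff ℝ 2 g)
    (hC : ∀ x, ‖iteratedFDeriv ℝ 2 g x‖ ≤ C) (x y : E) :
    ‖fderiv ℝ g x - fderiv ℝ g y‖ ≤ C * ‖x - y‖ := by
  have hd : Differentiable ℝ (fderiv ℝ g) :=
    (hg.fderiv_right (m := 1) (by norm_num)).differentiable (by norm_num)
  refine convex_univ.norm_image_sub_le_of_norm_hasFDerivWithin_le
    (fun z _ => (hd z).hasFDerivAt.hasFDerivWithinAt) (fun z _ => ?_) trivial trivial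
  have := hC z
  rwa [← norm_iteratedFDeriv_fderiv, norm_iteratedFDeriv_one] at this

/-- Interpolation of the first derivative between a function and its third-order modulus. -/
theorem norm_fderiv_le_of_interpolation {f : E → V} {f₁ : E → E →L[ℝ] V}
    {f₂ : E → E →L[ℝ] E →L[ℝ] V} {C h : ℝ} (hf : ∀ x, HasFDerivAt f (f₁ x) x)
    (hf₁ : ∀ x, HasFDerivAt f₁ (f₂ x) x) (hC : 0 ≤ C) (hh : 0 < h)
    (hL : ∀ x y, ‖f₂ x - f₂ y‖ ≤ C * ‖x - y‖) (hb : ∀ x, ‖f x‖ ≤ C * h ^ 3) (x : E) :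
    ‖f₁ x‖ ≤ 2 * C * h ^ 2 := by
  refine ContinuousLinearMap.opNorm_le_of_unit_norm (by positivity) fun v hv => ?_
  -- The symmetric second difference of `f₁` vanishes at r = 0, and its derivative is a difference
  -- of `f₂` at two points at distance 2r.
  have second : ∀ r ∈ Icc 0 h,
      ‖(f₁ (x + r • v) + f₁ (x + r • (-v)) - (2 : ℝ) • f₁ x)‖ ≤ 2 * C * h ^ 2 := by
    intro r hr
    have := norm_image_sub_le_of_norm_deriv_le_segment' (a := 0) (b := h)
      (f := fun r : ℝ => f₁ (x + r • v) + f₁ (x + r • (-v)))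
      (f' := fun r => f₂ (x + r • v) v + f₂ (x + r • (-v)) (-v)) (C := 2 * C * h)
      (fun r _ => ((hasDerivAt_comp_line hf₁ _ _ r).add
        (hasDerivAt_comp_line hf₁ _ _ r)).hasDerivWithinAt) ?_ r hr
    · simp only [zero_smul, add_zero, sub_zero] at this
      rw [two_smul]
      refine this.trans ?_
      rw [pow_two, ← mul_assoc]
      gcongr
      exact hr.2
    · intro q hq
      rw [map_neg, ← sub_eq_add_neg, ← sub_apply]
      refine (ContinuousLinearMap.le_opNorm _ _).trans ?_
      rw [hv, mul_one]
      refine (hL _ _).trans ?_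
      rw [add_sub_add_left_eq_sub, ← smul_sub, sub_neg_eq_add, norm_smul,
        Real.norm_of_nonneg hq.1, ← two_smul ℝ v, norm_smul, hv]
      norm_num
      nlinarith [hq.2]
  -- In the central difference of `f` the second-order Taylor term cancels. The error has order h³,
  -- as does the bound on `f`, and division by 2h gives h².
  have := norm_image_sub_le_of_norm_deriv_le_segment' (a := 0) (b := h)
    (f := fun r : ℝ => f (x + r • v) - f (x + r • (-v)) - r • (2 : ℝ) • f₁ x v)
    (f' := fun r => f₁ (x + r • v) v - f₁ (x + r • (-v)) (-v) - (1 : ℝ) • (2 : ℝ) • f₁ x v)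
    (C := 2 * C * h ^ 2)
    (fun r _ => (((hasDerivAt_comp_line hf _ _ r).sub (hasDerivAt_comp_line hf _ _ r)).sub
      ((hasDerivAt_id r).smul_const _)).hasDerivWithinAt) ?_ h ⟨hh.le, le_rfl⟩
  · simp only [zero_smul, add_zero, sub_zero, sub_self] at this
    have e : (2 * h) • f₁ x v = f (x + h • v) - f (x + h • (-v)) -
        (f (x + h • v) - f (x + h • (-v)) - h • (2 : ℝ) • f₁ x v) := by
      rw [smul_smul, mul_comm]; abel
    have n : ‖(2 * h) • f₁ x v‖ ≤ C * h ^ 3 + C * h ^ 3 + 2 * C * h ^ 2 * h := by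
      rw [e]
      refine (norm_sub_le _ _).trans (add_le_add ((norm_sub_le _ _).trans ?_) this)
      exact add_le_add (hb _) (hb _)
    rw [norm_smul, Real.norm_of_nonneg (by positivity)] at n
    have : 2 * h * ‖f₁ x v‖ ≤ 2 * h * (2 * C * h ^ 2) := by linarith
    exact le_of_mul_le_mul_left this (by positivity)
  · intro q hq
    have e : f₁ (x + q • v) v - f₁ (x + q • (-v)) (-v) - (1 : ℝ) • (2 : ℝ) • f₁ x v =
        (f₁ (x + q • v) + f₁ (x + q • (-v)) - (2 : ℝ) • f₁ x) v := by
      simp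
    rw [e]
    refine (ContinuousLinearMap.le_opNorm _ _).trans ?_
    rw [hv, mul_one]
    exact second q ⟨hq.1, hq.2.le⟩

/-- Interpolation of the derivative between a function and the modulus of its derivative. -/
theorem norm_fderiv_le_of_lipschitz {f : E → V} {f₁ : E → E →L[ℝ] V} {C K h : ℝ}
    (hf : ∀ x, HasFDerivAt f (f₁ x) x) (hC : 0 ≤ C) (hK : 0 ≤ K) (hh : 0 < h)
    (hL : ∀ x y, ‖f₁ x - f₁ y‖ ≤ C * ‖x - y‖) (hb : ∀ x, ‖f x‖ ≤ K * h ^ 2) (x : E) :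
    ‖f₁ x‖ ≤ (C + 2 * K) * h := by
  refine ContinuousLinearMap.opNorm_le_of_unit_norm (by positivity) fun v hv => ?_
  have := norm_taylor_le hC hf hL (x + h • v) x
  rw [add_sub_cancel_left, norm_smul, hv, mul_one, map_smul, Real.norm_of_nonneg hh.le] at this
  have e : h • f₁ x v = f (x + h • v) - f x - (f (x + h • v) - f x - h • f₁ x v) := by abel
  have n : ‖h • f₁ x v‖ ≤ K * h ^ 2 + K * h ^ 2 + C * h ^ 2 := by
    rw [e]
    refine (norm_sub_le _ _).trans (add_le_add ((norm_sub_le _ _).trans ?_) this)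
    exact add_le_add (hb _) (hb _)
  rw [norm_smul, Real.norm_of_nonneg hh.le] at n
  have : h * ‖f₁ x v‖ ≤ h * ((C + 2 * K) * h) := by linarith
  exact le_of_mul_le_mul_left this hh

end MeanValue

/-! ### Bounds on σ, including time moduli of its space derivatives -/

section Diffusion

variable {m : ℕ} {F : Type*} [NormedAddCommGroup F] [NormedSpace ℝ F]

/-- Uniform bounds, with constant `C`, on a coefficient with values in `F`, its first two space
derivatives `σ₁`, `σ₂`, and their moduli of continuity. -/
structure DiffusionBounds (T C : ℝ) (σ : ℝ → Euc m → F) (σ₁ : ℝ → Euc m → Euc m →L[ℝ] F)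
    (σ₂ : ℝ → Euc m → Euc m →L[ℝ] Euc m →L[ℝ] F) : Prop where
  hasFDerivAt : ∀ t ∈ Icc 0 T, ∀ x, HasFDerivAt (σ t) (σ₁ t x) x
  hasFDerivAt_deriv : ∀ t ∈ Icc 0 T, ∀ x, HasFDerivAt (σ₁ t) (σ₂ t x) x
  bound : ∀ t ∈ Icc 0 T, ∀ x, ‖σ t x‖ ≤ C
  bound_deriv : ∀ t ∈ Icc 0 T, ∀ x, ‖σ₁ t x‖ ≤ C
  bound_second : ∀ t ∈ Icc 0 T, ∀ x, ‖σ₂ t x‖ ≤ C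
  lip : ∀ t ∈ Icc 0 T, ∀ x y, ‖σ t x - σ t y‖ ≤ C * ‖x - y‖
  lip_deriv : ∀ t ∈ Icc 0 T, ∀ x y, ‖σ₁ t x - σ₁ t y‖ ≤ C * ‖x - y‖
  lip_second : ∀ t ∈ Icc 0 T, ∀ x y, ‖σ₂ t x - σ₂ t y‖ ≤ C * ‖x - y‖
  time : ∀ s ∈ Icc 0 T, ∀ t ∈ Icc 0 T, ∀ x, s ≤ t → ‖σ t x - σ s x‖ ≤ C * (t - s)
  time_deriv : ∀ s ∈ Icc 0 T, ∀ t ∈ Icc 0 T, ∀ x, s ≤ t →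
    ‖σ₁ t x - σ₁ s x‖ ≤ C * ((t - s) ^ (1 / 3 : ℝ)) ^ 2
  time_second : ∀ s ∈ Icc 0 T, ∀ t ∈ Icc 0 T, ∀ x, s ≤ t →
    ‖σ₂ t x - σ₂ s x‖ ≤ C * (t - s) ^ (1 / 3 : ℝ)

/-- Only the time moduli need an argument. The difference σ_t - σ_s is O(t - s) and has Lipschitz
second derivative; interpolation at scale h = (t - s)^(1/3) gives O(h²) for its gradient, and a
second interpolation gives O(h) for its second derivative. -/
theorem IsCb1.exists_bounds {T : ℝ} (hT : 0 < T) {σ : ℝ → Euc m → F} (hσ : IsCb1 3 T σ) :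
    ∃ C : ℝ, 1 ≤ C ∧ DiffusionBounds T C σ (fun t x => fderiv ℝ (σ t) x)
      (fun t x => fderiv ℝ (fderiv ℝ (σ t)) x) := by
  obtain ⟨C₀, h₀⟩ := hσ.bounded 0 (by norm_num)
  obtain ⟨C₁, h₁⟩ := hσ.bounded 1 (by norm_num)
  obtain ⟨C₂, h₂⟩ := hσ.bounded 2 (by norm_num)
  obtain ⟨C₃, h₃⟩ := hσ.bounded 3 (by norm_num)
  obtain ⟨D, hD, -, C₄, h₄⟩ := hσ.time_deriv
  have h0T : (0 : ℝ) ∈ Icc 0 T := ⟨le_rfl, hT.le⟩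
  have p₀ := (norm_nonneg _).trans (h₀ 0 h0T 0)
  have p₁ := (norm_nonneg _).trans (h₁ 0 h0T 0)
  have p₂ := (norm_nonneg _).trans (h₂ 0 h0T 0)
  have p₃ := (norm_nonneg _).trans (h₃ 0 h0T 0)
  have p₄ := (norm_nonneg _).trans (h₄ 0 h0T 0)
  set A := C₀ + C₁ + C₂ + C₃ + C₄ + 1 with hA
  have hA0 : 0 ≤ A := by positivity
  have cd : ∀ t ∈ Icc 0 T, ContDiff ℝ 3 (σ t) := fun t ht => by exact_mod_cast hσ.contDiff t ht
  have cd₁ : ∀ t ∈ Icc 0 T, ContDiff ℝ 2 (fderiv ℝ (σ t)) := fun t ht =>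
    (cd t ht).fderiv_right (by norm_num)
  have d₀ : ∀ t ∈ Icc 0 T, ∀ x, HasFDerivAt (σ t) (fderiv ℝ (σ t) x) x := fun t ht x =>
    ((cd t ht).differentiable (by norm_num) x).hasFDerivAt
  have d₁ : ∀ t ∈ Icc 0 T, ∀ x,
      HasFDerivAt (fderiv ℝ (σ t)) (fderiv ℝ (fderiv ℝ (σ t)) x) x := fun t ht x =>
    ((cd₁ t ht).differentiable (by norm_num) x).hasFDerivAt
  have b₀ : ∀ t ∈ Icc 0 T, ∀ x, ‖σ t x‖ ≤ A := fun t ht x => by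
    have := h₀ t ht x
    rw [norm_iteratedFDeriv_zero] at this
    linarith
  have b₁ : ∀ t ∈ Icc 0 T, ∀ x, ‖fderiv ℝ (σ t) x‖ ≤ A := fun t ht x => by
    have := h₁ t ht x
    rw [norm_iteratedFDeriv_one] at this
    linarith
  have b₂ : ∀ t ∈ Icc 0 T, ∀ x, ‖fderiv ℝ (fderiv ℝ (σ t)) x‖ ≤ A := fun t ht x => by
    have := h₂ t ht x
    rw [← norm_iteratedFDeriv_fderiv, norm_iteratedFDeriv_one] at this
    linarith
  have l₀ : ∀ t ∈ Icc 0 T, ∀ x y, ‖σ t x - σ t y‖ ≤ A * ‖x - y‖ := fun t ht x y =>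
    convex_univ.norm_image_sub_le_of_norm_hasFDerivWithin_le
      (fun z _ => (d₀ t ht z).hasFDerivWithinAt) (fun z _ => b₁ t ht z) trivial trivial
  have l₁ : ∀ t ∈ Icc 0 T, ∀ x y, ‖fderiv ℝ (σ t) x - fderiv ℝ (σ t) y‖ ≤ A * ‖x - y‖ :=
    fun t ht x y => convex_univ.norm_image_sub_le_of_norm_hasFDerivWithin_le
      (fun z _ => (d₁ t ht z).hasFDerivWithinAt) (fun z _ => b₂ t ht z) trivial trivial
  have l₂ : ∀ t ∈ Icc 0 T, ∀ x y,
      ‖fderiv ℝ (fderiv ℝ (σ t)) x - fderiv ℝ (fderiv ℝ (σ t)) y‖ ≤ A * ‖x - y‖ :=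
    fun t ht x y => norm_fderiv_sub_fderiv_le (cd₁ t ht) (fun z => by
      rw [norm_iteratedFDeriv_fderiv]
      exact (h₃ t ht z).trans (by linarith)) x y
  have tm : ∀ s ∈ Icc 0 T, ∀ t ∈ Icc 0 T, ∀ x, s ≤ t → ‖σ t x - σ s x‖ ≤ A * (t - s) := by
    intro s hs t ht x hst
    have := (convex_Icc (0 : ℝ) T).norm_image_sub_le_of_norm_hasDerivWithin_le
      (f := fun s => σ s x) (C := A) (fun r hr => hD r hr x)
      (fun r hr => (h₄ r hr x).trans (by linarith)) hs ht
    rwa [Real.norm_of_nonneg (sub_nonneg.2 hst)] at this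
  have tm₁ : ∀ s ∈ Icc 0 T, ∀ t ∈ Icc 0 T, ∀ x, s ≤ t →
      ‖fderiv ℝ (σ t) x - fderiv ℝ (σ s) x‖ ≤ 4 * A * ((t - s) ^ (1 / 3 : ℝ)) ^ 2 := by
    intro s hs t ht x hst
    rcases hst.eq_or_lt with rfl | hlt
    · rw [sub_self, norm_zero]; positivity
    have hpos : 0 < t - s := sub_pos.2 hlt
    have := norm_fderiv_le_of_interpolation (f := fun x => σ t x - σ s x) (C := 2 * A)
      (h := (t - s) ^ (1 / 3 : ℝ))
      (fun x => (d₀ t ht x).sub (d₀ s hs x)) (fun x => (d₁ t ht x).sub (d₁ s hs x))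
      (by positivity) (by positivity) (fun x y => ?_) (fun x => ?_) x
    · refine this.trans (le_of_eq (by ring))
    · rw [sub_sub_sub_comm]
      refine (norm_sub_le _ _).trans ?_
      linarith [l₂ t ht x y, l₂ s hs x y]
    · rw [← Real.rpow_natCast, ← Real.rpow_mul hpos.le]
      norm_num
      have := tm s hs t ht x hst
      nlinarith
  -- The largest constant is that of the second interpolation, 2A + 2 · 4A.
  refine ⟨10 * A, by linarith, ⟨d₀, d₁, fun t ht x => (b₀ t ht x).trans (by linarith),
    fun t ht x => (b₁ t ht x).trans (by linarith), fun t ht x => (b₂ t ht x).trans (by linarith),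
    fun t ht x y => (l₀ t ht x y).trans ?_, fun t ht x y => (l₁ t ht x y).trans ?_,
    fun t ht x y => (l₂ t ht x y).trans ?_, fun s hs t ht x hst => (tm s hs t ht x hst).trans ?_,
    fun s hs t ht x hst => (tm₁ s hs t ht x hst).trans ?_, fun s hs t ht x hst => ?_⟩⟩
  · gcongr; linarith
  · gcongr; linarith
  · gcongr; linarith
  · have := sub_nonneg.2 hst
    gcongr; linarith
  · gcongr; linarith
  · rcases hst.eq_or_lt with rfl | hlt
    · rw [sub_self, norm_zero]; positivity
    have hpos : 0 < t - s := sub_pos.2 hlt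
    have := norm_fderiv_le_of_lipschitz
      (f := fun x => fderiv ℝ (σ t) x - fderiv ℝ (σ s) x) (C := 2 * A) (K := 4 * A)
      (h := (t - s) ^ (1 / 3 : ℝ)) (fun x => (d₁ t ht x).sub (d₁ s hs x))
      (by positivity) (by positivity) (by positivity) (fun x y => ?_)
      (fun x => tm₁ s hs t ht x hst) x
    · refine this.trans (le_of_eq (by ring))
    · rw [sub_sub_sub_comm]
      refine (norm_sub_le _ _).trans ?_
      linarith [l₂ t ht x y, l₂ s hs x y]

end Diffusion

/-! ### Bounded Lipschitz drifts -/

section Drift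

variable {m : ℕ}

/-- Uniform bounds, with constant `C`, on a drift, which is continuous in time. -/
structure DriftBounds (T C : ℝ) (B : ℝ → Euc m → Euc m) : Prop where
  bound : ∀ t ∈ Icc 0 T, ∀ x, ‖B t x‖ ≤ C
  lip : ∀ t ∈ Icc 0 T, ∀ x y, ‖B t x - B t y‖ ≤ C * ‖x - y‖
  continuousOn : ∀ x, ContinuousOn (fun t => B t x) (Icc 0 T)

/-- The Lipschitz bound, uniform in time, absorbs the motion of x; time continuity is then needed
only at the frozen point x_s. -/
theorem DriftBounds.continuousOn_comp {T C : ℝ} {B : ℝ → Euc m → Euc m} (hB : DriftBounds T C B)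
    {x : ℝ → Euc m} (hx : ContinuousOn x (Icc 0 T)) :
    ContinuousOn (fun t => B t (x t)) (Icc 0 T) := by
  intro s hs
  have h₁ : Filter.Tendsto (fun t => B t (x t) - B t (x s)) (𝓝[Icc 0 T] s) (𝓝 0) := by
    rw [tendsto_zero_iff_norm_tendsto_zero]
    refine squeeze_zero' (Filter.Eventually.of_forall fun _ => norm_nonneg _)
      (eventually_nhdsWithin_of_forall fun t ht => hB.lip t ht (x t) (x s)) ?_
    have : Filter.Tendsto (fun t => ‖x t - x s‖) (𝓝[Icc 0 T] s) (𝓝 0) :=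
      tendsto_iff_norm_sub_tendsto_zero.1 (hx s hs)
    simpa using this.const_mul C
  simpa [ContinuousWithinAt] using h₁.add (hB.continuousOn (x s) s hs)

end Drift

/-! ### From W₂-Hölder controls to the relaxed drift -/

section Wasserstein

variable {U : Type*} [MetricSpace U] [MeasurableSpace U] [BorelSpace U]

instance P₂.isProbabilityMeasure (μ : P₂ U) : IsProbabilityMeasure μ.measure :=
  inferInstanceAs (IsProbabilityMeasure (μ.1 : Measure U))

/-- The easy half of Kantorovich duality, with `W₂` in place of `W₁`. -/
theorem enorm_integral_sub_integral_le_mul_W₂ [SecondCountableTopology U] (μ ν : P₂ U)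
    {f : U → ℝ} {L : NNReal} (hf : LipschitzWith L f) {C : ℝ} (hC : ∀ a, ‖f a‖ ≤ C) :
    ‖(∫ a, f a ∂μ.measure) - ∫ a, f a ∂ν.measure‖ₑ ≤ (L + 1 : ENNReal) * W₂ μ ν := by
  -- `L + 1` replaces `L` so that one may divide by it even when L = 0. The claim becomes a lower
  -- bound for the infimum over couplings, proved for each coupling by Cauchy–Schwarz.
  have h0 : (L + 1 : ENNReal) ≠ 0 := by simp
  have hT : (L + 1 : ENNReal) ≠ ⊤ := by simp
  rw [mul_comm, ← ENNReal.div_le_iff h0 hT]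
  refine le_iInf₂ fun π hπ => ?_
  rw [ENNReal.div_le_iff h0 hT]
  have hp : IsProbabilityMeasure π := by
    refine ⟨?_⟩
    have := congrArg (fun ρ : Measure U => ρ univ) hπ.1
    simpa [Measure.map_apply measurable_fst] using this
  have hfm : Measurable f := hf.continuous.measurable
  have i₁ : Integrable (fun p : U × U => f p.1) π :=
    Integrable.of_bound (hfm.comp measurable_fst).aestronglyMeasurable C
      (Filter.Eventually.of_forall fun p => hC p.1)
  have i₂ : Integrable (fun p : U × U => f p.2) π :=
    Integrable.of_bound (hfm.comp measurable_snd).aestronglyMeasurable C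
      (Filter.Eventually.of_forall fun p => hC p.2)
  have hm : AEMeasurable (fun p : U × U => edist p.1 p.2) π := measurable_edist.aemeasurable
  rw [← hπ.1, ← hπ.2, integral_map measurable_fst.aemeasurable hfm.aestronglyMeasurable,
    integral_map measurable_snd.aemeasurable hfm.aestronglyMeasurable, ← integral_sub i₁ i₂]
  calc ‖∫ p, f p.1 - f p.2 ∂π‖ₑ ≤ ∫⁻ p, ‖f p.1 - f p.2‖ₑ ∂π := enorm_integral_le_lintegral_enorm _
    _ ≤ ∫⁻ p, (L + 1 : ENNReal) * edist p.1 p.2 ∂π := by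
      refine lintegral_mono fun p => ?_
      rw [← edist_eq_enorm_sub]
      refine (hf p.1 p.2).trans ?_
      gcongr
      exact le_self_add
    _ = (L + 1 : ENNReal) * ∫⁻ p, edist p.1 p.2 ∂π := lintegral_const_mul' _ _ hT
    _ ≤ (L + 1 : ENNReal) * (∫⁻ p, edist p.1 p.2 ^ 2 ∂π) ^ (1 / 2 : ℝ) := by
      gcongr
      have := ENNReal.lintegral_mul_le_Lp_mul_Lq π Real.HolderConjugate.two_two hm
        (aemeasurable_const (b := (1 : ENNReal)))
      simpa using this
    _ = _ := mul_comm _ _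

/-- Weak convergence can be tested on bounded Lipschitz functions, whose integrals are controlled by
W₂. -/
theorem tendsto_of_mem_controlPaths [SecondCountableTopology U] {T ε L : ℝ} {K : Set (P₂ U)}
    {γ : ℝ → P₂ U} (hε : 0 < ε) (hγ : γ ∈ controlPaths T K ε L) {s : ℝ} (hs : s ∈ Icc 0 T) :
    Filter.Tendsto (fun t => (γ t).1) (𝓝[Icc 0 T] s) (𝓝 (γ s).1) := by
  rw [tendsto_iff_forall_lipschitz_integral_tendsto]
  rintro f ⟨C, hC⟩ ⟨M, hM⟩
  have hb : ∃ C', ∀ a, ‖f a‖ ≤ C' := by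
    rcases isEmpty_or_nonempty U with h | ⟨⟨a₀⟩⟩
    · exact ⟨0, fun a => h.elim a⟩
    · refine ⟨C + ‖f a₀‖, fun a => ?_⟩
      have := hC a a₀
      rw [dist_eq_norm] at this
      calc ‖f a‖ = ‖(f a - f a₀) + f a₀‖ := by rw [sub_add_cancel]
        _ ≤ _ := (norm_add_le _ _).trans (by gcongr)
  obtain ⟨C', hC'⟩ := hb
  change Filter.Tendsto (fun t => ∫ a, f a ∂(γ t).measure) _ (𝓝 (∫ a, f a ∂(γ s).measure))
  rw [tendsto_iff_edist_tendsto_0]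
  refine tendsto_of_tendsto_of_tendsto_of_le_of_le' (g := fun _ => (0 : ENNReal))
    (h := fun t => (M + 1 : ENNReal) * ENNReal.ofReal (L * |t - s| ^ ε)) tendsto_const_nhds ?_
    (Filter.Eventually.of_forall fun _ => zero_le)
    (eventually_nhdsWithin_of_forall fun t ht => ?_)
  · have h₁ : Filter.Tendsto (fun t : ℝ => L * |t - s| ^ ε) (𝓝 s) (𝓝 (L * |s - s| ^ ε)) :=
      (((continuous_abs.comp (continuous_id.sub continuous_const)).tendsto s).rpow_const
        (Or.inr hε.le)).const_mul L
    have h₂ := ENNReal.Tendsto.const_mul (a := (M + 1 : ENNReal))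
      (ENNReal.tendsto_ofReal h₁) (Or.inr (by simp))
    rw [sub_self, abs_zero, Real.zero_rpow hε.ne', mul_zero, ENNReal.ofReal_zero, mul_zero] at h₂
    exact h₂.mono_left nhdsWithin_le_nhds
  · rw [edist_eq_enorm_sub]
    refine (enorm_integral_sub_integral_le_mul_W₂ _ _ hM hC').trans ?_
    gcongr
    rw [abs_sub_comm]
    exact hγ.2 t ht s hs

variable {m k : ℕ}

/-- The relaxed drift is bounded, Lipschitz in space and continuous in time. -/
theorem IsCb011.exists_driftBounds {T ε L : ℝ} {ι : U → Euc k} (hι : Topology.IsEmbedding ι)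
    {K : Set (P₂ U)} {γ : ℝ → P₂ U} (hT : 0 < T) (hε : 0 < ε) (hγ : γ ∈ controlPaths T K ε L)
    {b : ℝ → Euc m → U → Euc m} (hb : IsCb011 ι T b) (hb' : IsUniformlyContinuousInTime T b) :
    ∃ C : ℝ, 0 ≤ C ∧ DriftBounds T C (relaxedDrift b γ) := by
  -- Inherited from the Euclidean space; it makes the distance on U × U measurable.
  have : SecondCountableTopology U := hι.isInducing.secondCountableTopology
  obtain ⟨C₀, h₀⟩ := hb.bounded
  obtain ⟨D, hD, -, C₁, h₁⟩ := hb.space_deriv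
  have hne : Nonempty U := (γ 0).measure.nonempty_of_neZero
  obtain ⟨a₀⟩ := hne
  have h0T : (0 : ℝ) ∈ Icc 0 T := ⟨le_rfl, hT.le⟩
  have p₀ := (norm_nonneg _).trans (h₀ 0 h0T 0 a₀)
  have p₁ := (norm_nonneg _).trans (h₁ 0 h0T 0 a₀)
  have hcont : ∀ t ∈ Icc 0 T, ∀ x, Continuous (b t x) := fun t ht x => by
    have : Continuous fun a : U => ((t, x, a) : ℝ × Euc m × U) := by fun_prop
    exact hb.continuousOn.comp_continuous this fun a => ⟨ht, trivial⟩
  have hint : ∀ t ∈ Icc 0 T, ∀ x, ∀ μ : P₂ U, Integrable (b t x) μ.measure := fun t ht x μ =>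
    Integrable.of_bound (hcont t ht x).aestronglyMeasurable C₀
      (Filter.Eventually.of_forall fun a => h₀ t ht x a)
  have hsub : ∀ (f : U → Euc m) (c : ℝ) (μ : P₂ U), (∀ a, ‖f a‖ ≤ c) →
      ‖∫ a, f a ∂μ.measure‖ ≤ c := fun f c μ h => by
    simpa using norm_integral_le_of_norm_le_const (μ := μ.measure)
      (Filter.Eventually.of_forall h)
  refine ⟨C₀ + C₁, by positivity, ?_, ?_, ?_⟩
  · intro t ht x
    refine (hsub _ C₀ _ (h₀ t ht x)).trans (by linarith)
  · intro t ht x y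
    rw [relaxedDrift, relaxedDrift, ← integral_sub (hint t ht x _) (hint t ht y _)]
    refine (hsub _ (C₁ * ‖x - y‖) _ fun a => ?_).trans ?_
    · exact convex_univ.norm_image_sub_le_of_norm_hasFDerivWithin_le
        (fun z _ => (hD t ht z a).hasFDerivWithinAt) (fun z _ => h₁ t ht z a) trivial trivial
    · gcongr; linarith
  · intro x s hs
    -- The time argument of `b` is moved under the varying measure γ_t, which is possible because
    -- the modulus of continuity is uniform in the control.
    have e₁ : Filter.Tendsto (fun t => relaxedDrift b γ t x - ∫ a, b s x a ∂(γ t).measure)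
        (𝓝[Icc 0 T] s) (𝓝 0) := by
      rw [tendsto_zero_iff_norm_tendsto_zero, Metric.tendsto_nhdsWithin_nhds]
      intro δ hδ
      obtain ⟨r, hr, H⟩ := hb' x (δ / 2) (by positivity)
      refine ⟨r, hr, fun {t} ht htr => ?_⟩
      rw [dist_zero_right, norm_norm, relaxedDrift,
        ← integral_sub (hint t ht x _) (hint s hs x _)]
      exact (hsub _ (δ / 2) _ fun a => (H t ht s hs htr a).le).trans_lt (by linarith)
    -- Now the integrand is fixed, bounded and continuous, and weak convergence applies coordinate
    -- by coordinate.
    have e₂ : Filter.Tendsto (fun t => ∫ a, b s x a ∂(γ t).measure)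
        (𝓝[Icc 0 T] s) (𝓝 (∫ a, b s x a ∂(γ s).measure)) := by
      refine (EuclideanSpace.equiv (Fin m) ℝ).toHomeomorph.isInducing.tendsto_nhds_iff.2
        (tendsto_pi_nhds.2 fun i => ?_)
      have hi : ∀ μ : P₂ U, (∫ a, b s x a ∂μ.measure) i = ∫ a, b s x a i ∂μ.measure := fun μ =>
        ((EuclideanSpace.proj (𝕜 := ℝ) i).integral_comp_comm (hint s hs x μ)).symm
      have hcb := ProbabilityMeasure.tendsto_iff_forall_integral_tendsto.1
        (tendsto_of_mem_controlPaths hε hγ hs) (BoundedContinuousFunction.ofNormedAddCommGroup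
          (fun a => b s x a i) ((EuclideanSpace.proj (𝕜 := ℝ) i).continuous.comp (hcont s hs x)) C₀
          fun a => (PiLp.norm_apply_le _ i).trans (h₀ s hs x a))
      change Filter.Tendsto (fun t => (∫ a, b s x a ∂(γ t).measure) i) _
        (𝓝 ((∫ a, b s x a ∂(γ s).measure) i))
      simp only [hi]
      exact hcb
    simpa [ContinuousWithinAt, relaxedDrift] using e₁.add e₂

end Wasserstein

/-! ### Comparison of powers on intervals of length at most one -/

section PowerBounds

variable {κ r : ℝ}

theorem cube_rpow_third (hr : 0 ≤ r) : (r ^ (1 / 3 : ℝ)) ^ 3 = r := by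
  rw [← Real.rpow_natCast, ← Real.rpow_mul hr]; norm_num

theorem le_sq_rpow_third (hr : 0 ≤ r) (hr1 : r ≤ 1) : r ≤ (r ^ (1 / 3 : ℝ)) ^ 2 := by
  have h0 : 0 ≤ r ^ (1 / 3 : ℝ) := Real.rpow_nonneg hr _
  have h1 : r ^ (1 / 3 : ℝ) ≤ 1 := Real.rpow_le_one hr hr1 (by norm_num)
  have h3 := cube_rpow_third hr
  nlinarith [mul_nonneg (sq_nonneg (r ^ (1 / 3 : ℝ))) (sub_nonneg.2 h1)]

theorem rpow_le_rpow_third (hκ : 1 / 3 < κ) (hr : 0 ≤ r) (hr1 : r ≤ 1) :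
    r ^ κ ≤ r ^ (1 / 3 : ℝ) := by
  rcases hr.eq_or_lt with rfl | h
  · rw [Real.zero_rpow (by linarith), Real.zero_rpow (by norm_num)]
  · exact Real.rpow_le_rpow_of_exponent_ge h hr1 hκ.le

theorem sq_rpow_third_le (hκ : 1 / 3 < κ) (hκ' : κ ≤ 1 / 2) (hr : 0 ≤ r) (hr1 : r ≤ 1) :
    (r ^ (1 / 3 : ℝ)) ^ 2 ≤ r ^ κ := by
  rw [← Real.rpow_natCast, ← Real.rpow_mul hr]
  rcases hr.eq_or_lt with rfl | h
  · rw [Real.zero_rpow (by norm_num)]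
    exact Real.rpow_nonneg le_rfl _
  · refine Real.rpow_le_rpow_of_exponent_ge h hr1 ?_
    norm_num
    linarith

/-- The left side is the error made by freezing a path of exponent 1/3 in a Lipschitz drift; it is
absorbed into the sewing order 2/3 + κ. -/
theorem rpow_third_mul_self_le (hκ : 1 / 3 < κ) (hκ' : κ ≤ 1 / 2) (hr : 0 ≤ r) (hr1 : r ≤ 1) :
    r ^ (1 / 3 : ℝ) * r ≤ r ^ (2 / 3 + κ) := by
  rw [Real.rpow_add_of_nonneg hr (by norm_num) (by linarith)]
  have h : r ^ (2 / 3 : ℝ) = (r ^ (1 / 3 : ℝ)) ^ 2 := by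
    rw [← Real.rpow_natCast, ← Real.rpow_mul hr]; norm_num
  rw [h]
  calc r ^ (1 / 3 : ℝ) * r = (r ^ (1 / 3 : ℝ)) ^ 2 * (r ^ (1 / 3 : ℝ)) ^ 2 := by
        nth_rewrite 2 [← cube_rpow_third hr]; ring
    _ ≤ _ := by
      gcongr
      exact sq_rpow_third_le hκ hκ' hr hr1

theorem rpow_two_thirds_add (hκ : 1 / 3 < κ) (hr : 0 ≤ r) :
    r ^ (2 / 3 + κ) = (r ^ (1 / 3 : ℝ)) ^ 2 * r ^ κ := by
  rw [Real.rpow_add_of_nonneg hr (by norm_num) (by linarith), ← Real.rpow_natCast,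
    ← Real.rpow_mul hr]
  norm_num

end PowerBounds

/-! ### Estimates of the second-order germ along one path -/

section Estimates

variable {m d : ℕ}

/-- Hölder bounds, with constant `C`, on a rough path. -/
structure PathBounds (m : ℕ) (T κ C : ℝ) (ζ : ℝ → Euc d) (ζ₂ : ℝ → ℝ → Fin d → Fin d → ℝ) :
    Prop where
  path : ∀ s t : ℝ, 0 ≤ s → s ≤ t → t ≤ T → ‖delta₁ ζ s t‖ ≤ C * (t - s) ^ κ
  area : ∀ s t : ℝ, 0 ≤ s → s ≤ t → t ≤ T → ∀ A : Euc d →L[ℝ] Euc d →L[ℝ] Euc m,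
    ‖contract A (ζ₂ s t)‖ ≤ C * ‖A‖ * ((t - s) ^ κ) ^ 2

theorem IsRoughPath.exists_pathBounds {T α κ : ℝ} {ζ : ℝ → Euc d}
    {ζ₂ : ℝ → ℝ → Fin d → Fin d → ℝ} (hζ : IsRoughPath T α ζ ζ₂) (hκ : 0 < κ) (hκα : κ ≤ α) :
    ∃ C : ℝ, 0 ≤ C ∧ PathBounds m T κ C ζ ζ₂ := by
  obtain ⟨Z, hZ0, hZ⟩ := (IsHolder₂.mono_exponent hζ.holder hκ hκα).exists_nonneg
  obtain ⟨Y, hY0, hY⟩ :=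
    (hζ.holder_two.mono_exponent (ν := 2 * κ) (by linarith) (by linarith)).exists_nonneg
  refine ⟨Z + d * d * Y, by positivity, fun s t h0 hst htT => ?_, fun s t h0 hst htT A => ?_⟩
  · refine (hZ s t h0 hst htT).trans ?_
    have : 0 ≤ t - s := sub_nonneg.2 hst
    gcongr
    have : 0 ≤ d * d * Y := by positivity
    linarith
  · have h1 : 0 ≤ t - s := sub_nonneg.2 hst
    have h2 : (t - s) ^ (2 * κ) = ((t - s) ^ κ) ^ 2 := by
      rw [mul_comm, Real.rpow_mul h1, Real.rpow_two]
    have h3 := hY s t h0 hst htT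
    rw [h2] at h3
    have hA := A.opNorm_nonneg
    calc ‖contract A (ζ₂ s t)‖ ≤ d * d * (‖A‖ * ‖ζ₂ s t‖) := norm_contract_le _ _
      _ ≤ d * d * (‖A‖ * (Y * ((t - s) ^ κ) ^ 2)) := by gcongr
      _ = d * d * Y * ‖A‖ * ((t - s) ^ κ) ^ 2 := by ring
      _ ≤ _ := by
        gcongr
        linarith

theorem PathBounds.mono {T κ C C' : ℝ} {ζ : ℝ → Euc d} {ζ₂ : ℝ → ℝ → Fin d → Fin d → ℝ}
    (h : PathBounds m T κ C ζ ζ₂) (hC : C ≤ C') : PathBounds m T κ C' ζ ζ₂ := by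
  refine ⟨fun s t h0 hst htT => (h.path s t h0 hst htT).trans ?_,
    fun s t h0 hst htT A => (h.area s t h0 hst htT A).trans ?_⟩
  · have : 0 ≤ t - s := sub_nonneg.2 hst
    gcongr
  · have := A.opNorm_nonneg
    gcongr

theorem DriftBounds.mono {T C C' : ℝ} {B : ℝ → Euc m → Euc m} (h : DriftBounds T C B)
    (hC : C ≤ C') : DriftBounds T C' B :=
  ⟨fun t ht x => (h.bound t ht x).trans hC, fun t ht x y => (h.lip t ht x y).trans (by gcongr),
    h.continuousOn⟩

theorem DiffusionBounds.mono {F : Type*} [NormedAddCommGroup F] [NormedSpace ℝ F] {T C C' : ℝ}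
    {σ : ℝ → Euc m → F} {σ₁ : ℝ → Euc m → Euc m →L[ℝ] F}
    {σ₂ : ℝ → Euc m → Euc m →L[ℝ] Euc m →L[ℝ] F} (h : DiffusionBounds T C σ σ₁ σ₂)
    (hC : C ≤ C') : DiffusionBounds T C' σ σ₁ σ₂ := by
  refine ⟨h.hasFDerivAt, h.hasFDerivAt_deriv, fun t ht x => (h.bound t ht x).trans hC,
    fun t ht x => (h.bound_deriv t ht x).trans hC, fun t ht x => (h.bound_second t ht x).trans hC,
    fun t ht x y => (h.lip t ht x y).trans ?_, fun t ht x y => (h.lip_deriv t ht x y).trans ?_,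
    fun t ht x y => (h.lip_second t ht x y).trans ?_,
    fun s hs t ht x hst => (h.time s hs t ht x hst).trans ?_,
    fun s hs t ht x hst => (h.time_deriv s hs t ht x hst).trans ?_,
    fun s hs t ht x hst => (h.time_second s hs t ht x hst).trans ?_⟩
  all_goals have := fun (s t : ℝ) (h : s ≤ t) => sub_nonneg.2 h
  all_goals gcongr

/-- The second-order coefficient `∇σ(s, x) σ(s, x)`. -/
noncomputable def gubinelliCoeff (σ : ℝ → Euc m → Euc d →L[ℝ] Euc m) (s : ℝ) (x : Euc m) :
    Euc d →L[ℝ] Euc d →L[ℝ] Euc m :=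
  (fderiv ℝ (σ s) x).comp (σ s x)

/-- The bounds on the diffusion coefficient `σ` used throughout. -/
abbrev SigmaBounds (T C : ℝ) (σ : ℝ → Euc m → Euc d →L[ℝ] Euc m) : Prop :=
  DiffusionBounds T C σ (fun t x => fderiv ℝ (σ t) x) (fun t x => fderiv ℝ (fderiv ℝ (σ t)) x)

variable {T κ C : ℝ} {σ : ℝ → Euc m → Euc d →L[ℝ] Euc m}

theorem SigmaBounds.norm_gubinelliCoeff_le (hσ : SigmaBounds T C σ) {s : ℝ} (hs : s ∈ Icc 0 T)
    (x : Euc m) : ‖gubinelliCoeff σ s x‖ ≤ C ^ 2 := by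
  refine (ContinuousLinearMap.opNorm_comp_le _ _).trans ?_
  rw [pow_two]
  have := (norm_nonneg _).trans (hσ.bound s hs x)
  exact mul_le_mul (hσ.bound_deriv s hs x) (hσ.bound s hs x) (norm_nonneg _) this

theorem SigmaBounds.norm_sub_le (hσ : SigmaBounds T C σ) {s t : ℝ} (hs : s ∈ Icc 0 T)
    (ht : t ∈ Icc 0 T) (hst : s ≤ t) (a c : Euc m) :
    ‖σ t c - σ s a‖ ≤ C * (t - s) + C * ‖c - a‖ := by
  have e : σ t c - σ s a = (σ t c - σ s c) + (σ s c - σ s a) := by abel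
  rw [e]
  exact (norm_add_le _ _).trans (add_le_add (hσ.time s hs t ht c hst) (hσ.lip s hs c a))

theorem SigmaBounds.norm_gubinelliCoeff_sub_le (hσ : SigmaBounds T C σ) {s t : ℝ}
    (hs : s ∈ Icc 0 T) (ht : t ∈ Icc 0 T) (hst : s ≤ t) (a c : Euc m) :
    ‖gubinelliCoeff σ t c - gubinelliCoeff σ s a‖ ≤
      C ^ 2 * (((t - s) ^ (1 / 3 : ℝ)) ^ 2 + (t - s) + 2 * ‖c - a‖) := by
  have hC : 0 ≤ C := (norm_nonneg _).trans (hσ.bound s hs a)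
  have h₁ : ‖fderiv ℝ (σ t) c - fderiv ℝ (σ s) a‖ ≤
      C * ((t - s) ^ (1 / 3 : ℝ)) ^ 2 + C * ‖c - a‖ := by
    have e : fderiv ℝ (σ t) c - fderiv ℝ (σ s) a =
      (fderiv ℝ (σ t) c - fderiv ℝ (σ s) c) + (fderiv ℝ (σ s) c - fderiv ℝ (σ s) a) := by abel
    rw [e]
    exact (norm_add_le _ _).trans
      (add_le_add (hσ.time_deriv s hs t ht c hst) (hσ.lip_deriv s hs c a))
  have e : gubinelliCoeff σ t c - gubinelliCoeff σ s a =
      (fderiv ℝ (σ t) c - fderiv ℝ (σ s) a).comp (σ t c) +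
        (fderiv ℝ (σ s) a).comp (σ t c - σ s a) := by
    ext v w
    simp [gubinelliCoeff]
  rw [e]
  calc _ ≤ _ := norm_add_le _ _
    _ ≤ (C * ((t - s) ^ (1 / 3 : ℝ)) ^ 2 + C * ‖c - a‖) * C +
        C * (C * (t - s) + C * ‖c - a‖) := by
      refine add_le_add ((ContinuousLinearMap.opNorm_comp_le _ _).trans ?_)
        ((ContinuousLinearMap.opNorm_comp_le _ _).trans ?_)
      · exact mul_le_mul h₁ (hσ.bound t ht c) (norm_nonneg _) (by positivity)
      · exact mul_le_mul (hσ.bound_deriv s hs a) (hσ.norm_sub_le hs ht hst a c) (norm_nonneg _) hC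
    _ = _ := by ring

/-- Three sources of error: the motion in time, the Taylor remainder in space, and ∇σ applied to the
remainder of the path. -/
theorem SigmaBounds.norm_remainder_le (hσ : SigmaBounds T C σ) {s t : ℝ} (hs : s ∈ Icc 0 T)
    (ht : t ∈ Icc 0 T) (hst : s ≤ t) (a c : Euc m) (v : Euc d) :
    ‖σ t c - σ s a - gubinelliCoeff σ s a v‖ ≤
      C * (t - s) + C * ‖c - a‖ ^ 2 + C * ‖c - a - σ s a v‖ := by
  have hC : 0 ≤ C := (norm_nonneg _).trans (hσ.bound s hs a)
  have e : σ t c - σ s a - gubinelliCoeff σ s a v =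
      (σ t c - σ s c) + (σ s c - σ s a - fderiv ℝ (σ s) a (c - a)) +
        fderiv ℝ (σ s) a (c - a - σ s a v) := by
    simp only [gubinelliCoeff, map_sub, ContinuousLinearMap.comp_apply]; abel
  rw [e]
  refine norm_add₃_le.trans (add_le_add (add_le_add (hσ.time s hs t ht c hst) ?_) ?_)
  · exact norm_taylor_le hC (hσ.hasFDerivAt s hs) (hσ.lip_deriv s hs) c a
  · exact ContinuousLinearMap.le_of_opNorm_le _ (hσ.bound_deriv s hs a) _

/-- The increment of the second-order germ along a path with controlled increments. -/
theorem norm_germ_increment_le {ζ : ℝ → Euc d} {ζ₂ : ℝ → ℝ → Fin d → Fin d → ℝ}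
    (hκ : 1 / 3 < κ) (hC : 1 ≤ C) (hζ : PathBounds m T κ C ζ ζ₂) (hσ : SigmaBounds T C σ)
    {K s u t : ℝ} (hK : 1 ≤ K) (h0 : 0 ≤ s) (hsu : s ≤ u) (hut : u ≤ t) (htT : t ≤ T)
    (h1 : t - s ≤ 1) {a c : Euc m} (hac : ‖c - a‖ ≤ K * (u - s) ^ (1 / 3 : ℝ))
    (hrem : ‖c - a - σ s a (delta₁ ζ s u)‖ ≤ K * ((u - s) ^ (1 / 3 : ℝ)) ^ 2) :
    ‖(σ u c - σ s a - gubinelliCoeff σ s a (delta₁ ζ s u)) (delta₁ ζ u t) +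
      contract (gubinelliCoeff σ u c - gubinelliCoeff σ s a) (ζ₂ u t)‖ ≤
        7 * C ^ 3 * K ^ 2 * (t - s) ^ (2 / 3 + κ) := by
  have hs : s ∈ Icc 0 T := ⟨h0, by linarith⟩
  have hu : u ∈ Icc 0 T := ⟨by linarith, by linarith⟩
  have hsu0 : 0 ≤ u - s := sub_nonneg.2 hsu
  have hut0 : 0 ≤ t - u := sub_nonneg.2 hut
  have hst0 : 0 ≤ t - s := by linarith
  rw [rpow_two_thirds_add hκ hst0]
  have hpp : (u - s) ^ (1 / 3 : ℝ) ≤ (t - s) ^ (1 / 3 : ℝ) :=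
    Real.rpow_le_rpow hsu0 (by linarith) (by norm_num)
  have hqq : (t - u) ^ κ ≤ (t - s) ^ κ := Real.rpow_le_rpow hut0 (by linarith) (by linarith)
  have hqp := rpow_le_rpow_third hκ hst0 h1
  have hr : u - s ≤ ((u - s) ^ (1 / 3 : ℝ)) ^ 2 := le_sq_rpow_third hsu0 (by linarith)
  have hp1 : (t - s) ^ (1 / 3 : ℝ) ≤ 1 := Real.rpow_le_one hst0 h1 (by norm_num)
  have n₁ := hσ.norm_remainder_le hs hu hsu a c (delta₁ ζ s u)
  have n₂ := hσ.norm_gubinelliCoeff_sub_le hs hu hsu a c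
  have z₁ := hζ.path u t (by linarith) hut htT
  have z₂ := hζ.area u t (by linarith) hut htT (gubinelliCoeff σ u c - gubinelliCoeff σ s a)
  have q0 : 0 ≤ (t - u) ^ κ := Real.rpow_nonneg hut0 _
  have p0 : 0 ≤ (u - s) ^ (1 / 3 : ℝ) := Real.rpow_nonneg hsu0 _
  generalize (u - s) ^ (1 / 3 : ℝ) = p' at *
  generalize (t - s) ^ (1 / 3 : ℝ) = p at *
  generalize (t - u) ^ κ = q' at *
  generalize (t - s) ^ κ = q at *
  have hq : 0 ≤ q := q0.trans hqq
  have hp : 0 ≤ p := p0.trans hpp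
  have m₁ : ‖σ u c - σ s a - gubinelliCoeff σ s a (delta₁ ζ s u)‖ ≤ 3 * C * K ^ 2 * p ^ 2 := by
    calc _ ≤ _ := n₁
      _ ≤ C * p' ^ 2 + C * (K * p') ^ 2 + C * (K * p' ^ 2) := by gcongr
      _ = (1 + K ^ 2 + K) * (C * p' ^ 2) := by ring
      _ ≤ (3 * K ^ 2) * (C * p' ^ 2) := by gcongr; nlinarith
      _ = 3 * C * K ^ 2 * p' ^ 2 := by ring
      _ ≤ _ := by gcongr
  have m₂ : ‖gubinelliCoeff σ u c - gubinelliCoeff σ s a‖ ≤ 4 * C ^ 2 * K ^ 2 * p := by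
    calc _ ≤ _ := n₂
      _ ≤ C ^ 2 * (p ^ 2 + p ^ 2 + 2 * (K * p)) := by
        gcongr
        · exact hr.trans (by gcongr)
        · exact hac.trans (by gcongr)
      _ ≤ C ^ 2 * (K ^ 2 * p + K ^ 2 * p + 2 * (K ^ 2 * p)) := by
        have k1 : p ^ 2 ≤ K ^ 2 * p := by nlinarith [mul_nonneg hp (by nlinarith : 0 ≤ K ^ 2 - 1)]
        have k2 : K * p ≤ K ^ 2 * p := by gcongr; nlinarith
        gcongr
      _ = _ := by ring
  have g0 := (gubinelliCoeff σ u c - gubinelliCoeff σ s a).opNorm_nonneg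
  calc _ ≤ _ := norm_add_le _ _
    _ ≤ (3 * C * K ^ 2 * p ^ 2) * (C * q) + C * (4 * C ^ 2 * K ^ 2 * p) * (q * p) := by
      refine add_le_add ((ContinuousLinearMap.le_opNorm _ _).trans ?_) (z₂.trans ?_)
      · have : ‖delta₁ ζ u t‖ ≤ C * q := z₁.trans (by gcongr)
        gcongr
      -- The area has order 2κ; against an increment of order 1/3, only κ + 1/3 of it is needed.
      · have : q' ^ 2 ≤ q * p := by rw [pow_two]; gcongr; exact hqq.trans hqp
        gcongr
    _ = 3 * C ^ 2 * K ^ 2 * (p ^ 2 * q) + 4 * C ^ 3 * K ^ 2 * (p ^ 2 * q) := by ring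
    _ ≤ 3 * C ^ 3 * K ^ 2 * (p ^ 2 * q) + 4 * C ^ 3 * K ^ 2 * (p ^ 2 * q) := by
      gcongr
      norm_num
    _ = _ := by ring

end Estimates

/-! ### Euler schemes, uniform estimates and their limit -/

section Euler

variable {m d : ℕ}

theorem DriftBounds.intervalIntegrable {T C : ℝ} {B : ℝ → Euc m → Euc m} (hB : DriftBounds T C B)
    {s t : ℝ} (h0 : 0 ≤ s) (hst : s ≤ t) (htT : t ≤ T) (a : Euc m) :
    IntervalIntegrable (fun v => B v a) volume s t :=
  ContinuousOn.intervalIntegrable_of_Icc hst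
    ((hB.continuousOn a).mono (Icc_subset_Icc h0 htT))

theorem DriftBounds.norm_integral_le {T C : ℝ} {B : ℝ → Euc m → Euc m} (hB : DriftBounds T C B)
    {s t : ℝ} (h0 : 0 ≤ s) (hst : s ≤ t) (htT : t ≤ T) (x : ℝ → Euc m) :
    ‖∫ v in s..t, B v (x v)‖ ≤ C * (t - s) := by
  rw [← abs_of_nonneg (sub_nonneg.2 hst)]
  refine intervalIntegral.norm_integral_le_of_norm_le_const fun v hv => ?_
  rw [uIoc_of_le hst] at hv
  exact hB.bound v ⟨h0.trans hv.1.le, hv.2.trans htT⟩ _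

theorem DriftBounds.norm_integral_sub_le {T C K : ℝ} {B : ℝ → Euc m → Euc m}
    (hB : DriftBounds T C B) {s t : ℝ} (h0 : 0 ≤ s) (hst : s ≤ t) (htT : t ≤ T)
    {x z : ℝ → Euc m} (hx : ContinuousOn x (Icc 0 T)) (hz : ContinuousOn z (Icc 0 T)) (hC : 0 ≤ C)
    (hK : ∀ v ∈ Icc s t, ‖x v - z v‖ ≤ K) :
    ‖(∫ v in s..t, B v (x v)) - ∫ v in s..t, B v (z v)‖ ≤ C * K * (t - s) := by
  have hsub := Icc_subset_Icc h0 htT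
  rw [← intervalIntegral.integral_sub
    (((hB.continuousOn_comp hx).mono hsub).intervalIntegrable_of_Icc hst)
    (((hB.continuousOn_comp hz).mono hsub).intervalIntegrable_of_Icc hst),
    ← abs_of_nonneg (sub_nonneg.2 hst)]
  refine intervalIntegral.norm_integral_le_of_norm_le_const fun v hv => ?_
  rw [uIoc_of_le hst] at hv
  refine (hB.lip v ⟨h0.trans hv.1.le, hv.2.trans htT⟩ _ _).trans ?_
  gcongr
  exact hK v ⟨hv.1.le, hv.2⟩

/-- The defect of a path `x` with respect to the second-order Euler step. -/
noncomputable def eulerDefect (ζ : ℝ → Euc d) (ζ₂ : ℝ → ℝ → Fin d → Fin d → ℝ)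
    (B : ℝ → Euc m → Euc m) (σ : ℝ → Euc m → Euc d →L[ℝ] Euc m) (x : ℝ → Euc m) (s t : ℝ) :
    Euc m :=
  delta₁ x s t - (σ s (x s) (delta₁ ζ s t) + contract (gubinelliCoeff σ s (x s)) (ζ₂ s t)) -
    ∫ v in s..t, B v (x s)

/-- The Euler scheme over a finite set of times. -/
theorem exists_euler_scheme (ζ : ℝ → Euc d) (ζ₂ : ℝ → ℝ → Fin d → Fin d → ℝ)
    (B : ℝ → Euc m → Euc m) (σ : ℝ → Euc m → Euc d →L[ℝ] Euc m) (y : Euc m) (P : Finset ℝ)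
    (hP : ∀ t ∈ P, 0 ≤ t) :
    ∃ x : ℝ → Euc m, x 0 = y ∧ ∀ s ∈ P, ∀ t ∈ P, s < t → (∀ u ∈ P, ¬ (s < u ∧ u < t)) →
      eulerDefect ζ ζ₂ B σ x s t = 0 := by
  induction P using Finset.induction_on_max with
  | empty => exact ⟨fun _ => y, rfl, by simp⟩
  | insert a P ha ih =>
    obtain ⟨x, hx0, hx⟩ := ih fun t ht => hP t (Finset.mem_insert_of_mem ht)
    rcases P.eq_empty_or_nonempty with rfl | hne
    · refine ⟨x, hx0, fun s hs t ht hst => ?_⟩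
      simp only [insert_empty_eq, Finset.mem_singleton] at hs ht
      linarith
    set q := P.max' hne with hq
    have hqP : q ∈ P := P.max'_mem hne
    have hqa : q < a := ha q hqP
    have hq0 : 0 ≤ q := hP q (Finset.mem_insert_of_mem hqP)
    have ha0 : 0 ≠ a := by linarith [hP q (Finset.mem_insert_of_mem hqP)] |> ne_of_lt
    -- The drift of a step is frozen at its left endpoint, so a defect sees the path at two times
    -- only. Changing the value at the new last time `a` leaves earlier defects intact.
    refine ⟨Function.update x a (x q + (σ q (x q) (delta₁ ζ q a) +
      contract (gubinelliCoeff σ q (x q)) (ζ₂ q a)) + ∫ v in q..a, B v (x q)), ?_, ?_⟩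
    · rw [Function.update_of_ne ha0, hx0]
    · intro s hs t ht hst hcons
      have hsP : s ∈ P := by
        rcases Finset.mem_insert.1 hs with rfl | h
        · rcases Finset.mem_insert.1 ht with rfl | h'
          · exact absurd hst (lt_irrefl _)
          · exact absurd hst (ha t h').le.not_gt
        · exact h
      have hsa : s ≠ a := (ha s hsP).ne
      rcases Finset.mem_insert.1 ht with rfl | htP
      · have hsq : s = q := by
          refine le_antisymm (P.le_max' s hsP) (not_lt.1 fun h => ?_)
          exact hcons q (Finset.mem_insert_of_mem hqP) ⟨h, hqa⟩
        subst hsq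
        simp only [eulerDefect, delta₁, Function.update_self, Function.update_of_ne hsa]
        abel
      · have hta : t ≠ a := (ha t htP).ne
        have := hx s hsP t htP hst fun u hu => hcons u (Finset.mem_insert_of_mem hu)
        simpa only [eulerDefect, delta₁, Function.update_of_ne hsa, Function.update_of_ne hta]
          using this

variable {T α κ C : ℝ} {ζ : ℝ → Euc d} {ζ₂ : ℝ → ℝ → Fin d → Fin d → ℝ} {B : ℝ → Euc m → Euc m}
  {σ : ℝ → Euc m → Euc d →L[ℝ] Euc m}

theorem delta₂_eulerDefect (hζ : IsRoughPath T α ζ ζ₂) (hB : DriftBounds T C B) (x : ℝ → Euc m)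
    {s u t : ℝ} (h0 : 0 ≤ s) (hsu : s ≤ u) (hut : u ≤ t) (htT : t ≤ T) :
    delta₂ (eulerDefect ζ ζ₂ B σ x) s u t =
      ((σ u (x u) - σ s (x s) - gubinelliCoeff σ s (x s) (delta₁ ζ s u)) (delta₁ ζ u t) +
        contract (gubinelliCoeff σ u (x u) - gubinelliCoeff σ s (x s)) (ζ₂ u t)) +
      ((∫ v in u..t, B v (x u)) - ∫ v in u..t, B v (x s)) := by
  have h := delta₂_germ hζ (fun s => σ s (x s)) (fun s => gubinelliCoeff σ s (x s)) h0 hsu hut htT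
  have hI := intervalIntegral.integral_add_adjacent_intervals
    (hB.intervalIntegrable h0 hsu (hut.trans htT) (x s))
    (hB.intervalIntegrable (h0.trans hsu) hut htT (x s))
  simp only [remainder, delta₁] at h
  rw [← neg_eq_iff_eq_neg] at h
  simp only [delta₁]
  rw [← h]
  simp only [delta₂, eulerDefect, ← hI, delta₁]
  abel

/-- Increments of a path in terms of its Euler defect. -/
theorem norm_increment_le_of_eulerDefect (hκ : 1 / 3 < κ) (hC : 1 ≤ C)
    (hζ : PathBounds m T κ C ζ ζ₂) (hσ : SigmaBounds T C σ) (hB : DriftBounds T C B)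
    {x : ℝ → Euc m} {s t : ℝ} (h0 : 0 ≤ s) (hst : s ≤ t) (htT : t ≤ T) (h1 : t - s ≤ 1)
    (he : ‖eulerDefect ζ ζ₂ B σ x s t‖ ≤ ((t - s) ^ (1 / 3 : ℝ)) ^ 2) :
    ‖x t - x s‖ ≤ 4 * C ^ 3 * (t - s) ^ (1 / 3 : ℝ) ∧
      ‖x t - x s - σ s (x s) (delta₁ ζ s t)‖ ≤ 4 * C ^ 3 * ((t - s) ^ (1 / 3 : ℝ)) ^ 2 := by
  have hs : s ∈ Icc 0 T := ⟨h0, by linarith⟩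
  have hr0 : 0 ≤ t - s := sub_nonneg.2 hst
  have hr := le_sq_rpow_third hr0 h1
  have hqp := rpow_le_rpow_third hκ hr0 h1
  have hp1 : (t - s) ^ (1 / 3 : ℝ) ≤ 1 := Real.rpow_le_one hr0 h1 (by norm_num)
  have hq : 0 ≤ (t - s) ^ κ := Real.rpow_nonneg hr0 _
  have z₁ := hζ.path s t h0 hst htT
  have z₂ := hζ.area s t h0 hst htT (gubinelliCoeff σ s (x s))
  have g := hσ.norm_gubinelliCoeff_le hs (x s)
  have i₁ := hB.norm_integral_le h0 hst htT fun _ => x s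
  generalize (t - s) ^ (1 / 3 : ℝ) = p at *
  generalize (t - s) ^ κ = q at *
  have hp : 0 ≤ p := hq.trans hqp
  have hC3 : C ≤ C ^ 3 := le_self_pow₀ hC (by norm_num)
  have hC2 : C ^ 2 ≤ C ^ 3 := by gcongr; norm_num
  have e₁ : x t - x s - σ s (x s) (delta₁ ζ s t) =
      contract (gubinelliCoeff σ s (x s)) (ζ₂ s t) + (∫ v in s..t, B v (x s)) +
        eulerDefect ζ ζ₂ B σ x s t := by
    simp only [eulerDefect, delta₁]; abel
  have b₁ : ‖x t - x s - σ s (x s) (delta₁ ζ s t)‖ ≤ (C ^ 3 + C + 1) * p ^ 2 := by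
    rw [e₁]
    calc _ ≤ _ := norm_add₃_le
      _ ≤ C * C ^ 2 * p ^ 2 + C * p ^ 2 + p ^ 2 := by
        refine add_le_add (add_le_add (z₂.trans ?_) (i₁.trans ?_)) he
        · have := (gubinelliCoeff σ s (x s)).opNorm_nonneg
          gcongr
        · gcongr
      _ = _ := by ring
  refine ⟨?_, b₁.trans ?_⟩
  · have e₂ : x t - x s = σ s (x s) (delta₁ ζ s t) + (x t - x s - σ s (x s) (delta₁ ζ s t)) := by
      abel
    rw [e₂]
    calc _ ≤ _ := norm_add_le _ _
      _ ≤ C * (C * p) + (C ^ 3 + C + 1) * p := by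
        refine add_le_add ?_ (b₁.trans ?_)
        · refine (ContinuousLinearMap.le_opNorm _ _).trans ?_
          have := hσ.bound s hs (x s)
          have : ‖delta₁ ζ s t‖ ≤ C * p := z₁.trans (by gcongr)
          gcongr
        · have : p ^ 2 ≤ p := by nlinarith
          gcongr
      _ = (C ^ 2 + C ^ 3 + C + 1) * p := by ring
      _ ≤ 4 * C ^ 3 * p := by
        gcongr
        linarith
  · gcongr
    linarith

/-- The uniform estimate for the Euler scheme. -/
theorem exists_uniform_euler_bound (hκ : 1 / 3 < κ) (hκ' : κ ≤ 1 / 2) (hC : 1 ≤ C)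
    (hR : IsRoughPath T α ζ ζ₂) (hζ : PathBounds m T κ C ζ ζ₂) (hσ : SigmaBounds T C σ)
    (hB : DriftBounds T C B) :
    ∃ M τ : ℝ, 0 ≤ M ∧ 0 < τ ∧ τ ≤ 1 ∧ ∀ (P : Finset ℝ), (∀ t ∈ P, t ∈ Icc 0 T) →
      ∀ x : ℝ → Euc m, (∀ s ∈ P, ∀ t ∈ P, s < t → (∀ u ∈ P, ¬ (s < u ∧ u < t)) →
        eulerDefect ζ ζ₂ B σ x s t = 0) →
      ∀ s ∈ P, ∀ t ∈ P, s ≤ t → t - s ≤ τ →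
        ‖eulerDefect ζ ζ₂ B σ x s t‖ ≤ M * (t - s) ^ (2 / 3 + κ) ∧
        ‖x t - x s‖ ≤ 4 * C ^ 3 * (t - s) ^ (1 / 3 : ℝ) := by
  -- A defect bounded by r^(2/3), with constant one, yields increments bounded with this `K`. As `K`
  -- does not involve `M`, the choices of c, `M` and then τ are not circular.
  set K := 4 * C ^ 3 with hK
  have hC3 : C ≤ C ^ 3 := le_self_pow₀ hC (by norm_num)
  have hK1 : 1 ≤ K := by linarith
  set c := 7 * C ^ 3 * K ^ 2 + C * K with hc
  have hc0 : 0 ≤ c := by positivity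
  have hθ : 1 < 2 / 3 + κ := by linarith
  have hhalf := two_mul_half_rpow_lt_one hθ
  set M := 2 * c / (1 - 2 * (1 / 2) ^ (2 / 3 + κ)) with hM
  have hM0 : 0 ≤ M := div_nonneg (by positivity) (by linarith)
  have hcM : 2 * (1 / 2) ^ (2 / 3 + κ) * M + 2 * c ≤ M := by
    have : 1 - (2 : ℝ) * (1 / 2) ^ (2 / 3 + κ) ≠ 0 := by linarith
    have h := div_mul_cancel₀ (2 * c) this
    rw [← hM] at h
    linarith
  -- For r ≤ τ one has M r^κ ≤ 1, so a defect bounded by M r^(2/3 + κ) is at most r^(2/3).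
  set τ : ℝ := (1 / (M + 1)) ^ (1 / κ) with hτ
  have hτ0 : 0 < τ := Real.rpow_pos_of_pos (by positivity) _
  have hM1 : 1 / (M + 1) ≤ 1 := by rw [div_le_one (by positivity)]; linarith
  have hτ1 : τ ≤ 1 := Real.rpow_le_one (by positivity) hM1 (by positivity)
  have hτκ : τ ^ κ = 1 / (M + 1) := by
    rw [hτ, ← Real.rpow_mul (by positivity), one_div_mul_cancel (by linarith), Real.rpow_one]
  have small : ∀ {V : Type} [NormedAddCommGroup V] (e : V) (r : ℝ), 0 ≤ r → r ≤ τ →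
      ‖e‖ ≤ M * r ^ (2 / 3 + κ) → ‖e‖ ≤ (r ^ (1 / 3 : ℝ)) ^ 2 := by
    intro V _ e r hr0 hr he
    refine he.trans ?_
    rw [rpow_two_thirds_add hκ hr0]
    have h1 : r ^ κ ≤ 1 / (M + 1) := hτκ ▸ Real.rpow_le_rpow hr0 hr (by linarith)
    calc M * ((r ^ (1 / 3 : ℝ)) ^ 2 * r ^ κ) ≤ M * ((r ^ (1 / 3 : ℝ)) ^ 2 * (1 / (M + 1))) := by
          gcongr
      _ = M / (M + 1) * (r ^ (1 / 3 : ℝ)) ^ 2 := by ring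
      _ ≤ 1 * (r ^ (1 / 3 : ℝ)) ^ 2 := by
        gcongr
        rw [div_le_one (by positivity)]
        linarith
      _ = _ := one_mul _
  refine ⟨M, τ, hM0, hτ0, hτ1, fun P hP x hx => ?_⟩
  have main : ∀ s ∈ P, ∀ t ∈ P, s ≤ t → t - s ≤ τ →
      ‖eulerDefect ζ ζ₂ B σ x s t‖ ≤ M * (t - s) ^ (2 / 3 + κ) := by
    refine norm_le_of_discrete_sewing hM0 hc0 (by linarith) hcM ?_ hx ?_
    · intro s hs
      have h := hP s hs
      have z₂ := hζ.area s s h.1 le_rfl h.2 (gubinelliCoeff σ s (x s))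
      rw [sub_self, Real.zero_rpow (by linarith)] at z₂
      have z₃ : contract (gubinelliCoeff σ s (x s)) (ζ₂ s s) = 0 := by
        rw [← norm_le_zero_iff]; simpa using z₂
      simp [eulerDefect, delta₁, z₃]
    -- The bootstrap: the inductive bound `he` on [s, u] controls the path there, and this alone
    -- bounds the increment of the defect.
    · intro s hs u hu t ht hsu hut hst he
      have h0 := (hP s hs).1
      have htT := (hP t ht).2
      have hst0 : 0 ≤ t - s := by linarith
      obtain ⟨b₁, b₂⟩ := norm_increment_le_of_eulerDefect hκ hC hζ hσ hB h0 hsu (hut.trans htT)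
        (by linarith) (small _ (u - s) (by linarith) (by linarith) he)
      have g := norm_germ_increment_le hκ hC hζ hσ hK1 h0 hsu hut htT (by linarith) b₁ b₂
      have i := hB.norm_integral_sub_le (h0.trans hsu) hut htT
        (x := fun _ => x u) (z := fun _ => x s) continuousOn_const continuousOn_const
        (by linarith) (fun _ _ => b₁)
      rw [delta₂_eulerDefect hR hB x h0 hsu hut htT]
      calc _ ≤ _ := norm_add_le _ _
        _ ≤ 7 * C ^ 3 * K ^ 2 * (t - s) ^ (2 / 3 + κ) + C * K * (t - s) ^ (2 / 3 + κ) := by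
          refine add_le_add g (i.trans ?_)
          have h4 : (u - s) ^ (1 / 3 : ℝ) * (t - u) ≤ (t - s) ^ (2 / 3 + κ) := by
            refine le_trans ?_ (rpow_third_mul_self_le hκ hκ' hst0 (by linarith))
            have : 0 ≤ t - u := by linarith
            have : 0 ≤ u - s := by linarith
            gcongr
          calc C * (K * (u - s) ^ (1 / 3 : ℝ)) * (t - u)
              = C * K * ((u - s) ^ (1 / 3 : ℝ) * (t - u)) := by ring
            _ ≤ _ := by gcongr
        _ = _ := by rw [hc]; ring
  intro s hs t ht hst hτ'
  have he := main s hs t ht hst hτ'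
  exact ⟨he, (norm_increment_le_of_eulerDefect hκ hC hζ hσ hB (hP s hs).1 hst (hP t ht).2
    (by linarith) (small _ (t - s) (by linarith) hτ' he)).1⟩

/-- The Euler defect depends continuously on the path. -/
theorem tendsto_eulerDefect (hσ : SigmaBounds T C σ)
    (hB : DriftBounds T C B) (hC : 1 ≤ C) {β : Type*} {l : Filter β} {X : β → ℝ → Euc m}
    {x : ℝ → Euc m} {s t : ℝ} (h0 : 0 ≤ s) (hst : s ≤ t) (htT : t ≤ T)
    (hs : Filter.Tendsto (fun i => X i s) l (𝓝 (x s)))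
    (ht : Filter.Tendsto (fun i => X i t) l (𝓝 (x t))) :
    Filter.Tendsto (fun i => eulerDefect ζ ζ₂ B σ (X i) s t) l
      (𝓝 (eulerDefect ζ ζ₂ B σ x s t)) := by
  have hsT : s ∈ Icc 0 T := ⟨h0, hst.trans htT⟩
  have c₁ : Continuous (σ s) :=
    continuous_iff_continuousAt.2 fun a => (hσ.hasFDerivAt s hsT a).continuousAt
  have c₂ : Continuous (fderiv ℝ (σ s)) :=
    continuous_iff_continuousAt.2 fun a => (hσ.hasFDerivAt_deriv s hsT a).continuousAt
  have c₃ : Continuous (gubinelliCoeff σ s) := c₂.clm_comp c₁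
  have c₄ : Continuous fun a => ∫ v in s..t, B v a := by
    refine (LipschitzWith.of_dist_le_mul (K := ⟨C * (t - s), by
      have := sub_nonneg.2 hst; positivity⟩) fun a c => ?_).continuous
    rw [dist_eq_norm, dist_eq_norm]
    refine (hB.norm_integral_sub_le h0 hst htT (x := fun _ => a) (z := fun _ => c)
      continuousOn_const continuousOn_const (by linarith) (fun _ _ => le_rfl)).trans (le_of_eq ?_)
    change _ = C * (t - s) * ‖a - c‖
    ring
  have c₅ : Continuous fun a => σ s a (delta₁ ζ s t) := c₁.clm_apply continuous_const
  have c₆ := (continuous_contract_left (V := Euc m) (ζ₂ s t)).comp c₃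
  exact ((ht.sub hs).sub (((c₅.tendsto _).comp hs).add ((c₆.tendsto _).comp hs))).sub
    ((c₄.tendsto _).comp hs)

/-- Existence of a path with small Euler defect, by compactness of the Euler schemes. -/
theorem exists_path_eulerDefect_le (hκ : 1 / 3 < κ) (hκ' : κ ≤ 1 / 2) (hC : 1 ≤ C)
    (hR : IsRoughPath T α ζ ζ₂) (hζ : PathBounds m T κ C ζ ζ₂) (hσ : SigmaBounds T C σ)
    (hB : DriftBounds T C B) (y : Euc m) (hT : 0 < T) :
    ∃ (x : ℝ → Euc m) (M τ : ℝ), x 0 = y ∧ 0 ≤ M ∧ 0 < τ ∧ τ ≤ 1 ∧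
      ∀ s t : ℝ, 0 ≤ s → s ≤ t → t ≤ T → t - s ≤ τ →
        ‖eulerDefect ζ ζ₂ B σ x s t‖ ≤ M * (t - s) ^ (2 / 3 + κ) ∧
        ‖x t - x s‖ ≤ 4 * C ^ 3 * (t - s) ^ (1 / 3 : ℝ) := by
  classical
  obtain ⟨M, τ, hM0, hτ0, hτ1, H⟩ := exists_uniform_euler_bound hκ hκ' hC hR hζ hσ hB
  have hsch : ∀ P : Finset ℝ, ∃ x : ℝ → Euc m, x 0 = y ∧
      ∀ s ∈ P.filter (· ∈ Icc 0 T), ∀ t ∈ P.filter (· ∈ Icc 0 T), s < t →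
        (∀ u ∈ P.filter (· ∈ Icc 0 T), ¬ (s < u ∧ u < t)) →
        eulerDefect ζ ζ₂ B σ x s t = 0 := fun P =>
    exists_euler_scheme ζ ζ₂ B σ y _ fun t ht => (Finset.mem_filter.1 ht).2.1
  choose X hX0 hX using hsch
  -- Along this ultrafilter any given times eventually belong to `P`. Values bounded at a fixed time
  -- converge, and every bound at a fixed pair of times passes to the limit.
  set l : Ultrafilter (Finset ℝ) := Ultrafilter.of Filter.atTop with hl
  have hle : (l : Filter (Finset ℝ)) ≤ Filter.atTop := Ultrafilter.of_le _
  have hev : ∀ s t : ℝ, 0 ≤ s → s ≤ t → t ≤ T → t - s ≤ τ → ∀ᶠ P in (l : Filter (Finset ℝ)),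
      ‖eulerDefect ζ ζ₂ B σ (X P) s t‖ ≤ M * (t - s) ^ (2 / 3 + κ) ∧
        ‖X P t - X P s‖ ≤ 4 * C ^ 3 * (t - s) ^ (1 / 3 : ℝ) := by
    intro s t h0 hst htT hτ
    refine hle ?_
    filter_upwards [Filter.eventually_ge_atTop ({s, t} : Finset ℝ)] with P hP
    refine H (P.filter (· ∈ Icc 0 T)) (fun t ht => (Finset.mem_filter.1 ht).2) (X P) (hX P)
      s ?_ t ?_ hst hτ
    · exact Finset.mem_filter.2 ⟨hP (by simp), h0, hst.trans htT⟩
    · exact Finset.mem_filter.2 ⟨hP (by simp), h0.trans hst, htT⟩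
  -- The increment bound holds only on lengths up to τ, so it is chained from the initial value y.
  have hbd : ∀ n : ℕ, ∀ t ∈ Icc 0 T, t ≤ n * τ → ∃ D : ℝ, ∀ᶠ P in (l : Filter (Finset ℝ)),
      ‖X P t‖ ≤ D := by
    intro n
    induction n with
    | zero =>
      intro t ht htn
      have : t = 0 := le_antisymm (by simpa using htn) ht.1
      subst this
      exact ⟨‖y‖, Filter.Eventually.of_forall fun P => by rw [hX0]⟩
    | succ n ih =>
      intro t ht htn
      push_cast at htn
      rcases le_or_gt t (n * τ) with h | h
      · exact ih t ht h
      obtain ⟨D, hD⟩ := ih (n * τ) ⟨by positivity, h.le.trans ht.2⟩ le_rfl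
      refine ⟨D + 4 * C ^ 3 * (t - n * τ) ^ (1 / 3 : ℝ), ?_⟩
      filter_upwards [hD, hev (n * τ) t (by positivity) h.le ht.2 (by linarith)] with P h₁ h₂
      calc ‖X P t‖ = ‖X P (n * τ) + (X P t - X P (n * τ))‖ := by rw [add_sub_cancel]
        _ ≤ _ := (norm_add_le _ _).trans (add_le_add h₁ h₂.2)
  have hlim : ∀ t : ℝ, ∃ a : Euc m, t ∈ Icc 0 T →
      Filter.Tendsto (fun P => X P t) l (𝓝 a) := by
    intro t
    by_cases ht : t ∈ Icc 0 T
    · obtain ⟨n, hn⟩ := exists_nat_ge (t / τ)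
      obtain ⟨D, hD⟩ := hbd n t ht ((div_le_iff₀ hτ0).1 hn)
      obtain ⟨a, -, ha⟩ := (isCompact_closedBall (0 : Euc m) D).ultrafilter_le_nhds
        (l.map fun P => X P t) (by
          rw [Filter.le_principal_iff]
          change ∀ᶠ P in (l : Filter (Finset ℝ)), X P t ∈ Metric.closedBall 0 D
          filter_upwards [hD] with P hP
          simpa using hP)
      exact ⟨a, fun _ => ha⟩
    · exact ⟨0, fun h => absurd h ht⟩
  choose x hx using hlim
  refine ⟨x, M, τ, ?_, hM0, hτ0, hτ1, fun s t h0 hst htT hτ => ?_⟩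
  · have := hx 0 ⟨le_rfl, hT.le⟩
    simp only [hX0] at this
    exact tendsto_nhds_unique this tendsto_const_nhds
  · have hs := hx s ⟨h0, hst.trans htT⟩
    have ht := hx t ⟨h0.trans hst, htT⟩
    have he := hev s t h0 hst htT hτ
    exact ⟨le_of_tendsto (tendsto_eulerDefect hσ hB hC h0 hst htT hs ht).norm
      (he.mono fun _ h => h.1), le_of_tendsto (ht.sub hs).norm (he.mono fun _ h => h.2)⟩

end Euler

/-! ### From an expansion to a primitive -/

section Primitive

variable {d : ℕ} {V : Type*} [NormedAddCommGroup V] [NormedSpace ℝ V]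

/-- A second-order expansion with an error of order more than one characterizes primitives. -/
theorem isPrimitive_of_expansion {T α κ ν : ℝ} {ζ : ℝ → Euc d} {ζ₂ : ℝ → ℝ → Fin d → Fin d → ℝ}
    (hζ : IsRoughPath T α ζ ζ₂) (hκ : 1 / 3 < κ) (hκα : κ ≤ α) (hν : 1 < ν)
    {η : ℝ → V} {μ : ℝ → Euc d →L[ℝ] V} {μ' : ℝ → Euc d →L[ℝ] Euc d →L[ℝ] V} {z : ℝ → V}
    (hη : ContinuousOn η (Icc 0 T)) (hμ : IsControlled T κ ζ μ μ')
    (hz : IsHolder₂ T ν fun s t => delta₁ z s t -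
      (μ s (delta₁ ζ s t) + contract (μ' s) (ζ₂ s t)) - ∫ u in s..t, η u) :
    IsPrimitive T κ ζ ζ₂ η μ μ' z := by
  set g : ℝ → ℝ → V := fun s t => delta₁ z s t -
      (μ s (delta₁ ζ s t) + contract (μ' s) (ζ₂ s t)) - ∫ u in s..t, η u with hg
  have hκ0 : 0 < κ := by linarith
  have hδ : ∀ s u t : ℝ, 0 ≤ s → s ≤ u → u ≤ t → t ≤ T → delta₂ g s u t =
      remainder ζ μ μ' s u (delta₁ ζ u t) + contract (delta₁ μ' s u) (ζ₂ u t) := by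
    intro s u t h0 hsu hut htT
    have h := delta₂_germ hζ μ μ' h0 hsu hut htT
    have hI := intervalIntegral.integral_add_adjacent_intervals
      ((hη.mono (Icc_subset_Icc h0 (hut.trans htT))).intervalIntegrable_of_Icc (μ := volume) hsu)
      ((hη.mono (Icc_subset_Icc (h0.trans hsu) htT)).intervalIntegrable_of_Icc (μ := volume) hut)
    rw [← neg_eq_iff_eq_neg] at h
    rw [← h]
    simp only [delta₂, hg, ← hI, delta₁]
    abel
  -- The error term itself serves as Λ. Its order ν > 1 is raised to 3κ by the sewing bound, since
  -- its increment has order 3κ.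
  refine ⟨hη, hμ, g, ⟨?_, hδ⟩, fun s t _ _ _ => ?_⟩
  · obtain ⟨K, hK0, hK⟩ := hz.exists_nonneg
    obtain ⟨R, hR0, hR⟩ := hμ.holder_remainder.exists_nonneg
    obtain ⟨D, hD0, hD⟩ := IsHolder₂.exists_nonneg hμ.holder_deriv
    obtain ⟨Z, hZ0, hZ⟩ := (IsHolder₂.mono_exponent hζ.holder hκ0 hκα).exists_nonneg
    obtain ⟨Y, hY0, hY⟩ :=
      (hζ.holder_two.mono_exponent (ν := 2 * κ) (by linarith) (by linarith)).exists_nonneg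
    refine ⟨_, norm_le_of_delta₂_le (N := R * Z + d * d * (D * Y)) hν (ν := 3 * κ) (by linarith)
      (by positivity) hK ?_⟩
    intro s u t h0 hsu hut htT
    have a₁ : 0 ≤ u - s := sub_nonneg.2 hsu
    have a₂ : 0 ≤ t - u := sub_nonneg.2 hut
    have a₃ : 0 ≤ t - s := by linarith
    have b₁ := hR s u h0 hsu (hut.trans htT)
    have b₂ := hZ u t (h0.trans hsu) hut htT
    have b₃ := hD s u h0 hsu (hut.trans htT)
    have b₄ := hY u t (h0.trans hsu) hut htT
    have e₁ : (t - s) ^ (3 * κ) = (t - s) ^ (2 * κ) * (t - s) ^ κ := by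
      rw [← Real.rpow_add_of_nonneg a₃ (by linarith) hκ0.le]; ring_nf
    rw [hδ s u t h0 hsu hut htT]
    calc _ ≤ _ := norm_add_le _ _
      _ ≤ (R * (t - s) ^ (2 * κ)) * (Z * (t - s) ^ κ) +
          d * d * ((D * (t - s) ^ κ) * (Y * (t - s) ^ (2 * κ))) := by
        refine add_le_add ((ContinuousLinearMap.le_opNorm _ _).trans ?_)
          ((norm_contract_le _ _).trans ?_)
        · refine mul_le_mul (b₁.trans ?_) (b₂.trans ?_) (norm_nonneg _) (by positivity)
          · gcongr
          · gcongr
        · refine mul_le_mul_of_nonneg_left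
            (mul_le_mul (b₃.trans ?_) (b₄.trans ?_) (norm_nonneg _) (by positivity))
            (by positivity)
          · gcongr
          · gcongr
      _ = _ := by rw [e₁]; ring
  · simp only [hg]; abel

end Primitive

/-! ### From a small defect to a solution -/

section Existence

variable {m d : ℕ} {T α κ C : ℝ} {ζ : ℝ → Euc d} {ζ₂ : ℝ → ℝ → Fin d → Fin d → ℝ}
  {B : ℝ → Euc m → Euc m} {σ : ℝ → Euc m → Euc d →L[ℝ] Euc m}

/-- The defect of a path `x` with respect to the integrated equation. -/
noncomputable def equationDefect (ζ : ℝ → Euc d) (ζ₂ : ℝ → ℝ → Fin d → Fin d → ℝ)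
    (B : ℝ → Euc m → Euc m) (σ : ℝ → Euc m → Euc d →L[ℝ] Euc m) (x : ℝ → Euc m) (s t : ℝ) :
    Euc m :=
  delta₁ x s t - (σ s (x s) (delta₁ ζ s t) + contract (gubinelliCoeff σ s (x s)) (ζ₂ s t)) -
    ∫ v in s..t, B v (x v)

/-- Order of the first-order remainder of a path with small equation defect. -/
theorem isHolder₂_remainder_of_equationDefect (hσ : SigmaBounds T C σ) (hB : DriftBounds T C B)
    (hC : 0 ≤ C) {x : ℝ → Euc m} {ν : ℝ} (hν : 0 < ν) (hν1 : ν ≤ 1) (hζ₂ : IsHolder₂ T ν ζ₂)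
    (he : IsHolder₂ T ν (equationDefect ζ ζ₂ B σ x)) :
    IsHolder₂ T ν (remainder ζ x fun s => σ s (x s)) := by
  refine isHolder₂_of_norm_le (d * d * C ^ 2) C 1 (by positivity) hC zero_le_one hζ₂
    ((isHolder₂_sub T).mono_exponent hν hν1) he fun s t h0 hst htT => ?_
  have hs : s ∈ Icc 0 T := ⟨h0, hst.trans htT⟩
  have e : remainder ζ x (fun s => σ s (x s)) s t = contract (gubinelliCoeff σ s (x s)) (ζ₂ s t) +
      (∫ v in s..t, B v (x v)) + equationDefect ζ ζ₂ B σ x s t := by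
    simp only [remainder, equationDefect]; abel
  rw [e, Real.norm_of_nonneg (sub_nonneg.2 hst), one_mul]
  refine norm_add₃_le.trans (add_le_add (add_le_add ?_ (hB.norm_integral_le h0 hst htT x)) le_rfl)
  refine (norm_contract_le _ _).trans ?_
  rw [← mul_assoc]
  gcongr
  exact hσ.norm_gubinelliCoeff_le hs _

theorem isHolder₁_of_remainder (hσ : SigmaBounds T C σ) (hC : 0 ≤ C) {x : ℝ → Euc m} {ν : ℝ}
    (hζ : IsHolder₁ T ν ζ) (hr : IsHolder₂ T ν (remainder ζ x fun s => σ s (x s))) :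
    IsHolder₁ T ν x := by
  refine isHolder₂_of_norm_le C 1 0 hC zero_le_one le_rfl hζ hr (isHolder₂_zero T ν)
    fun s t h0 hst htT => ?_
  have e : delta₁ x s t = σ s (x s) (delta₁ ζ s t) + remainder ζ x (fun s => σ s (x s)) s t := by
    simp only [remainder]; abel
  rw [e, one_mul, zero_mul, add_zero]
  exact (norm_add_le _ _).trans (add_le_add
    (ContinuousLinearMap.le_of_opNorm_le _ (hσ.bound s ⟨h0, hst.trans htT⟩ _) _) le_rfl)

theorem isHolder₂_sq_rpow_third (T : ℝ) :
    IsHolder₂ T (2 / 3) fun s t : ℝ => ((t - s) ^ (1 / 3 : ℝ)) ^ 2 := by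
  refine ⟨1, fun s t _ hst _ => le_of_eq ?_⟩
  have h := sub_nonneg.2 hst
  rw [Real.norm_of_nonneg (by positivity), one_mul]
  beta_reduce
  rw [← Real.rpow_natCast, ← Real.rpow_mul h]
  norm_num

/-- Paths whose equation defect is of order more than one are solutions. -/
theorem isSolution_of_equationDefect (hR : IsRoughPath T α ζ ζ₂) (hκ : 1 / 3 < κ) (hκα : κ ≤ α)
    (hκ' : κ ≤ 1 / 2) (hC : 0 ≤ C) (hσ : SigmaBounds T C σ) (hB : DriftBounds T C B)
    {x : ℝ → Euc m} {y : Euc m} (hx0 : x 0 = y) {ν : ℝ} (hν : 1 < ν)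
    (he : IsHolder₂ T ν (equationDefect ζ ζ₂ B σ x)) :
    IsSolution T κ ζ ζ₂ B σ y x (fun s => σ s (x s)) ∧ IsHolder₁ T (min α 1) x := by
  have hκ0 : 0 < κ := by linarith
  have hα0 : 0 < min α 1 := lt_min (by linarith) one_pos
  -- The drift integral contributes a term of order one to the remainder; this is where κ ≤ 1/2
  -- enters.
  have hr := isHolder₂_remainder_of_equationDefect hσ hB hC (ν := 2 * κ) (by linarith)
    (by linarith) (hR.holder_two.mono_exponent (by linarith) (by linarith))
    (he.mono_exponent (by linarith) (by linarith))
  have hx : IsHolder₁ T κ x := isHolder₁_of_remainder hσ hC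
    (IsHolder₂.mono_exponent hR.holder hκ0 hκα) (hr.mono_exponent hκ0 (by linarith))
  have hx' : IsHolder₁ T κ fun s => σ s (x s) := by
    refine isHolder₂_of_norm_le C C 0 hC hC le_rfl
      ((isHolder₂_sub T).mono_exponent hκ0 (by linarith)) hx (isHolder₂_zero T κ)
      fun s t h0 hst htT => ?_
    rw [Real.norm_of_nonneg (sub_nonneg.2 hst), zero_mul, add_zero]
    exact hσ.norm_sub_le ⟨h0, hst.trans htT⟩ ⟨h0.trans hst, htT⟩ hst _ _
  have hG : IsHolder₁ T κ fun s => gubinelliCoeff σ s (x s) := by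
    refine isHolder₂_of_norm_le (C ^ 2) (C ^ 2) (2 * C ^ 2) (by positivity) (by positivity)
      (by positivity) ((isHolder₂_sq_rpow_third T).mono_exponent hκ0 (by linarith))
      ((isHolder₂_sub T).mono_exponent hκ0 (by linarith)) hx fun s t h0 hst htT => ?_
    have h := sub_nonneg.2 hst
    rw [Real.norm_of_nonneg h, Real.norm_of_nonneg (by positivity)]
    refine (hσ.norm_gubinelliCoeff_sub_le ⟨h0, hst.trans htT⟩ ⟨h0.trans hst, htT⟩ hst _ _).trans
      (le_of_eq ?_)
    simp only [delta₁]
    ring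
  have hw : IsHolder₂ T (2 * κ) (remainder ζ (fun s => σ s (x s))
      fun s => gubinelliCoeff σ s (x s)) := by
    have hxx := IsHolder₂.norm_mul_norm hx hx hκ0 hκ0
    rw [← two_mul] at hxx
    refine isHolder₂_of_norm_le C C C hC hC hC
      ((isHolder₂_sub T).mono_exponent (by linarith) (by linarith)) hxx hr
      fun s t h0 hst htT => ?_
    rw [Real.norm_of_nonneg (sub_nonneg.2 hst), norm_mul, norm_norm, ← pow_two]
    exact hσ.norm_remainder_le ⟨h0, hst.trans htT⟩ ⟨h0.trans hst, htT⟩ hst _ _ _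
  refine ⟨⟨⟨hx, hx', hr⟩, hx0, ?_, fun _ _ => rfl⟩, ?_⟩
  · exact isPrimitive_of_expansion hR hκ hκα hν (hB.continuousOn_comp (hx.continuousOn hκ0))
      ⟨hx', hG, hw⟩ he
  -- For the regularity of x the remainder is needed at order min(α, 1) only: the area has order 2α,
  -- the drift order one, the defect order ν > 1.
  · refine isHolder₁_of_remainder hσ hC (IsHolder₂.mono_exponent hR.holder hα0 (min_le_left _ _))
      (isHolder₂_remainder_of_equationDefect hσ hB hC hα0 (min_le_right _ _)
        (hR.holder_two.mono_exponent hα0 ?_) (he.mono_exponent hα0 ?_))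
    · exact (min_le_left _ _).trans (by linarith)
    · exact (min_le_right _ _).trans hν.le

/-- The limit of the Euler schemes has a small defect with frozen drift on lengths up to τ.
Unfreezing the drift costs r^(1/3) · r, and pairs of times further apart are covered by boundedness.
-/
theorem exists_isHolder₂_equationDefect (hκ : 1 / 3 < κ) (hκ' : κ ≤ 1 / 2) (hC : 1 ≤ C)
    (hR : IsRoughPath T α ζ ζ₂) (hζ : PathBounds m T κ C ζ ζ₂) (hσ : SigmaBounds T C σ)
    (hB : DriftBounds T C B) (y : Euc m) (hT : 0 < T) :
    ∃ x : ℝ → Euc m, x 0 = y ∧ IsHolder₂ T (2 / 3 + κ) (equationDefect ζ ζ₂ B σ x) := by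
  obtain ⟨x, M, τ, hx0, hM0, hτ0, hτ1, H⟩ := exists_path_eulerDefect_le hκ hκ' hC hR hζ hσ hB y hT
  refine ⟨x, hx0, ?_⟩
  have hbd : ∀ n : ℕ, ∀ t ∈ Icc 0 T, t ≤ n * τ → ‖x t‖ ≤ ‖y‖ + n * (4 * C ^ 3) := by
    intro n
    induction n with
    | zero =>
      intro t ht htn
      have : t = 0 := le_antisymm (by simpa using htn) ht.1
      simp [this, hx0]
    | succ n ih =>
      intro t ht htn
      push_cast at htn ⊢
      have hC3 : 0 ≤ 4 * C ^ 3 := by positivity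
      rcases le_or_gt t (n * τ) with h | h
      · linarith [ih t ht h]
      · have h₁ := ih (n * τ) ⟨by positivity, h.le.trans ht.2⟩ le_rfl
        have h₂ := (H (n * τ) t (by positivity) h.le ht.2 (by linarith)).2
        have h₃ : (t - n * τ) ^ (1 / 3 : ℝ) ≤ 1 :=
          Real.rpow_le_one (by linarith) (by linarith) (by norm_num)
        calc ‖x t‖ = ‖x (n * τ) + (x t - x (n * τ))‖ := by rw [add_sub_cancel]
          _ ≤ (‖y‖ + n * (4 * C ^ 3)) + 4 * C ^ 3 * 1 := by
            refine (norm_add_le _ _).trans (add_le_add h₁ (h₂.trans ?_))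
            gcongr
          _ = _ := by ring
  obtain ⟨n, hn⟩ := exists_nat_ge (T / τ)
  rw [div_le_iff₀ hτ0] at hn
  set D := ‖y‖ + n * (4 * C ^ 3) with hD
  have hxD : ∀ t ∈ Icc 0 T, ‖x t‖ ≤ D := fun t ht => hbd n t ht (ht.2.trans hn)
  have hx : IsHolder₁ T (1 / 3) x := by
    refine isHolder₂_of_local (by norm_num) hτ0 (fun s t h0 hst htT hτ => (H s t h0 hst htT hτ).2)
      (D := D + D) fun s t h0 hst htT => ?_
    exact (norm_sub_le _ _).trans
      (add_le_add (hxD t ⟨h0.trans hst, htT⟩) (hxD s ⟨h0, hst.trans htT⟩))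
  have hxc := hx.continuousOn (by norm_num)
  refine isHolder₂_of_local (C := M + C * (4 * C ^ 3))
    (D := (D + D) + C * (C * T ^ κ) + C * C ^ 2 * (T ^ κ) ^ 2 + C * T) (by linarith) hτ0
    (fun s t h0 hst htT hτ => ?_) fun s t h0 hst htT => ?_
  · obtain ⟨h₁, -⟩ := H s t h0 hst htT hτ
    have hr := sub_nonneg.2 hst
    have h₂ := hB.norm_integral_sub_le h0 hst htT (x := fun _ => x s) (z := x) continuousOn_const hxc
      (by linarith) (K := 4 * C ^ 3 * (t - s) ^ (1 / 3 : ℝ)) fun v hv => by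
        rw [norm_sub_rev]
        refine (H s v h0 hv.1 (hv.2.trans htT) (by linarith [hv.2])).2.trans ?_
        have := sub_nonneg.2 hv.1
        gcongr
        exact hv.2
    have e : equationDefect ζ ζ₂ B σ x s t = eulerDefect ζ ζ₂ B σ x s t +
        ((∫ v in s..t, B v (x s)) - ∫ v in s..t, B v (x v)) := by
      simp only [equationDefect, eulerDefect]; abel
    rw [e, add_mul]
    refine (norm_add_le _ _).trans (add_le_add h₁ (h₂.trans ?_))
    calc C * (4 * C ^ 3 * (t - s) ^ (1 / 3 : ℝ)) * (t - s) =
        C * (4 * C ^ 3) * ((t - s) ^ (1 / 3 : ℝ) * (t - s)) := by ring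
      _ ≤ _ := by
        gcongr
        exact rpow_third_mul_self_le hκ hκ' hr (by linarith)
  · have hs : s ∈ Icc 0 T := ⟨h0, hst.trans htT⟩
    have hr := sub_nonneg.2 hst
    have hrT : t - s ≤ T := by linarith
    have hqT : (t - s) ^ κ ≤ T ^ κ := Real.rpow_le_rpow hr hrT (by linarith)
    have hq0 : 0 ≤ (t - s) ^ κ := Real.rpow_nonneg hr _
    have e : equationDefect ζ ζ₂ B σ x s t = (x t - x s) + -(σ s (x s) (delta₁ ζ s t)) +
        -(contract (gubinelliCoeff σ s (x s)) (ζ₂ s t)) + -∫ v in s..t, B v (x v) := by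
      simp only [equationDefect, delta₁]; abel
    rw [e]
    refine norm_add₄_le.trans (add_le_add (add_le_add (add_le_add ?_ ?_) ?_) ?_)
    · exact (norm_sub_le _ _).trans (add_le_add (hxD t ⟨h0.trans hst, htT⟩) (hxD s hs))
    · rw [norm_neg]
      refine (ContinuousLinearMap.le_opNorm _ _).trans ?_
      have := hσ.bound s hs (x s)
      have : ‖delta₁ ζ s t‖ ≤ C * T ^ κ := (hζ.path s t h0 hst htT).trans (by gcongr)
      gcongr
    · rw [norm_neg]
      refine (hζ.area s t h0 hst htT _).trans ?_
      have := hσ.norm_gubinelliCoeff_le hs (x s)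
      gcongr
    · rw [norm_neg]
      refine (hB.norm_integral_le h0 hst htT x).trans ?_
      gcongr

end Existence

/-! ### Estimates of the second-order germ along two paths -/

section FourPoint

variable {m d : ℕ}

/-- The second-order increment of a time-dependent function along two pairs of points. -/
theorem norm_space_time_four_point_le {V : Type*} [NormedAddCommGroup V] [NormedSpace ℝ V]
    {E : Type*} [NormedAddCommGroup E] [NormedSpace ℝ E] {f g : E → V} {f₁ g₁ : E → E →L[ℝ] V}
    {C K S p : ℝ} (hf : ∀ x, HasFDerivAt f (f₁ x) x) (hg : ∀ x, HasFDerivAt g (g₁ x) x)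
    (hC : ∀ x, ‖f₁ x‖ ≤ C) (hL : ∀ x y, ‖f₁ x - f₁ y‖ ≤ C * ‖x - y‖)
    (hfg : ∀ x, ‖g₁ x - f₁ x‖ ≤ C * p) (hK : 1 ≤ K) {a c a' c' : E}
    (hac : ‖c - a‖ ≤ K * p) (haa : ‖a - a'‖ ≤ S) (hcc : ‖c - c'‖ ≤ S)
    (hS : ‖(c - a) - (c' - a')‖ ≤ S * p) (hp : 0 ≤ p) :
    ‖(g c - f a) - (g c' - f a')‖ ≤ 4 * C * K * (S * p) := by
  have hC0 : 0 ≤ C := (norm_nonneg _).trans (hC a)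
  have hS0 : 0 ≤ S := (norm_nonneg _).trans haa
  have h₁ : ‖(g c - f c) - (g c' - f c')‖ ≤ C * p * ‖c - c'‖ :=
    convex_univ.norm_image_sub_le_of_norm_hasFDerivWithin_le (f := fun x => g x - f x)
      (fun z _ => ((hg z).sub (hf z)).hasFDerivWithinAt) (fun z _ => hfg z) trivial trivial
  have h₂ := norm_four_point_le hf hC hL c a c' a'
  have e : (g c - f a) - (g c' - f a') =
      ((g c - f c) - (g c' - f c')) + ((f c - f a) - (f c' - f a')) := by abel
  rw [e]
  calc _ ≤ _ := norm_add_le _ _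
    _ ≤ C * p * S + (C * (S * p) + C * (S + S) * (K * p)) := by
      refine add_le_add (h₁.trans (by gcongr)) (h₂.trans ?_)
      gcongr
    _ = C * (S * p) * (2 + 2 * K) := by ring
    _ ≤ C * (S * p) * (4 * K) := by gcongr; linarith
    _ = _ := by ring

variable {T κ C : ℝ} {σ : ℝ → Euc m → Euc d →L[ℝ] Euc m}

/-- The difference of the increments of the second-order coefficient along two paths. -/
theorem SigmaBounds.norm_gubinelliCoeff_four_point_le (hσ : SigmaBounds T C σ) {K S s t : ℝ}
    (hs : s ∈ Icc 0 T) (ht : t ∈ Icc 0 T) (hst : s ≤ t) (h1 : t - s ≤ 1) (hK : 1 ≤ K)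
    {a c a' c' : Euc m}
    (hac : ‖c - a‖ ≤ K * (t - s) ^ (1 / 3 : ℝ)) (hac' : ‖c' - a'‖ ≤ K * (t - s) ^ (1 / 3 : ℝ))
    (haa : ‖a - a'‖ ≤ S) (hcc : ‖c - c'‖ ≤ S)
    (hS : ‖(c - a) - (c' - a')‖ ≤ S * (t - s) ^ (1 / 3 : ℝ)) :
    ‖(gubinelliCoeff σ t c - gubinelliCoeff σ s a) -
      (gubinelliCoeff σ t c' - gubinelliCoeff σ s a')‖ ≤
        12 * C ^ 2 * K * (S * (t - s) ^ (1 / 3 : ℝ)) := by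
  have hC0 : 0 ≤ C := (norm_nonneg _).trans (hσ.bound s hs a)
  have hS0 : 0 ≤ S := (norm_nonneg _).trans haa
  have hr := sub_nonneg.2 hst
  have hr2 := le_sq_rpow_third hr h1
  have hp1 : (t - s) ^ (1 / 3 : ℝ) ≤ 1 := Real.rpow_le_one hr h1 (by norm_num)
  have hp0 : 0 ≤ (t - s) ^ (1 / 3 : ℝ) := Real.rpow_nonneg hr _
  have ht₁ := fun x => hσ.time_deriv s hs t ht x hst
  have ht₂ := fun x => hσ.time_second s hs t ht x hst
  generalize (t - s) ^ (1 / 3 : ℝ) = p at *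
  have hpp : p ^ 2 ≤ p := by nlinarith
  have f₀ := norm_space_time_four_point_le (hσ.hasFDerivAt s hs) (hσ.hasFDerivAt t ht)
    (hσ.bound_deriv s hs) (hσ.lip_deriv s hs) (fun x => (ht₁ x).trans (by gcongr)) hK hac haa hcc
    hS hp0
  -- Here the time modulus of ∇²σ, of exponent 1/3, is used.
  have f₁ := norm_space_time_four_point_le (hσ.hasFDerivAt_deriv s hs) (hσ.hasFDerivAt_deriv t ht)
    (hσ.bound_second s hs) (hσ.lip_second s hs) ht₂ hK hac haa hcc hS hp0
  have d₁ : ‖fderiv ℝ (σ t) c' - fderiv ℝ (σ s) a'‖ ≤ 2 * C * K * p := by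
    have e : fderiv ℝ (σ t) c' - fderiv ℝ (σ s) a' =
      (fderiv ℝ (σ t) c' - fderiv ℝ (σ s) c') + (fderiv ℝ (σ s) c' - fderiv ℝ (σ s) a') := by abel
    rw [e]
    calc _ ≤ _ := norm_add_le _ _
      _ ≤ C * p + C * (K * p) := add_le_add ((ht₁ c').trans (by gcongr))
          ((hσ.lip_deriv s hs c' a').trans (by gcongr))
      _ = C * p * (1 + K) := by ring
      _ ≤ C * p * (2 * K) := by gcongr; linarith
      _ = _ := by ring
  have d₀ : ‖σ t c' - σ s a'‖ ≤ 2 * C * K * p := by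
    calc _ ≤ _ := hσ.norm_sub_le hs ht hst a' c'
      _ ≤ C * p + C * (K * p) := by gcongr; exact hr2.trans hpp
      _ = C * p * (1 + K) := by ring
      _ ≤ C * p * (2 * K) := by gcongr; linarith
      _ = _ := by ring
  -- The product rule for second-order increments, applied to ∇σ composed with σ.
  have e : (gubinelliCoeff σ t c - gubinelliCoeff σ s a) -
      (gubinelliCoeff σ t c' - gubinelliCoeff σ s a') =
      ((fderiv ℝ (σ t) c - fderiv ℝ (σ s) a) - (fderiv ℝ (σ t) c' - fderiv ℝ (σ s) a')).comp
        (σ t c) + (fderiv ℝ (σ t) c' - fderiv ℝ (σ s) a').comp (σ t c - σ t c') +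
      (fderiv ℝ (σ s) a).comp ((σ t c - σ s a) - (σ t c' - σ s a')) +
      (fderiv ℝ (σ s) a - fderiv ℝ (σ s) a').comp (σ t c' - σ s a') := by
    ext v w
    simp [gubinelliCoeff]
    abel
  rw [e]
  calc _ ≤ _ := norm_add₄_le
    _ ≤ (4 * C * K * (S * p)) * C + (2 * C * K * p) * (C * S) + C * (4 * C * K * (S * p)) +
        (C * S) * (2 * C * K * p) := by
      refine add_le_add (add_le_add (add_le_add
        ((ContinuousLinearMap.opNorm_comp_le _ _).trans ?_)
        ((ContinuousLinearMap.opNorm_comp_le _ _).trans ?_))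
        ((ContinuousLinearMap.opNorm_comp_le _ _).trans ?_))
        ((ContinuousLinearMap.opNorm_comp_le _ _).trans ?_)
      · exact mul_le_mul f₁ (hσ.bound t ht c) (norm_nonneg _) (by positivity)
      · exact mul_le_mul d₁ ((hσ.lip t ht c c').trans (by gcongr)) (norm_nonneg _) (by positivity)
      · exact mul_le_mul (hσ.bound_deriv s hs a) f₀ (norm_nonneg _) (by positivity)
      · exact mul_le_mul ((hσ.lip_deriv s hs a a').trans (by gcongr)) d₀ (norm_nonneg _)
          (by positivity)
    _ = _ := by ring

/-- The difference of the first-order remainders of `σ` along two controlled paths. -/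
theorem SigmaBounds.norm_remainder_sub_le (hσ : SigmaBounds T C σ) {K S s t : ℝ}
    (hs : s ∈ Icc 0 T) (ht : t ∈ Icc 0 T) (hst : s ≤ t) (hK : 1 ≤ K)
    {a c a' c' : Euc m} {v : Euc d}
    (hac : ‖c - a‖ ≤ K * (t - s) ^ (1 / 3 : ℝ)) (hac' : ‖c' - a'‖ ≤ K * (t - s) ^ (1 / 3 : ℝ))
    (haa : ‖a - a'‖ ≤ S) (hcc : ‖c - c'‖ ≤ S)
    (hS : ‖(c - a) - (c' - a')‖ ≤ S * (t - s) ^ (1 / 3 : ℝ))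
    (hv' : ‖c' - a' - σ s a' v‖ ≤ K * ((t - s) ^ (1 / 3 : ℝ)) ^ 2)
    (hSv : ‖(c - a - σ s a v) - (c' - a' - σ s a' v)‖ ≤ S * ((t - s) ^ (1 / 3 : ℝ)) ^ 2) :
    ‖(σ t c - σ s a - gubinelliCoeff σ s a v) - (σ t c' - σ s a' - gubinelliCoeff σ s a' v)‖ ≤
      8 * C * K ^ 2 * (S * ((t - s) ^ (1 / 3 : ℝ)) ^ 2) := by
  have hC0 : 0 ≤ C := (norm_nonneg _).trans (hσ.bound s hs a)
  have hS0 : 0 ≤ S := (norm_nonneg _).trans haa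
  have hr := sub_nonneg.2 hst
  have hp0 : 0 ≤ (t - s) ^ (1 / 3 : ℝ) := Real.rpow_nonneg hr _
  have ht₁ := fun x => hσ.time_deriv s hs t ht x hst
  generalize (t - s) ^ (1 / 3 : ℝ) = p at *
  -- The remainder needs order 2/3 together with a factor ‖c - c'‖, which is what the time modulus
  -- of ∇σ supplies.
  have h₁ : ‖(σ t c - σ s c) - (σ t c' - σ s c')‖ ≤ C * p ^ 2 * ‖c - c'‖ :=
    convex_univ.norm_image_sub_le_of_norm_hasFDerivWithin_le (f := fun x => σ t x - σ s x)
      (fun z _ => ((hσ.hasFDerivAt t ht z).sub (hσ.hasFDerivAt s hs z)).hasFDerivWithinAt)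
      (fun z _ => ht₁ z) trivial trivial
  have h₂ := norm_taylor_sub_taylor_le (hσ.hasFDerivAt s hs) (hσ.hasFDerivAt_deriv s hs)
    (hσ.bound_second s hs) (hσ.lip_deriv s hs) (hσ.lip_second s hs) c a c' a'
  have e : (σ t c - σ s a - gubinelliCoeff σ s a v) -
      (σ t c' - σ s a' - gubinelliCoeff σ s a' v) =
      ((σ t c - σ s c) - (σ t c' - σ s c')) +
      ((σ s c - σ s a - fderiv ℝ (σ s) a (c - a)) -
        (σ s c' - σ s a' - fderiv ℝ (σ s) a' (c' - a'))) +
      fderiv ℝ (σ s) a ((c - a - σ s a v) - (c' - a' - σ s a' v)) +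
      (fderiv ℝ (σ s) a - fderiv ℝ (σ s) a') (c' - a' - σ s a' v) := by
    simp only [gubinelliCoeff, map_sub, ContinuousLinearMap.comp_apply, sub_apply]
    abel
  rw [e]
  calc _ ≤ _ := norm_add₄_le
    _ ≤ C * p ^ 2 * S + (C * (K * p + K * p) * (S * p) + C * (S + 2 * S) * (K * p) ^ 2) +
        C * (S * p ^ 2) + (C * S) * (K * p ^ 2) := by
      refine add_le_add (add_le_add (add_le_add (h₁.trans (by gcongr)) (h₂.trans (by gcongr)))
        ((ContinuousLinearMap.le_opNorm _ _).trans ?_))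
        ((ContinuousLinearMap.le_opNorm _ _).trans ?_)
      · exact mul_le_mul (hσ.bound_deriv s hs a) hSv (norm_nonneg _) hC0
      · exact mul_le_mul ((hσ.lip_deriv s hs a a').trans (by gcongr)) hv' (norm_nonneg _)
          (by positivity)
    _ = C * (S * p ^ 2) * (2 + 3 * K + 3 * K ^ 2) := by ring
    _ ≤ C * (S * p ^ 2) * (8 * K ^ 2) := by gcongr; nlinarith
    _ = _ := by ring

/-- The difference of the increments of the second-order germs along two controlled paths. -/
theorem norm_germ_increment_sub_le {ζ : ℝ → Euc d} {ζ₂ : ℝ → ℝ → Fin d → Fin d → ℝ}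
    (hκ : 1 / 3 < κ) (hC : 1 ≤ C) (hζ : PathBounds m T κ C ζ ζ₂) (hσ : SigmaBounds T C σ)
    {K S s u t : ℝ} (hK : 1 ≤ K) (h0 : 0 ≤ s) (hsu : s ≤ u) (hut : u ≤ t) (htT : t ≤ T)
    (h1 : t - s ≤ 1) {a c a' c' : Euc m}
    (hac : ‖c - a‖ ≤ K * (u - s) ^ (1 / 3 : ℝ)) (hac' : ‖c' - a'‖ ≤ K * (u - s) ^ (1 / 3 : ℝ))
    (haa : ‖a - a'‖ ≤ S) (hcc : ‖c - c'‖ ≤ S)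
    (hS : ‖(c - a) - (c' - a')‖ ≤ S * (u - s) ^ (1 / 3 : ℝ))
    (hv' : ‖c' - a' - σ s a' (delta₁ ζ s u)‖ ≤ K * ((u - s) ^ (1 / 3 : ℝ)) ^ 2)
    (hSv : ‖(c - a - σ s a (delta₁ ζ s u)) - (c' - a' - σ s a' (delta₁ ζ s u))‖ ≤
      S * ((u - s) ^ (1 / 3 : ℝ)) ^ 2) :
    ‖((σ u c - σ s a - gubinelliCoeff σ s a (delta₁ ζ s u)) (delta₁ ζ u t) +
      contract (gubinelliCoeff σ u c - gubinelliCoeff σ s a) (ζ₂ u t)) -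
      ((σ u c' - σ s a' - gubinelliCoeff σ s a' (delta₁ ζ s u)) (delta₁ ζ u t) +
      contract (gubinelliCoeff σ u c' - gubinelliCoeff σ s a') (ζ₂ u t))‖ ≤
        20 * C ^ 3 * K ^ 2 * S * (t - s) ^ (2 / 3 + κ) := by
  have hs : s ∈ Icc 0 T := ⟨h0, by linarith⟩
  have hu : u ∈ Icc 0 T := ⟨by linarith, by linarith⟩
  have hsu0 : 0 ≤ u - s := sub_nonneg.2 hsu
  have hut0 : 0 ≤ t - u := sub_nonneg.2 hut
  have hst0 : 0 ≤ t - s := by linarith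
  have hS0 : 0 ≤ S := (norm_nonneg _).trans haa
  have n₁ := hσ.norm_remainder_sub_le hs hu hsu hK hac hac' haa hcc hS hv' hSv
  have n₂ := hσ.norm_gubinelliCoeff_four_point_le hs hu hsu (by linarith) hK hac hac' haa hcc hS
  rw [rpow_two_thirds_add hκ hst0, add_sub_add_comm, ← sub_apply, ← contract_sub_left]
  have hpp : (u - s) ^ (1 / 3 : ℝ) ≤ (t - s) ^ (1 / 3 : ℝ) :=
    Real.rpow_le_rpow hsu0 (by linarith) (by norm_num)
  have hqq : (t - u) ^ κ ≤ (t - s) ^ κ := Real.rpow_le_rpow hut0 (by linarith) (by linarith)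
  have hqp := rpow_le_rpow_third hκ hst0 h1
  have z₁ := hζ.path u t (by linarith) hut htT
  have z₂ := hζ.area u t (by linarith) hut htT ((gubinelliCoeff σ u c - gubinelliCoeff σ s a) -
    (gubinelliCoeff σ u c' - gubinelliCoeff σ s a'))
  have q0 : 0 ≤ (t - u) ^ κ := Real.rpow_nonneg hut0 _
  have p0 : 0 ≤ (u - s) ^ (1 / 3 : ℝ) := Real.rpow_nonneg hsu0 _
  clear hac hac' hS hv' hSv
  generalize (u - s) ^ (1 / 3 : ℝ) = p' at *
  generalize (t - s) ^ (1 / 3 : ℝ) = p at *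
  generalize (t - u) ^ κ = q' at *
  generalize (t - s) ^ κ = q at *
  have hq : 0 ≤ q := q0.trans hqq
  have hp : 0 ≤ p := p0.trans hpp
  have g0 := ((gubinelliCoeff σ u c - gubinelliCoeff σ s a) -
    (gubinelliCoeff σ u c' - gubinelliCoeff σ s a')).opNorm_nonneg
  calc _ ≤ _ := norm_add_le _ _
    _ ≤ (8 * C * K ^ 2 * (S * p ^ 2)) * (C * q) + C * (12 * C ^ 2 * K * (S * p)) * (q * p) := by
      refine add_le_add ((ContinuousLinearMap.le_opNorm _ _).trans ?_) (z₂.trans ?_)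
      · refine mul_le_mul (n₁.trans ?_) (z₁.trans ?_) (norm_nonneg _) (by positivity)
        · gcongr
        · gcongr
      · have h₁ : q' ^ 2 ≤ q * p := by rw [pow_two]; gcongr; exact hqq.trans hqp
        have h₂ := n₂.trans (by gcongr : 12 * C ^ 2 * K * (S * p') ≤ 12 * C ^ 2 * K * (S * p))
        gcongr
    _ = (8 * C ^ 2 * K ^ 2 + 12 * C ^ 3 * K) * (S * (p ^ 2 * q)) := by ring
    _ ≤ (8 * C ^ 3 * K ^ 2 + 12 * C ^ 3 * K ^ 2) * (S * (p ^ 2 * q)) := by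
      have k : K ≤ K ^ 2 := by nlinarith
      gcongr
      norm_num
    _ = _ := by ring

end FourPoint

/-! ### Contraction and uniqueness -/

section Uniqueness

variable {m d : ℕ} {T α κ C : ℝ} {ζ : ℝ → Euc d} {ζ₂ : ℝ → ℝ → Fin d → Fin d → ℝ}
  {B : ℝ → Euc m → Euc m} {σ : ℝ → Euc m → Euc d →L[ℝ] Euc m}

/-- A priori bounds, with constant `K`, on a solution. -/
structure SolutionBounds (T κ K : ℝ) (ζ : ℝ → Euc d) (ζ₂ : ℝ → ℝ → Fin d → Fin d → ℝ)
    (B : ℝ → Euc m → Euc m) (σ : ℝ → Euc m → Euc d →L[ℝ] Euc m) (x : ℝ → Euc m) : Prop where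
  continuousOn : ContinuousOn x (Icc 0 T)
  increment : ∀ s t : ℝ, 0 ≤ s → s ≤ t → t ≤ T → t - s ≤ 1 →
    ‖x t - x s‖ ≤ K * (t - s) ^ (1 / 3 : ℝ)
  remainder : ∀ s t : ℝ, 0 ≤ s → s ≤ t → t ≤ T → t - s ≤ 1 →
    ‖x t - x s - σ s (x s) (delta₁ ζ s t)‖ ≤ K * ((t - s) ^ (1 / 3 : ℝ)) ^ 2
  defect : ∀ s t : ℝ, 0 ≤ s → s ≤ t → t ≤ T →
    ‖equationDefect ζ ζ₂ B σ x s t‖ ≤ K * (t - s) ^ (3 * κ)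

theorem SolutionBounds.mono {K K' : ℝ} {x : ℝ → Euc m}
    (h : SolutionBounds T κ K ζ ζ₂ B σ x) (hK : K ≤ K') : SolutionBounds T κ K' ζ ζ₂ B σ x := by
  refine ⟨h.continuousOn, fun s t h0 hst htT h1 => (h.increment s t h0 hst htT h1).trans ?_,
    fun s t h0 hst htT h1 => (h.remainder s t h0 hst htT h1).trans ?_,
    fun s t h0 hst htT => (h.defect s t h0 hst htT).trans ?_⟩
  all_goals
    have := sub_nonneg.2 hst
    gcongr

/-- Exponent κ is deliberately weakened to 1/3, to leave room for the contraction. The defect of a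
solution is its sewing term, because x^ζ = σ(x) makes the two expansions agree. -/
theorem IsSolution.exists_solutionBounds (hκ : 1 / 3 < κ) {y : Euc m} {x : ℝ → Euc m}
    {x' : ℝ → Euc d →L[ℝ] Euc m} (h : IsSolution T κ ζ ζ₂ B σ y x x') :
    ∃ K : ℝ, 1 ≤ K ∧ SolutionBounds T κ K ζ ζ₂ B σ x := by
  obtain ⟨H, hH0, hH⟩ := IsHolder₂.exists_nonneg h.controlled.holder
  obtain ⟨R, hR0, hR⟩ := h.controlled.holder_remainder.exists_nonneg
  obtain ⟨-, -, g, ⟨hg, -⟩, hexp⟩ := h.primitive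
  obtain ⟨G, hG0, hG⟩ := hg.exists_nonneg
  have hgx : ∀ s t : ℝ, 0 ≤ s → s ≤ t → t ≤ T → equationDefect ζ ζ₂ B σ x s t = g s t := by
    intro s t h0 hst htT
    have e := hexp s t h0 hst htT
    beta_reduce at e
    rw [h.deriv_eq s ⟨h0, hst.trans htT⟩] at e
    simp only [equationDefect, gubinelliCoeff, e]
    abel
  refine ⟨H + R + G + 1, by linarith, h.controlled.holder.continuousOn (by linarith),
    fun s t h0 hst htT h1 => ?_, fun s t h0 hst htT h1 => ?_, fun s t h0 hst htT => ?_⟩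
  · have hr := sub_nonneg.2 hst
    have hqp := rpow_le_rpow_third hκ hr h1
    have hp : 0 ≤ (t - s) ^ (1 / 3 : ℝ) := Real.rpow_nonneg hr _
    refine (hH s t h0 hst htT).trans ?_
    gcongr
    linarith
  · have hr := sub_nonneg.2 hst
    have hqp := rpow_le_rpow_third hκ hr h1
    have hq : 0 ≤ (t - s) ^ κ := Real.rpow_nonneg hr _
    have hp : 0 ≤ (t - s) ^ (1 / 3 : ℝ) := Real.rpow_nonneg hr _
    have b := hR s t h0 hst htT
    rw [RoughControl.remainder, h.deriv_eq s ⟨h0, hst.trans htT⟩, mul_comm 2 κ, Real.rpow_mul hr,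
      Real.rpow_two] at b
    refine b.trans ?_
    gcongr
    linarith
  · have hr := sub_nonneg.2 hst
    rw [hgx s t h0 hst htT]
    refine (hG s t h0 hst htT).trans ?_
    gcongr
    linarith

/-- The drift integral is additive along the path and drops out, unlike the frozen one in
`delta₂_eulerDefect`. -/
theorem delta₂_equationDefect (hR : IsRoughPath T α ζ ζ₂) (hB : DriftBounds T C B)
    {x : ℝ → Euc m} (hx : ContinuousOn x (Icc 0 T))
    {s u t : ℝ} (h0 : 0 ≤ s) (hsu : s ≤ u) (hut : u ≤ t) (htT : t ≤ T) :
    delta₂ (equationDefect ζ ζ₂ B σ x) s u t =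
      (σ u (x u) - σ s (x s) - gubinelliCoeff σ s (x s) (delta₁ ζ s u)) (delta₁ ζ u t) +
        contract (gubinelliCoeff σ u (x u) - gubinelliCoeff σ s (x s)) (ζ₂ u t) := by
  have h := delta₂_germ hR (fun s => σ s (x s)) (fun s => gubinelliCoeff σ s (x s)) h0 hsu hut htT
  have hη := hB.continuousOn_comp hx
  have hI := intervalIntegral.integral_add_adjacent_intervals
    ((hη.mono (Icc_subset_Icc h0 (hut.trans htT))).intervalIntegrable_of_Icc (μ := volume) hsu)
    ((hη.mono (Icc_subset_Icc (h0.trans hsu) htT)).intervalIntegrable_of_Icc (μ := volume) hut)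
  simp only [remainder, delta₁] at h
  rw [← neg_eq_iff_eq_neg] at h
  simp only [delta₁]
  rw [← h]
  simp only [delta₂, equationDefect, ← hI, delta₁]
  abel

/-- The two paths `x` and `z` are `S`-close on `[a, b]`, in the sense of controlled paths. -/
structure ControlledClose (ζ : ℝ → Euc d) (σ : ℝ → Euc m → Euc d →L[ℝ] Euc m) (a b S : ℝ)
    (x z : ℝ → Euc m) : Prop where
  sup : ∀ t ∈ Icc a b, ‖x t - z t‖ ≤ S
  increment : ∀ s t : ℝ, a ≤ s → s ≤ t → t ≤ b →
    ‖(x t - x s) - (z t - z s)‖ ≤ S * (t - s) ^ (1 / 3 : ℝ)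
  remainder : ∀ s t : ℝ, a ≤ s → s ≤ t → t ≤ b →
    ‖(x t - x s - σ s (x s) (delta₁ ζ s t)) - (z t - z s - σ s (z s) (delta₁ ζ s t))‖ ≤
      S * ((t - s) ^ (1 / 3 : ℝ)) ^ 2

/-- Trading exponent κ for 1/3 gains the small factor l, the source of the contraction. -/
theorem rpow_le_mul_of_le {p r l : ℝ} (hκ : 1 / 3 < κ) (hr : 0 ≤ r) (hl : r ^ (κ - 1 / 3) ≤ l)
    (hp : r ^ (1 / 3 : ℝ) = p) : r ^ κ ≤ l * p := by
  have : r ^ κ = r ^ (κ - 1 / 3) * r ^ (1 / 3 : ℝ) := by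
    rw [← Real.rpow_add_of_nonneg hr (by linarith) (by norm_num)]; ring_nf
  rw [this, hp]
  have : 0 ≤ p := hp ▸ Real.rpow_nonneg hr _
  gcongr

/-- Solutions with the same initial value contract towards each other on short intervals. -/
theorem ControlledClose.contract (hκ : 1 / 3 < κ) (hκ' : κ ≤ 1 / 2) (hC : 1 ≤ C)
    (hR : IsRoughPath T α ζ ζ₂) (hζ : PathBounds m T κ C ζ ζ₂) (hσ : SigmaBounds T C σ)
    (hB : DriftBounds T C B) {K : ℝ} (hK : 1 ≤ K) {x z : ℝ → Euc m}
    (hx : SolutionBounds T κ K ζ ζ₂ B σ x) (hz : SolutionBounds T κ K ζ ζ₂ B σ z) :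
    ∃ τ : ℝ, 0 < τ ∧ τ ≤ 1 ∧ ∀ a b S : ℝ, 0 ≤ a → b ≤ T → b - a ≤ τ → x a = z a →
      ControlledClose ζ σ a b S x z → ControlledClose ζ σ a b (S / 2) x z := by
  set N := 20 * C ^ 3 * K ^ 2 / (1 - 2 * (1 / 2) ^ (2 / 3 + κ)) with hN
  have hhalf := two_mul_half_rpow_lt_one (show 1 < 2 / 3 + κ by linarith)
  have hN0 : 0 ≤ N := div_nonneg (by positivity) (by linarith)
  set c := C ^ 2 + 2 * C ^ 3 + C + N with hc
  have hc1 : 1 ≤ c := by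
    have : 0 ≤ C ^ 2 + 2 * C ^ 3 := by positivity
    linarith
  -- `c` dominates the sum of all constants below, so that c l = 1/2. The length τ is then chosen to
  -- make r^(κ - 1/3) ≤ l for r ≤ τ.
  set l := 1 / (2 * c) with hl
  have hl0 : 0 < l := by positivity
  have hl1 : l ≤ 1 := by rw [hl, div_le_one (by positivity)]; linarith
  have hcl : c * l = 1 / 2 := by rw [hl]; field_simp
  refine ⟨l ^ (1 / (κ - 1 / 3)), Real.rpow_pos_of_pos hl0 _, Real.rpow_le_one hl0.le hl1
    (one_div_nonneg.2 (by linarith)), fun a b S ha hbT hab hxz h => ?_⟩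
  have hab1 : b - a ≤ 1 := hab.trans (Real.rpow_le_one hl0.le hl1 (one_div_nonneg.2 (by linarith)))
  have hlr : ∀ r : ℝ, 0 ≤ r → r ≤ b - a → r ^ (κ - 1 / 3) ≤ l := by
    intro r hr0 hr
    calc r ^ (κ - 1 / 3) ≤ (l ^ (1 / (κ - 1 / 3))) ^ (κ - 1 / 3) :=
          Real.rpow_le_rpow hr0 (hr.trans hab) (by linarith)
      _ = l := by
        rw [← Real.rpow_mul hl0.le, one_div_mul_cancel (by linarith), Real.rpow_one]
  have hdef : ∀ s t : ℝ, a ≤ s → s ≤ t → t ≤ b →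
      ‖equationDefect ζ ζ₂ B σ x s t - equationDefect ζ ζ₂ B σ z s t‖ ≤
        N * S * (t - s) ^ (2 / 3 + κ) := by
    intro s t hs hst ht
    -- The difference of the defects is of order 3κ > 1 with a constant independent of S. Sewing
    -- replaces that constant by one proportional to S.
    have hS0 : 0 ≤ S := (norm_nonneg _).trans (h.sup s ⟨hs, hst.trans ht⟩)
    have key := norm_le_of_delta₂_le (a := a) (b := b) (μ := 3 * κ) (ν := 2 / 3 + κ) (K := K + K)
      (N := 20 * C ^ 3 * K ^ 2 * S)
      (g := fun s t => equationDefect ζ ζ₂ B σ x s t - equationDefect ζ ζ₂ B σ z s t)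
      (by linarith) (by linarith) (by positivity) (fun s t hs hst ht => ?_)
      (fun s u t hs hsu hut ht => ?_) s t hs hst ht
    · refine key.trans (le_of_eq ?_)
      rw [hN]; ring
    · rw [add_mul]
      exact (norm_sub_le _ _).trans (add_le_add (hx.defect s t (ha.trans hs) hst (ht.trans hbT))
        (hz.defect s t (ha.trans hs) hst (ht.trans hbT)))
    · have e : delta₂ (fun s t => equationDefect ζ ζ₂ B σ x s t - equationDefect ζ ζ₂ B σ z s t)
          s u t = delta₂ (equationDefect ζ ζ₂ B σ x) s u t -
            delta₂ (equationDefect ζ ζ₂ B σ z) s u t := by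
        simp only [delta₂]; abel
      have h0 := ha.trans hs
      have htT := ht.trans hbT
      rw [e, delta₂_equationDefect hR hB hx.continuousOn h0 hsu hut htT,
        delta₂_equationDefect hR hB hz.continuousOn h0 hsu hut htT]
      exact norm_germ_increment_sub_le hκ hC hζ hσ hK h0 hsu hut htT (by linarith)
        (hx.increment s u h0 hsu (hut.trans htT) (by linarith))
        (hz.increment s u h0 hsu (hut.trans htT) (by linarith))
        (h.sup s ⟨hs, by linarith⟩) (h.sup u ⟨by linarith, by linarith⟩)
        (h.increment s u hs hsu (hut.trans ht))
        (hz.remainder s u h0 hsu (hut.trans htT) (by linarith))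
        (h.remainder s u hs hsu (hut.trans ht))
  have hrem : ∀ s t : ℝ, a ≤ s → s ≤ t → t ≤ b →
      ‖(x t - x s - σ s (x s) (delta₁ ζ s t)) - (z t - z s - σ s (z s) (delta₁ ζ s t))‖ ≤
        (2 * C ^ 3 + C + N) * l * S * ((t - s) ^ (1 / 3 : ℝ)) ^ 2 := by
    intro s t hs hst ht
    have h0 := ha.trans hs
    have htT := ht.trans hbT
    have hsT : s ∈ Icc 0 T := ⟨h0, hst.trans htT⟩
    have hS := h.sup s ⟨hs, hst.trans ht⟩
    have hS0 : 0 ≤ S := (norm_nonneg _).trans hS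
    have hr0 := sub_nonneg.2 hst
    have hd := hdef s t hs hst ht
    rw [rpow_two_thirds_add hκ hr0] at hd
    have hG := hσ.norm_gubinelliCoeff_sub_le hsT hsT le_rfl (z s) (x s)
    rw [sub_self, Real.zero_rpow (by norm_num)] at hG
    have ha' := hζ.area s t h0 hst htT (gubinelliCoeff σ s (x s) - gubinelliCoeff σ s (z s))
    have hi := hB.norm_integral_sub_le h0 hst htT hx.continuousOn hz.continuousOn (by linarith)
      (K := S) fun v hv => h.sup v ⟨hs.trans hv.1, hv.2.trans ht⟩
    have e : (x t - x s - σ s (x s) (delta₁ ζ s t)) - (z t - z s - σ s (z s) (delta₁ ζ s t)) =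
        RoughControl.contract (gubinelliCoeff σ s (x s) - gubinelliCoeff σ s (z s)) (ζ₂ s t) +
        ((∫ v in s..t, B v (x v)) - ∫ v in s..t, B v (z v)) +
        (equationDefect ζ ζ₂ B σ x s t - equationDefect ζ ζ₂ B σ z s t) := by
      simp only [equationDefect, contract_sub_left, delta₁]; abel
    have hp1 : (t - s) ^ (1 / 3 : ℝ) ≤ 1 := Real.rpow_le_one hr0 (by linarith) (by norm_num)
    have hp0 : 0 ≤ (t - s) ^ (1 / 3 : ℝ) := Real.rpow_nonneg hr0 _
    have hq0 : 0 ≤ (t - s) ^ κ := Real.rpow_nonneg hr0 _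
    have hql := rpow_le_mul_of_le hκ hr0 (hlr _ hr0 (by linarith)) rfl
    have hqp := rpow_le_rpow_third hκ hr0 (by linarith)
    have hrq := sq_rpow_third_le hκ hκ' hr0 (by linarith)
    have h3 := cube_rpow_third hr0
    generalize (t - s) ^ (1 / 3 : ℝ) = p at *
    generalize (t - s) ^ κ = q at *
    have hql' : q ≤ l := hql.trans (mul_le_of_le_one_right hl0.le hp1)
    have hq2 : q ^ 2 ≤ l * p ^ 2 := by
      calc q ^ 2 = q * q := pow_two q
        _ ≤ (l * p) * p := by gcongr
        _ = _ := by ring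
    have hr' : t - s ≤ l * p ^ 2 := by
      calc t - s = p ^ 2 * p := by rw [← h3]; ring
        _ ≤ q * p := by gcongr
        _ ≤ (l * p) * p := by gcongr
        _ = _ := by ring
    rw [e]
    calc _ ≤ _ := norm_add₃_le
      _ ≤ C * (C ^ 2 * (2 * S)) * (l * p ^ 2) + C * S * (l * p ^ 2) + N * S * (p ^ 2 * l) := by
        refine add_le_add (add_le_add (ha'.trans ?_) (hi.trans ?_)) (hd.trans ?_)
        · have g0 := (gubinelliCoeff σ s (x s) - gubinelliCoeff σ s (z s)).opNorm_nonneg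
          have : ‖gubinelliCoeff σ s (x s) - gubinelliCoeff σ s (z s)‖ ≤ C ^ 2 * (2 * S) := by
            refine hG.trans ?_
            norm_num
            gcongr
          gcongr
        · gcongr
        · gcongr
      _ = _ := by ring
  have hinc : ∀ s t : ℝ, a ≤ s → s ≤ t → t ≤ b →
      ‖(x t - x s) - (z t - z s)‖ ≤ S / 2 * (t - s) ^ (1 / 3 : ℝ) := by
    intro s t hs hst ht
    have h0 := ha.trans hs
    have htT := ht.trans hbT
    have hsT : s ∈ Icc 0 T := ⟨h0, hst.trans htT⟩
    have hS := h.sup s ⟨hs, hst.trans ht⟩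
    have hS0 : 0 ≤ S := (norm_nonneg _).trans hS
    have hr0 := sub_nonneg.2 hst
    have hp1 : (t - s) ^ (1 / 3 : ℝ) ≤ 1 := Real.rpow_le_one hr0 (by linarith) (by norm_num)
    have hp0 : 0 ≤ (t - s) ^ (1 / 3 : ℝ) := Real.rpow_nonneg hr0 _
    have hql := rpow_le_mul_of_le hκ hr0 (hlr _ hr0 (by linarith)) rfl
    have z₁ := hζ.path s t h0 hst htT
    have hr := hrem s t hs hst ht
    have e : (x t - x s) - (z t - z s) = (σ s (x s) - σ s (z s)) (delta₁ ζ s t) +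
        ((x t - x s - σ s (x s) (delta₁ ζ s t)) - (z t - z s - σ s (z s) (delta₁ ζ s t))) := by
      rw [sub_apply]; abel
    generalize (t - s) ^ (1 / 3 : ℝ) = p at *
    rw [e]
    calc _ ≤ _ := norm_add_le _ _
      _ ≤ (C * S) * (C * (l * p)) + (2 * C ^ 3 + C + N) * l * S * p := by
        refine add_le_add ((ContinuousLinearMap.le_opNorm _ _).trans ?_) (hr.trans ?_)
        · exact mul_le_mul ((hσ.lip s hsT _ _).trans (by gcongr)) (z₁.trans (by gcongr))
            (norm_nonneg _) (by positivity)
        · have : p ^ 2 ≤ p := by nlinarith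
          gcongr
      _ = (c * l) * S * p := by rw [hc]; ring
      _ = _ := by rw [hcl]; ring
  refine ⟨fun t ht => ?_, hinc, fun s t hs hst ht => (hrem s t hs hst ht).trans ?_⟩
  -- The paths agree at `a`, so their distance is a difference of increments.
  · have h₁ := hinc a t le_rfl ht.1 ht.2
    have hS0 : 0 ≤ S := (norm_nonneg _).trans (h.sup t ht)
    have e : x t - z t = (x t - x a) - (z t - z a) := by rw [hxz]; abel
    rw [e]
    refine h₁.trans (mul_le_of_le_one_right (by positivity) ?_)
    exact Real.rpow_le_one (sub_nonneg.2 ht.1) (by linarith [ht.2]) (by norm_num)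
  · have hS0 : 0 ≤ S := (norm_nonneg _).trans (h.sup s ⟨hs, hst.trans ht⟩)
    gcongr
    calc (2 * C ^ 3 + C + N) * l * S ≤ c * l * S := by
          gcongr
          rw [hc]
          have := sq_nonneg C
          linarith
      _ = S / 2 := by rw [hcl]; ring

/-- Starts the iteration of the contraction: the two a priori bounds add up to 2K. -/
theorem SolutionBounds.controlledClose {K : ℝ} (hK : 1 ≤ K) {x z : ℝ → Euc m}
    (hx : SolutionBounds T κ K ζ ζ₂ B σ x) (hz : SolutionBounds T κ K ζ ζ₂ B σ z) {a b : ℝ}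
    (ha : 0 ≤ a) (hbT : b ≤ T) (hab : b - a ≤ 1) (hxz : x a = z a) :
    ControlledClose ζ σ a b (2 * K) x z := by
  have hinc : ∀ s t : ℝ, a ≤ s → s ≤ t → t ≤ b →
      ‖(x t - x s) - (z t - z s)‖ ≤ 2 * K * (t - s) ^ (1 / 3 : ℝ) := by
    intro s t hs hst ht
    rw [two_mul, add_mul]
    exact (norm_sub_le _ _).trans (add_le_add
      (hx.increment s t (ha.trans hs) hst (ht.trans hbT) (by linarith))
      (hz.increment s t (ha.trans hs) hst (ht.trans hbT) (by linarith)))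
  refine ⟨fun t ht => ?_, hinc, fun s t hs hst ht => ?_⟩
  · have e : x t - z t = (x t - x a) - (z t - z a) := by rw [hxz]; abel
    rw [e]
    refine (hinc a t le_rfl ht.1 ht.2).trans (mul_le_of_le_one_right (by positivity) ?_)
    exact Real.rpow_le_one (sub_nonneg.2 ht.1) (by linarith [ht.2]) (by norm_num)
  · rw [two_mul, add_mul]
    exact (norm_sub_le _ _).trans (add_le_add
      (hx.remainder s t (ha.trans hs) hst (ht.trans hbT) (by linarith))
      (hz.remainder s t (ha.trans hs) hst (ht.trans hbT) (by linarith)))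

/-- Solutions with the same initial value coincide. -/
theorem SolutionBounds.eqOn (hκ : 1 / 3 < κ) (hκ' : κ ≤ 1 / 2) (hC : 1 ≤ C)
    (hR : IsRoughPath T α ζ ζ₂) (hζ : PathBounds m T κ C ζ ζ₂) (hσ : SigmaBounds T C σ)
    (hB : DriftBounds T C B) {K : ℝ} (hK : 1 ≤ K) {x z : ℝ → Euc m}
    (hx : SolutionBounds T κ K ζ ζ₂ B σ x) (hz : SolutionBounds T κ K ζ ζ₂ B σ z)
    (h0 : x 0 = z 0) : ∀ t ∈ Icc 0 T, x t = z t := by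
  obtain ⟨τ, hτ0, hτ1, H⟩ := ControlledClose.contract hκ hκ' hC hR hζ hσ hB hK hx hz
  have step : ∀ a b : ℝ, 0 ≤ a → a ≤ b → b ≤ T → b - a ≤ τ → x a = z a → x b = z b := by
    intro a b ha hab hbT hτ hxz
    have hn : ∀ n : ℕ, ControlledClose ζ σ a b (2 * K * (1 / 2) ^ n) x z := by
      intro n
      induction n with
      | zero => simpa using hx.controlledClose hK hz ha hbT (hτ.trans hτ1) hxz
      | succ n ih =>
        have := H a b _ ha hbT hτ hxz ih
        rw [pow_succ]
        convert this using 1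
        ring
    have lim : Filter.Tendsto (fun n : ℕ => 2 * K * (1 / 2 : ℝ) ^ n) Filter.atTop
        (𝓝 (2 * K * 0)) :=
      (tendsto_pow_atTop_nhds_zero_of_lt_one (by norm_num) (by norm_num)).const_mul _
    rw [mul_zero] at lim
    have : ‖x b - z b‖ ≤ 0 := ge_of_tendsto' lim fun n => (hn n).sup b ⟨hab, le_rfl⟩
    exact sub_eq_zero.1 (norm_le_zero_iff.1 this)
  -- The length τ does not depend on the starting time, so finitely many intervals cover [0, T].
  have hn : ∀ n : ℕ, ∀ t ∈ Icc 0 T, t ≤ n * τ → x t = z t := by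
    intro n
    induction n with
    | zero =>
      intro t ht htn
      have : t = 0 := le_antisymm (by simpa using htn) ht.1
      rw [this, h0]
    | succ n ih =>
      intro t ht htn
      push_cast at htn
      rcases le_or_gt t (n * τ) with h | h
      · exact ih t ht h
      · exact step (n * τ) t (by positivity) h.le ht.2 (by linarith)
          (ih _ ⟨by positivity, h.le.trans ht.2⟩ le_rfl)
  intro t ht
  obtain ⟨n, hn'⟩ := exists_nat_ge (t / τ)
  exact hn n t ht ((div_le_iff₀ hτ0).1 hn')

theorem IsSolution.unique (hκ : 1 / 3 < κ) (hκ' : κ ≤ 1 / 2) (hC : 1 ≤ C)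
    (hR : IsRoughPath T α ζ ζ₂) (hζ : PathBounds m T κ C ζ ζ₂) (hσ : SigmaBounds T C σ)
    (hB : DriftBounds T C B) {y : Euc m} {x z : ℝ → Euc m} {x' z' : ℝ → Euc d →L[ℝ] Euc m}
    (hx : IsSolution T κ ζ ζ₂ B σ y x x') (hz : IsSolution T κ ζ ζ₂ B σ y z z') :
    ∀ t ∈ Icc 0 T, z t = x t ∧ z' t = x' t := by
  obtain ⟨K₁, hK₁, h₁⟩ := hx.exists_solutionBounds hκ
  obtain ⟨K₂, hK₂, h₂⟩ := hz.exists_solutionBounds hκ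
  intro t ht
  have h := SolutionBounds.eqOn hκ hκ' hC hR hζ hσ hB (hK₁.trans (le_max_left K₁ K₂))
    (h₂.mono (le_max_right _ _)) (h₁.mono (le_max_left _ _)) (hz.initial.trans hx.initial.symm) t ht
  exact ⟨h, by rw [hx.deriv_eq t ht, hz.deriv_eq t ht, h]⟩

end Uniqueness

end RoughControl

/-! ### The theorem -/

open RoughControl in
theorem mainTheorem3 {m d k : ℕ} {T : ℝ} (hT : 0 < T)
    {U : Type*} [MetricSpace U] [MeasurableSpace U] [BorelSpace U]
    (ι : U → Euc k) (hι : Topology.IsEmbedding ι)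
    {α : ℝ} (hα : 1 / 3 < α)
    (ζ : ℝ → Euc d) (ζ₂ : ℝ → ℝ → Fin d → Fin d → ℝ) (hζ : IsRoughPath T α ζ ζ₂)
    (K : Set (P₂ U)) (hK : @IsCompact _ (w₂Topology U) K)
    (γ : ℝ → P₂ U) {ε L : ℝ} (hε : 0 < ε) (hL : 0 < L) (hγ : γ ∈ controlPaths T K ε L)
    (b : ℝ → Euc m → U → Euc m) (hb : IsCb011 ι T b) (hb' : IsUniformlyContinuousInTime T b)
    (σ : ℝ → Euc m → Euc d →L[ℝ] Euc m) (hσ : IsCb1 3 T σ)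
    (y : Euc m) {κ : ℝ} (hκ : 1 / 3 < κ) (hκα : κ < α) (hκ' : κ ≤ 1 / 2) :
    ∃ (x : ℝ → Euc m) (x' : ℝ → Euc d →L[ℝ] Euc m),
      IsSolution T κ ζ ζ₂ (relaxedDrift b γ) σ y x x' ∧
      IsHolder₁ T (min α 1) x ∧
      ∀ (z : ℝ → Euc m) (z' : ℝ → Euc d →L[ℝ] Euc m),
        IsSolution T κ ζ ζ₂ (relaxedDrift b γ) σ y z z' →
          ∀ t ∈ Set.Icc 0 T, z t = x t ∧ z' t = x' t := by
  obtain ⟨C₁, hC₁, h₁⟩ := hσ.exists_bounds hT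
  obtain ⟨C₂, hC₂, h₂⟩ := hb.exists_driftBounds hι hT hε hγ hb'
  obtain ⟨C₃, hC₃, h₃⟩ := hζ.exists_pathBounds (m := m) (κ := κ) (by linarith) hκα.le
  have hC : 1 ≤ C₁ + C₂ + C₃ := by linarith
  have hB := h₂.mono (show C₂ ≤ C₁ + C₂ + C₃ by linarith)
  have hS : SigmaBounds T (C₁ + C₂ + C₃) σ := h₁.mono (by linarith)
  have hP := h₃.mono (show C₃ ≤ C₁ + C₂ + C₃ by linarith)
  obtain ⟨x, hx0, hx⟩ := exists_isHolder₂_equationDefect hκ hκ' hC hζ hP hS hB y hT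
  obtain ⟨hsol, hreg⟩ := isSolution_of_equationDefect hζ hκ hκα.le hκ' (by linarith) hS hB hx0
    (by linarith) hx
  exact ⟨x, _, hsol, hreg, fun z z' hz => hsol.unique hκ hκ' hC hζ hP hS hB hz⟩
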